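/- **Setting.** Let $I\subseteq\mathbb R$ be an interval of positive, possibly infinite, length, and let $\mathfrak F=\bigoplus_{n\ge 0}L^2_{\rm sym}(I^n)$ be the bosonic Fock space over $L^2(I)$, with vacuum $|\Omega\rangle$, field operators $\psi(x),\psi^\dagger(x)$, and the dense subspace $\mathfrak F_0$ of vectors with finitely many nonzero $n$-particle components. For $\Phi\in\mathfrak F$ put $\langle\Omega|\psi(x_1)\cdots\psi(x_n)|\Phi\rangle=\sqrt{n!}\,\Phi_n(x_1,\dots,x_n)$. Tensors of bond dimension $D$ are $B\in M_D(\mathbb C)$ and functions $Q,L,R,T:I\to M_D(\mathbb C)$ with $Q\in L^1$, $L,R\in L^2$, $T\in L^\infty$. Let $V_x^y=\mathcal P\exp\int_x^yQ=\sum_k\int_{x<z_1<\dots<z_k<y}Q(z_1)\cdots Q(z_k)\,dz$, let $K^L=L$, $K^R=R$, $K^A=T$, and for $x_1\le\dots\le x_j$ in $I$ and $\alpha\in\{L,R,A\}^j$ let $$c_\alpha(x)=\mathrm{Tr}\big(B\,V_-^{1}K^{\alpha_1}(x_1)V_1^{2}K^{\alpha_2}(x_2)\cdots K^{\alpha_j}(x_j)V_j^{+}\big),$$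 where $V_i^{i+1}=V_{x_i}^{x_{i+1}}$ and $V_-^{1}$, $V_j^{+}$ start, respectively end, at the left, respectively right, end of $I$. The cMPO $O[B,Q,L,R,T]=\mathrm{Tr}_D\big(B\,\mathcal P e^{\int_I dx\,(Q\otimes\mathrm{Id}+L\otimes l_x+R\otimes r_x+T\otimes\mathrm{Ad}_x)}\big)(|\Omega\rangle\langle\Omega|)$, with $l_x[\cdot]=\psi^\dagger(x)[\cdot]$, $r_x[\cdot]=[\cdot]\psi(x)$, $\mathrm{Ad}_x[\cdot]=\psi^\dagger(x)[\cdot]\psi(x)$, is the operator on $\mathfrak F$ with domain $\mathfrak F_0$ and matrix elements, for $\Phi,\Psi\in\mathfrak F_0$, $$\langle\Phi,O\Psi\rangle=\sum_{j\ge 0}\ \sum_{\alpha\in\{L,R,A\}^j}\ \int_{x_1<\dots<x_j}c_\alpha(x)\,\Big\langle\Phi\Big|\prod_{i:\alpha_i\in\{L,A\}}\psi^\dagger(x_i)\Big|\Omega\Big\rangle\Big\langle\Omega\Big|\prod_{i:\alpha_i\in\{R,A\}}\psi(x_i)\Big|\Psi\Big\rangle\,dx .$$ $O$ is called unitary if it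 is the restriction to $\mathfrak F_0$ of a unitary operator on $\mathfrak F$. For an operator $A$ whose domain contains $\mathfrak F_0$, "$A^\dagger A$ is the cMPO with tensors $(B',Q',L',R',T')$" means that $\langle A\Phi,A\Psi\rangle$ equals the matrix element of that cMPO for all $\Phi,\Psi\in\mathfrak F_0$. **Lemma.** Given tensors $B,Q,L,R,T$ of bond dimension $D$, there is exactly one operator $O=O[B,Q,L,R,T]$ as above. $O^\dagger O$ and $OO^\dagger$ (the case $A=O^\dagger$, the Hilbert space adjoint) are cMPOs of bond dimension at most $D^2$: tensors for them are given by the product rule $B=B_1\otimes B_2$, $T=T_1\otimes T_2$, $Q=Q_1\otimes 1+1\otimes Q_2+R_1\otimes L_2$, $L=L_1\otimes 1+T_1\otimes L_2$, $R=1\otimes R_2+R_1\otimes T_2$, where $O^\dagger$ has the tensors $\bar B,\bar Q,\bar R,\bar L,\bar T$ (entrywise conjugates, $L$ and $R$ exchanged). Moreover, let $(B_+,Q_+,L_+,R_+,T_+)$ and $(B_-,Q_-,L_-,R_-,T_-)$ be any tensors, of any bond dimensions, such that $O^\dagger O$ and $OO^\dagger$ are the cMPOs with these tensors, and let $c_{\alpha,\pm}$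 be their coefficients. Then $O$ is unitary if and only if, for both signs, all $j\ge 0$ and all $\alpha\in\{L,R,A\}^j$, $$c_{\alpha,\pm}(x_1,\dots,x_j)=\begin{cases}1&\text{if }\alpha_k=A\text{ for all }k,\\ 0&\text{if }\alpha_k\in\{L,R\}\text{ for some }k,\end{cases}$$ for almost all $x_1<\dots<x_j$ in $I$. If in addition $L_\pm,R_\pm,T_\pm$ are continuous on $I$, then $O$ is unitary if and only if this identity holds for every $j\ge 0$, every $\alpha$, and all $x_1\le\dots\le x_j$ in $I$. -/

import Mathlib

open MeasureTheory Set
open scoped ENNReal Nat Kronecker ComplexConjugate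

noncomputable section

/-! ## The bosonic Fock space over `L²(I)` -/

/-- Lebesgue measure on `Iⁿ`. -/
def boxMeasure (I : Set ℝ) (n : ℕ) : Measure (Fin n → ℝ) :=
  Measure.pi fun _ => (volume : Measure ℝ).restrict I

theorem measurePreserving_perm (I : Set ℝ) {n : ℕ} (σ : Equiv.Perm (Fin n)) :
    MeasurePreserving (fun x : Fin n → ℝ => x ∘ σ) (boxMeasure I n) (boxMeasure I n) := by
  have h := measurePreserving_piCongrLeft (α := fun _ : Fin n => ℝ)
    (fun _ : Fin n => (volume : Measure ℝ).restrict I) σ.symm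
  have e : (fun x : Fin n → ℝ => x ∘ σ)
      = MeasurableEquiv.piCongrLeft (fun _ : Fin n => ℝ) σ.symm := by
    funext x i
    have := Equiv.piCongrLeft_apply_apply (fun _ : Fin n => ℝ) σ.symm x (σ i)
    simpa [MeasurableEquiv.coe_piCongrLeft] using this.symm
  rw [e]
  exact h

/-- The `n`-particle space: the elements of `L²(Iⁿ)` that are symmetric, that is, almost everywhere
invariant under all permutations of the `n` coordinates. -/
def NParticle (I : Set ℝ) (n : ℕ) : Submodule ℂ (Lp ℂ 2 (boxMeasure I n)) where
  carrier := {f | ∀ σ : Equiv.Perm (Fin n),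
    (fun x : Fin n → ℝ => f (x ∘ σ)) =ᵐ[boxMeasure I n] fun x => f x}
  zero_mem' := by
    intro σ
    have h := Lp.coeFn_zero ℂ 2 (boxMeasure I n)
    have h' := (measurePreserving_perm I σ).quasiMeasurePreserving.ae_eq_comp h
    filter_upwards [h, h'] with x hx hx'
    simp only [Function.comp_apply] at hx'
    rw [hx, hx']
    rfl
  add_mem' := by
    intro f g hf hg σ
    have h := Lp.coeFn_add f g
    have h' := (measurePreserving_perm I σ).quasiMeasurePreserving.ae_eq_comp h
    filter_upwards [h, h', hf σ, hg σ] with x hx hx' hfx hgx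
    simp only [Function.comp_apply, Pi.add_apply] at hx hx'
    rw [hx, hx', hfx, hgx]
  smul_mem' := by
    intro c f hf σ
    have h := Lp.coeFn_smul c f
    have h' := (measurePreserving_perm I σ).quasiMeasurePreserving.ae_eq_comp h
    filter_upwards [h, h', hf σ] with x hx hx' hfx
    simp only [Function.comp_apply, Pi.smul_apply] at hx hx'
    rw [hx, hx', hfx]

theorem isClosed_NParticle (I : Set ℝ) (n : ℕ) :
    IsClosed (NParticle I n : Set (Lp ℂ 2 (boxMeasure I n))) := by
  have e : (NParticle I n : Set (Lp ℂ 2 (boxMeasure I n))) =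
      ⋂ σ : Equiv.Perm (Fin n),
        {f | Lp.compMeasurePreserving (fun x : Fin n → ℝ => x ∘ σ)
          (measurePreserving_perm I σ) f = f} := by
    ext f
    simp only [mem_iInter, mem_ofPred_eq]
    refine forall_congr' fun σ => ?_
    have h := Lp.coeFn_compMeasurePreserving f (measurePreserving_perm I σ)
    constructor
    · intro hf
      exact Lp.ext (h.trans hf)
    · intro hf
      have : (f ∘ fun x : Fin n → ℝ => x ∘ σ) =ᵐ[boxMeasure I n] f := by
        rw [hf] at h
        exact h.symm
      exact this
  rw [e]
  exact isClosed_iInter fun σ =>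
    isClosed_eq (Lp.isometry_compMeasurePreserving _).continuous continuous_id

instance instCompleteSpaceNParticle (I : Set ℝ) (n : ℕ) : CompleteSpace (NParticle I n) :=
  (isClosed_NParticle I n).completeSpace_coe

/-- The Fock space: the Hilbert space direct sum of the `n`-particle spaces, `n = 0, 1, 2, …`. -/
abbrev Fock (I : Set ℝ) : Type := lp (fun n : ℕ => NParticle I n) 2

/-- The vectors with finitely many nonzero `n`-particle components. -/
def finiteParticle (I : Set ℝ) : Submodule ℂ (Fock I) where
  carrier := {Φ | {n : ℕ | Φ n ≠ 0}.Finite}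
  zero_mem' := by simp
  add_mem' := by
    intro Φ Ψ hΦ hΨ
    refine (hΦ.union hΨ).subset fun n hn => ?_
    by_contra h
    simp only [mem_union, mem_ofPred_eq, not_or, not_not] at h
    exact hn (by rw [lp.coeFn_add, Pi.add_apply, h.1, h.2, add_zero])
  smul_mem' := by
    intro c Φ hΦ
    refine hΦ.subset fun n hn h => hn ?_
    rw [lp.coeFn_smul, Pi.smul_apply, h, smul_zero]

/-- The amplitude `⟨Ω| ψ(x₁) ⋯ ψ(xₙ) |Φ⟩ = √(n!) Φₙ(x₁, …, xₙ)`. -/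
def amplitude {I : Set ℝ} (Φ : Fock I) (n : ℕ) (x : Fin n → ℝ) : ℂ :=
  (Real.sqrt (n ! : ℝ) : ℂ) * (Φ n : Lp ℂ 2 (boxMeasure I n)) x

/-! ## Tensors, propagators and matrix-product coefficients -/

/-- The ordered configurations `x₁ < ⋯ < xⱼ` in `I`. -/
def orderedConfigs (I : Set ℝ) (j : ℕ) : Set (Fin j → ℝ) :=
  {x | StrictMono x ∧ ∀ i, x i ∈ I}

/-- The `k`-th term of the Dyson series of the path-ordered exponential of `Q` over `S`, that is, the
integral of `Q(z₁) ⋯ Q(z_k)` over `z₁ < ⋯ < z_k` in `S`. The integrals are entrywise. -/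
def dysonTerm {ι : Type} [Fintype ι] [DecidableEq ι] (Q : ℝ → Matrix ι ι ℂ) :
    ℕ → Set ℝ → Matrix ι ι ℂ
  | 0, _ => 1
  | k + 1, S => Matrix.of fun a b => ∫ z in S, (dysonTerm Q k (S ∩ Iio z) * Q z) a b

/-- The path-ordered exponential of `Q` over `S`, earlier points standing to the left. For `S` the
open interval between `x` and `y` this is the free propagator `V_x^y`. -/
def pathExp {ι : Type} [Fintype ι] [DecidableEq ι] (Q : ℝ → Matrix ι ι ℂ) (S : Set ℝ) :
    Matrix ι ι ℂ :=
  Matrix.of fun a b => ∑' k : ℕ, dysonTerm Q k S a b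

/-- Labels of the ladder maps: `l` for `[·] ↦ ψ†(x)[·]`, `r` for `[·] ↦ [·]ψ(x)`, and
`a` for `[·] ↦ ψ†(x)[·]ψ(x)`. -/
inductive Ladder
  | l
  | r
  | a
  deriving DecidableEq

instance instFintypeLadder : Fintype Ladder :=
  ⟨{Ladder.l, Ladder.r, Ladder.a}, fun x => by cases x <;> simp⟩

/-- The data `B, Q(x), L(x), R(x), T(x)` of a cMPO with bond space `ℂ^ι`
(bond dimension: the cardinality of `ι`). -/
structure CMPOTensors (ι : Type) where
  B : Matrix ι ι ℂ
  Q : ℝ → Matrix ι ι ℂ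
  L : ℝ → Matrix ι ι ℂ
  R : ℝ → Matrix ι ι ℂ
  T : ℝ → Matrix ι ι ℂ

namespace CMPOTensors

/-- The regularity under which the path-ordered exponential makes sense on finite-particle vectors:
on `I`, `Q` is integrable, `L` and `R` are square integrable, `T` is essentially bounded. -/
structure Regular {ι : Type} (t : CMPOTensors ι) (I : Set ℝ) : Prop where
  Q_mem : ∀ a b, IntegrableOn (fun x => t.Q x a b) I
  L_mem : ∀ a b, MemLp (fun x => t.L x a b) 2 (volume.restrict I)
  R_mem : ∀ a b, MemLp (fun x => t.R x a b) 2 (volume.restrict I)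
  T_mem : ∀ a b, MemLp (fun x => t.T x a b) ∞ (volume.restrict I)

/-- The matrix `K^α(x)` that accompanies the ladder map with label `α` at `x`. -/
def K {ι : Type} (t : CMPOTensors ι) : Ladder → ℝ → Matrix ι ι ℂ
  | Ladder.l => t.L
  | Ladder.r => t.R
  | Ladder.a => t.T

/-- For `w = [(α₁, x₁), …, (αⱼ, xⱼ)]` with `x₁ ≤ ⋯ ≤ xⱼ` in the interval `S`, the product
`V_-^1 K^{α₁}(x₁) V_1^2 ⋯ K^{αⱼ}(xⱼ) V_j^+` over `S`. -/
def word {ι : Type} [Fintype ι] [DecidableEq ι] (t : CMPOTensors ι) :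
    Set ℝ → List (Ladder × ℝ) → Matrix ι ι ℂ
  | S, [] => pathExp t.Q S
  | S, (α, x) :: w => pathExp t.Q (S ∩ Iio x) * t.K α x * t.word (S ∩ Ioi x) w

/-- The continuous matrix-product coefficient
`Tr (B V_-^1 K^{α₁}(x₁) V_1^2 K^{α₂}(x₂) ⋯ K^{αⱼ}(xⱼ) V_j^+)`, for `x₁ ≤ ⋯ ≤ xⱼ` in `I`. -/
def coeff {ι : Type} [Fintype ι] [DecidableEq ι] (t : CMPOTensors ι) (I : Set ℝ) {j : ℕ}
    (α : Fin j → Ladder) (x : Fin j → ℝ) : ℂ :=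
  Matrix.trace (t.B * t.word I (List.ofFn fun i => (α i, x i)))

end CMPOTensors

/-- The positions that carry a creation operator `ψ†` to the left of `|Ω⟩⟨Ω|`. -/
def ketPos {j : ℕ} (α : Fin j → Ladder) : Finset (Fin j) :=
  Finset.univ.filter fun i => α i = Ladder.l ∨ α i = Ladder.a

/-- The positions that carry an annihilation operator `ψ` to the right of `|Ω⟩⟨Ω|`. -/
def braPos {j : ℕ} (α : Fin j → Ladder) : Finset (Fin j) :=
  Finset.univ.filter fun i => α i = Ladder.r ∨ α i = Ladder.a

/-- The subconfiguration of `x` at the positions in `s`. -/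
def subConfig {j : ℕ} (s : Finset (Fin j)) (x : Fin j → ℝ) : Fin s.card → ℝ :=
  fun i => x (s.orderEmbOfFin rfl i)

namespace CMPOTensors

/-- The matrix element between `Φ` and `Ψ` of
`Tr (B 𝒫 exp ∫ (Q ⊗ Id + L ⊗ l_x + R ⊗ r_x + T ⊗ Ad_x) dx) (|Ω⟩⟨Ω|)`: the sum over `j` and over all
labels `α₁, …, αⱼ` of the integral over `x₁ < ⋯ < xⱼ` of
`Tr (B V_-^1 K^{α₁}(x₁) V_1^2 ⋯ V_j^+) ⟨Φ| f^{α₁}_{x₁} ⋯ f^{αⱼ}_{xⱼ}[|Ω⟩⟨Ω|] |Ψ⟩`,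
where `f^l = l_x`, `f^r = r_x`, `f^a = Ad_x`, so that `f^{α₁}_{x₁} ⋯ f^{αⱼ}_{xⱼ}[|Ω⟩⟨Ω|]` is
`∏ ψ†(xᵢ) |Ω⟩⟨Ω| ∏ ψ(xₖ)` with `αᵢ ∈ {l, a}` and `αₖ ∈ {r, a}`.
For finite-particle vectors only finitely many `j` contribute. -/
def matrixElement {ι : Type} [Fintype ι] [DecidableEq ι] (t : CMPOTensors ι) (I : Set ℝ)
    (Φ Ψ : Fock I) : ℂ :=
  ∑' j : ℕ, ∑ α : Fin j → Ladder, ∫ x in orderedConfigs I j,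
    t.coeff I α x * conj (amplitude Φ (ketPos α).card (subConfig (ketPos α) x)) *
      amplitude Ψ (braPos α).card (subConfig (braPos α) x)

/-- The tensors of the adjoint: `B̄, Q̄, R̄, L̄, T̄` (entrywise complex conjugates). -/
def adj {ι : Type} (t : CMPOTensors ι) : CMPOTensors ι where
  B := t.B.map conj
  Q x := (t.Q x).map conj
  L x := (t.R x).map conj
  R x := (t.L x).map conj
  T x := (t.T x).map conj

/-- The tensors of a product of two cMPOs. -/
def mul {ι κ : Type} [DecidableEq ι] [DecidableEq κ] (s : CMPOTensors ι) (t : CMPOTensors κ) :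
    CMPOTensors (ι × κ) where
  B := s.B ⊗ₖ t.B
  Q x := s.Q x ⊗ₖ (1 : Matrix κ κ ℂ) + (1 : Matrix ι ι ℂ) ⊗ₖ t.Q x + s.R x ⊗ₖ t.L x
  L x := s.L x ⊗ₖ (1 : Matrix κ κ ℂ) + s.T x ⊗ₖ t.L x
  R x := (1 : Matrix ι ι ℂ) ⊗ₖ t.R x + s.R x ⊗ₖ t.T x
  T x := s.T x ⊗ₖ t.T x

end CMPOTensors

/-! ## cMPOs as operators, and unitarity -/

/-- `O` is the cMPO with tensors `t`: the operator on the Fock space with domain the finite-particle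
vectors whose matrix elements are those of the cMPO with tensors `t`. -/
def IsCMPO {ι : Type} [Fintype ι] [DecidableEq ι] (I : Set ℝ) (t : CMPOTensors ι)
    (O : Fock I →ₗ.[ℂ] Fock I) : Prop :=
  O.domain = finiteParticle I ∧
    ∀ Φ ∈ finiteParticle I, ∀ Ψ : O.domain, inner ℂ Φ (O Ψ) = t.matrixElement I Φ (Ψ : Fock I)

/-- `A†A` is the cMPO with the (regular) tensors `t`: on finite-particle vectors, which belong to the
domain of `A`, the matrix elements `⟨Φ, A†A Ψ⟩ = ⟨A Φ, A Ψ⟩` are those of the cMPO with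
tensors `t`. -/
def AdjointMulSelfIsCMPO {ι : Type} [Fintype ι] [DecidableEq ι] (I : Set ℝ)
    (A : Fock I →ₗ.[ℂ] Fock I) (t : CMPOTensors ι) : Prop :=
  t.Regular I ∧ finiteParticle I ≤ A.domain ∧
    ∀ Φ Ψ : A.domain, (Φ : Fock I) ∈ finiteParticle I → (Ψ : Fock I) ∈ finiteParticle I →
      inner ℂ (A Φ) (A Ψ) = t.matrixElement I (Φ : Fock I) (Ψ : Fock I)

/-- The densely defined operator `O` is unitary: it is the restriction to its domain of a
(necessarily unique) unitary operator on the Fock space. -/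
def IsUnitaryOp {I : Set ℝ} (O : Fock I →ₗ.[ℂ] Fock I) : Prop :=
  ∃ U ∈ unitary (Fock I →L[ℂ] Fock I), ∀ Ψ : O.domain, U (Ψ : Fock I) = O Ψ

/-- The value `1` if only `a` labels (that is, `T` matrices) appear, and `0` otherwise. -/
def identityCoeff {j : ℕ} (α : Fin j → Ladder) : ℂ :=
  if ∀ k, α k = Ladder.a then 1 else 0

/-- All coefficients of `t` are those of the identity, for almost all `x₁ < ⋯ < xⱼ` in `I`. -/
def HasIdentityCoeffsAE {ι : Type} [Fintype ι] [DecidableEq ι] (I : Set ℝ)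
    (t : CMPOTensors ι) : Prop :=
  ∀ (j : ℕ) (α : Fin j → Ladder),
    ∀ᵐ x ∂(volume.restrict (orderedConfigs I j)), t.coeff I α x = identityCoeff α

/-- All coefficients of `t` are those of the identity, for all `x₁ ≤ ⋯ ≤ xⱼ` in `I`. -/
def HasIdentityCoeffs {ι : Type} [Fintype ι] [DecidableEq ι] (I : Set ℝ)
    (t : CMPOTensors ι) : Prop :=
  ∀ (j : ℕ) (α : Fin j → Ladder) (x : Fin j → ℝ), Monotone x → (∀ i, x i ∈ I) →
    t.coeff I α x = identityCoeff α

/-- `L`, `R` and `T` are continuous on `I`. -/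
def CMPOTensors.ContinuousLRT {ι : Type} (t : CMPOTensors ι) (I : Set ℝ) : Prop :=
  ContinuousOn t.L I ∧ ContinuousOn t.R I ∧ ContinuousOn t.T I

end

/-! The interaction picture turns coefficients into products of functions of one variable. Let U(x)
be the path-ordered exponential of Q up to x. It is continuous and bounded, its inverse is too, and
the propagator from x to y is U(x)⁻¹U(y). So a coefficient is the trace of B times a product of
dressed matrices U(xᵢ)K(xᵢ)U(xᵢ)⁻¹ times the full propagator (`coeff_eq`), and dressing preserves L²
and L^∞.

Existence: Cauchy–Schwarz on the ordered chamber bounds the term of a word of length j by C aʲ /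
√(q!), where q counts its labels `l`. Against a vector with at most M particles only words with q ≥
j − M contribute, so the series converges and is bounded in the left vector; Riesz gives the
operator (`exists_inner_eq_matrixElement`). Density of the finite-particle vectors gives uniqueness.

Product rule: a vector whose ordered amplitude is the indicator of a cube is a matrix product
vector. By Duhamel's expansion, overlaps of matrix product vectors, and matrix elements of cMPOs
between those without propagators, are single numbers Tr(B 𝒫 exp ∫ Q) for the product tensors
(`hasSum_overlap`, `matrixElement_eq_vacuumElement`). Thus O maps cube vectors to matrix product
vectors, and the two bracketings in ⟨OΦ, OΨ⟩ = ⟨Φ, O†O Ψ⟩ differ only by a permutation of the bond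
basis. Boundedness on vectors with at most M particles extends this to all finite-particle vectors
(`inner_toLinearMap_toLinearMap`).

Coefficients from matrix elements: given a word α on a small cube of ordered configurations, take as
test vectors the cubes at its ket and its bra positions. Apart from α, only longer words with the
same numbers of ket and bra positions can contribute. The length of such words is at most the sum of
these two numbers, so a downward induction on the length determines every coefficient almost
everywhere (`coeff_ae_eq`). Since the identity is itself a cMPO, the matrix elements are those of
the identity exactly when the coefficients are.

Unitarity: the two conditions on coefficients say that O and the cMPO with adjoint tensors, a
restriction of O†, are isometric on the dense finite-particle space. Their isometric extensions are
adjoint to each other, hence unitary (`isUnitaryOp_iff`). For continuous L, R, T the coefficients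
are continuous on the closed chamber, in which the open chamber is dense. -/

set_option linter.unusedSectionVars false

/-! ### Path-ordered exponentials over a measure on the line -/

section Dyson

variable {𝔸 : Type*} [NormedRing 𝔸] {μ : Measure ℝ}

/-- The Dyson series of `q` with respect to a measure on the line. -/
noncomputable def dyson [NormedAlgebra ℝ 𝔸] (q : ℝ → 𝔸) : ℕ → Measure ℝ → 𝔸
  | 0, _ => 1
  | k + 1, μ => ∫ z, dyson q k (μ.restrict (Iio z)) * q z ∂μ

/-- The path-ordered exponential of `q` with respect to a measure on the line. -/
noncomputable def orderedExp [NormedAlgebra ℝ 𝔸] (q : ℝ → 𝔸) (μ : Measure ℝ) : 𝔸 := ∑' k, dyson q k μ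

theorem restrict_Iio_restrict_Iio {w z : ℝ} (h : w ≤ z) :
    (μ.restrict (Iio z)).restrict (Iio w) = μ.restrict (Iio w) := by
  rw [Measure.restrict_restrict measurableSet_Iio, Iio_inter_Iio, min_eq_left h]

theorem setIntegral_Iio_restrict {E : Type*} [NormedAddCommGroup E] [NormedSpace ℝ E]
    {f : Measure ℝ → ℝ → E} (z : ℝ) :
    ∫ w in Iio z, f ((μ.restrict (Iio z)).restrict (Iio w)) w ∂μ
      = ∫ w in Iio z, f (μ.restrict (Iio w)) w ∂μ := by
  refine setIntegral_congr_fun measurableSet_Iio fun w hw => ?_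
  simp only [restrict_Iio_restrict_Iio (le_of_lt hw)]

/-- Dominated convergence: away from w = z₀, which is null because there are no atoms, the indicator
of w < z is constant for z near z₀. -/
theorem continuous_setIntegral_Iio {E : Type*} [NormedAddCommGroup E] [NormedSpace ℝ E] [NullSingletonClass μ]
    {f : ℝ → E} (hf : Integrable f μ) : Continuous fun z => ∫ w in Iio z, f w ∂μ := by
  have h : (fun z => ∫ w in Iio z, f w ∂μ) = fun z => ∫ w, (Iio z).indicator f w ∂μ := by
    funext z
    rw [integral_indicator measurableSet_Iio]
  rw [h, continuous_iff_continuousAt]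
  intro z₀
  refine continuousAt_of_dominated (bound := fun w => ‖f w‖)
    (.of_forall fun z => (hf.indicator measurableSet_Iio).aestronglyMeasurable)
    (.of_forall fun z => .of_forall fun w => norm_indicator_le_norm_self _ _) hf.norm ?_
  have : ∀ᵐ w ∂μ, w ≠ z₀ := by simp [ae_iff, measure_singleton]
  filter_upwards [this] with w hw
  rcases lt_or_gt_of_ne hw with h | h
  · refine (continuousAt_const (y := f w)).congr ?_
    filter_upwards [lt_mem_nhds h] with z hz
    rw [indicator_of_mem (show w ∈ Iio z from hz)]
  · refine (continuousAt_const (y := (0 : E))).congr ?_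
    filter_upwards [gt_mem_nhds h] with z hz
    rw [indicator_of_notMem (show w ∉ Iio z from not_lt.2 (le_of_lt hz))]

theorem norm_setIntegral_Iio_le {E : Type*} [NormedAddCommGroup E] [NormedSpace ℝ E]
    {f : ℝ → E} (hf : Integrable f μ) (z : ℝ) : ‖∫ w in Iio z, f w ∂μ‖ ≤ ∫ w, ‖f w‖ ∂μ :=
  (norm_integral_le_integral_norm _).trans
    (setIntegral_le_integral hf.norm (.of_forall fun _ => norm_nonneg _))

theorem MeasureTheory.Integrable.continuous_bdd_mul {f W : ℝ → 𝔸} (hf : Integrable f μ) (hW : Continuous W)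
    {C : ℝ} (hC : ∀ z, ‖W z‖ ≤ C) : Integrable (fun z => W z * f z) μ :=
  Integrable.bdd_mul hf hW.aestronglyMeasurable (.of_forall hC)

theorem MeasureTheory.Integrable.mul_continuous_bdd {f W : ℝ → 𝔸} (hf : Integrable f μ) (hW : Continuous W)
    {C : ℝ} (hC : ∀ z, ‖W z‖ ≤ C) : Integrable (fun z => f z * W z) μ :=
  Integrable.mul_bdd hf hW.aestronglyMeasurable (.of_forall hC)

variable [NormedAlgebra ℝ 𝔸] [SFinite μ] [NullSingletonClass μ]

/-- Fubini on the plane: the two open triangles give the two summands, and the diagonal is null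
because μ has no atoms. The factors are never exchanged, so the formula holds in a noncommutative
algebra. -/
theorem integral_mul_integral {f g : ℝ → 𝔸} (hf : Integrable f μ) (hg : Integrable g μ) :
    (∫ z, f z ∂μ) * (∫ z, g z ∂μ)
      = ∫ z, (f z * ∫ w in Iio z, g w ∂μ) + (∫ w in Iio z, f w ∂μ) * g z ∂μ := by
  have hfg : Integrable (fun p : ℝ × ℝ => f p.1 * g p.2) (μ.prod μ) := hf.mul_prod hg
  have m1 : MeasurableSet {p : ℝ × ℝ | p.2 < p.1} := measurableSet_lt measurable_snd measurable_fst
  have m2 : MeasurableSet {p : ℝ × ℝ | p.1 < p.2} := measurableSet_lt measurable_fst measurable_snd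
  have e0 : (∫ z, f z ∂μ) * (∫ z, g z ∂μ) = ∫ p, f p.1 * g p.2 ∂(μ.prod μ) := by
    rw [integral_prod _ hfg]
    simp only [integral_const_mul_of_integrable hg]
    rw [integral_mul_const_of_integrable hf]
  have e1 : ∫ p in {p : ℝ × ℝ | p.2 < p.1}, f p.1 * g p.2 ∂(μ.prod μ)
      = ∫ z, (f z * ∫ w in Iio z, g w ∂μ) ∂μ := by
    rw [← integral_indicator m1, integral_prod _ (hfg.indicator m1)]
    refine integral_congr_ae (.of_forall fun z => ?_)
    dsimp only
    rw [← integral_const_mul_of_integrable hg.integrableOn, ← integral_indicator measurableSet_Iio]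
    rfl
  have e2 : ∫ p in {p : ℝ × ℝ | p.1 < p.2}, f p.1 * g p.2 ∂(μ.prod μ)
      = ∫ z, ((∫ w in Iio z, f w ∂μ) * g z) ∂μ := by
    rw [← integral_indicator m2, integral_prod_symm _ (hfg.indicator m2)]
    refine integral_congr_ae (.of_forall fun z => ?_)
    dsimp only
    rw [← integral_mul_const_of_integrable hf.integrableOn, ← integral_indicator measurableSet_Iio]
    rfl
  have hd : μ.prod μ {p : ℝ × ℝ | p.1 = p.2} = 0 := by
    rw [Measure.measure_prod_null (measurableSet_eq_fun measurable_fst measurable_snd)]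
    refine .of_forall fun z => ?_
    have : Prod.mk z ⁻¹' {p : ℝ × ℝ | p.1 = p.2} = {z} := by ext w; simp [eq_comm]
    simp [this]
  have hu : ({p : ℝ × ℝ | p.2 < p.1} ∪ {p | p.1 < p.2} : Set (ℝ × ℝ)) =ᵐ[μ.prod μ] univ := by
    rw [ae_eq_univ]
    refine measure_mono_null (fun p hp => ?_) hd
    simp only [mem_compl_iff, mem_union, mem_ofPred_eq, not_or, not_lt] at hp ⊢
    exact le_antisymm hp.1 hp.2
  rw [e0, ← setIntegral_univ, ← setIntegral_congr_set hu, setIntegral_union _ m2 hfg.integrableOn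
    hfg.integrableOn, e1, e2, ← integral_add]
  · exact Integrable.mul_continuous_bdd hf (continuous_setIntegral_Iio hg)
      (norm_setIntegral_Iio_le hg)
  · exact Integrable.continuous_bdd_mul hg (continuous_setIntegral_Iio hf)
      (norm_setIntegral_Iio_le hf)
  · rw [Set.disjoint_left]
    intro p hp hp'
    exact lt_asymm (show p.2 < p.1 from hp) hp'

/-- The product rule for primitives. -/
theorem add_integral_mul_add_integral {f g : ℝ → 𝔸} (a b : 𝔸) (hf : Integrable f μ)
    (hg : Integrable g μ) :
    (a + ∫ z, f z ∂μ) * (b + ∫ z, g z ∂μ)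
      = a * b + ∫ z, (f z * (b + ∫ w in Iio z, g w ∂μ)) + (a + ∫ w in Iio z, f w ∂μ) * g z ∂μ := by
  have i1 := Integrable.mul_continuous_bdd hf (continuous_setIntegral_Iio hg)
    (norm_setIntegral_Iio_le hg)
  have i2 := Integrable.continuous_bdd_mul hg (continuous_setIntegral_Iio hf)
      (norm_setIntegral_Iio_le hf)
  have j1 : Integrable (fun z => f z * b + a * g z) μ := (hf.mul_const b).add (hg.const_mul a)
  have j2 : Integrable (fun z => (f z * ∫ w in Iio z, g w ∂μ) + (∫ w in Iio z, f w ∂μ) * g z) μ :=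
    i1.add i2
  have h : ∀ z, (f z * (b + ∫ w in Iio z, g w ∂μ)) + (a + ∫ w in Iio z, f w ∂μ) * g z
      = (f z * b + a * g z) +
        ((f z * ∫ w in Iio z, g w ∂μ) + (∫ w in Iio z, f w ∂μ) * g z) := fun z => by noncomm_ring
  simp only [h]
  rw [integral_add j1 j2, ← integral_mul_integral hf hg,
    integral_add (hf.mul_const b) (hg.const_mul a), integral_mul_const_of_integrable hf,
    integral_const_mul_of_integrable hg]
  noncomm_ring

/-- This replaces the substitution rule for F(z) = ∫_{w<z} q, which need not be differentiable. In
the induction, `integral_mul_integral` for q and Fᵏq gives (k + 2)/(k + 1) times the next integral.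
-/
theorem integral_pow_mul {q : ℝ → ℝ} (hq : Integrable q μ) (k : ℕ) :
    ∫ z, (∫ w in Iio z, q w ∂μ) ^ k * q z ∂μ = (∫ z, q z ∂μ) ^ (k + 1) / (k + 1) := by
  induction k generalizing μ with
  | zero => simp
  | succ k ih =>
    have hb : ∀ k z, ‖(∫ w in Iio z, q w ∂μ) ^ k‖ ≤ (∫ w, ‖q w‖ ∂μ) ^ k := fun k z => by
      rw [norm_pow]
      exact pow_le_pow_left₀ (norm_nonneg _) (norm_setIntegral_Iio_le hq z) k
    have hi : ∀ k, Integrable (fun z => (∫ w in Iio z, q w ∂μ) ^ k * q z) μ := fun k =>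
      Integrable.continuous_bdd_mul hq ((continuous_setIntegral_Iio hq).pow k) (hb k)
    have h := integral_mul_integral hq (hi k)
    have e : ∀ z, ∫ w in Iio z, (∫ w in Iio w, q w ∂μ) ^ k * q w ∂μ
        = (∫ w in Iio z, q w ∂μ) ^ (k + 1) / (k + 1) := fun z => by
      rw [← ih (μ := μ.restrict (Iio z)) hq.restrict]
      exact (setIntegral_Iio_restrict (f := fun ν w => (∫ w, q w ∂ν) ^ k * q w) z).symm
    rw [ih hq] at h
    simp only [e] at h
    have e' : ∀ z, q z * ((∫ w in Iio z, q w ∂μ) ^ (k + 1) / (k + 1))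
        + (∫ w in Iio z, q w ∂μ) * ((∫ w in Iio z, q w ∂μ) ^ k * q z)
        = ((k + 2 : ℝ) / (k + 1)) * ((∫ w in Iio z, q w ∂μ) ^ (k + 1) * q z) := fun z => by
      field_simp
      ring
    simp only [e'] at h
    rw [integral_const_mul] at h
    push_cast
    field_simp at h ⊢
    linear_combination -h

theorem dyson_succ_Iio (q : ℝ → 𝔸) (k : ℕ) (z : ℝ) : dyson q (k + 1) (μ.restrict (Iio z))
    = ∫ w in Iio z, dyson q k (μ.restrict (Iio w)) * q w ∂μ :=
  setIntegral_Iio_restrict (f := fun ν w => dyson q k ν * q w) z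

/-- The factorial is the volume of the simplex, supplied by `integral_pow_mul`. The factor ‖1‖ stays
because the unit need not have norm one: it is zero on an empty bond space. -/
theorem norm_dyson_le {q : ℝ → 𝔸} (hq : Integrable q μ) (k : ℕ) :
    ‖dyson q k μ‖ ≤ ‖(1 : 𝔸)‖ * ((∫ z, ‖q z‖ ∂μ) ^ k / k !) := by
  induction k generalizing μ with
  | zero => simp [dyson]
  | succ k ih =>
    have hb : ∀ z, ‖(∫ w in Iio z, ‖q w‖ ∂μ) ^ k‖ ≤ (∫ w, ‖q w‖ ∂μ) ^ k := fun z => by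
      rw [norm_pow]
      refine pow_le_pow_left₀ (norm_nonneg _) ?_ k
      simpa using norm_setIntegral_Iio_le hq.norm z
    have hi : Integrable (fun z => (∫ w in Iio z, ‖q w‖ ∂μ) ^ k * ‖q z‖) μ :=
      Integrable.continuous_bdd_mul hq.norm ((continuous_setIntegral_Iio hq.norm).pow k) hb
    have h1 : ‖dyson q (k + 1) μ‖
        ≤ ∫ z, ‖(1 : 𝔸)‖ / k ! * ((∫ w in Iio z, ‖q w‖ ∂μ) ^ k * ‖q z‖) ∂μ := by
      refine norm_integral_le_of_norm_le (hi.const_mul _) (.of_forall fun z => ?_)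
      refine (norm_mul_le _ _).trans ?_
      refine (mul_le_mul_of_nonneg_right (ih (μ := μ.restrict (Iio z)) hq.restrict)
        (norm_nonneg _)).trans (le_of_eq ?_)
      ring
    refine h1.trans (le_of_eq ?_)
    rw [integral_const_mul, integral_pow_mul hq.norm, Nat.factorial_succ]
    push_cast
    field_simp

theorem norm_dyson_Iio_le {q : ℝ → 𝔸} (hq : Integrable q μ) (k : ℕ) (z : ℝ) :
    ‖dyson q k (μ.restrict (Iio z))‖ ≤ ‖(1 : 𝔸)‖ * ((∫ z, ‖q z‖ ∂μ) ^ k / k !) := by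
  refine (norm_dyson_le hq.restrict k).trans ?_
  have := setIntegral_le_integral (s := Iio z) hq.norm (.of_forall fun _ => norm_nonneg _)
  have h0 : 0 ≤ ∫ w in Iio z, ‖q w‖ ∂μ := integral_nonneg fun _ => norm_nonneg _
  gcongr

theorem continuous_dyson_Iio {q : ℝ → 𝔸} (hq : Integrable q μ) (k : ℕ) :
    Continuous fun z => dyson q k (μ.restrict (Iio z)) := by
  induction k with
  | zero => exact continuous_const
  | succ k ih =>
    simp only [dyson_succ_Iio]
    exact continuous_setIntegral_Iio (hq.continuous_bdd_mul ih (norm_dyson_Iio_le hq k))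

theorem summable_norm_dyson_bound {q : ℝ → 𝔸} :
    Summable fun k : ℕ => ‖(1 : 𝔸)‖ * ((∫ z, ‖q z‖ ∂μ) ^ k / k !) :=
  (Real.summable_pow_div_factorial _).mul_left _

variable [CompleteSpace 𝔸]

theorem summable_dyson {q : ℝ → 𝔸} (hq : Integrable q μ) : Summable fun k => dyson q k μ :=
  .of_norm_bounded summable_norm_dyson_bound (norm_dyson_le hq)

theorem continuous_orderedExp_Iio {q : ℝ → 𝔸} (hq : Integrable q μ) :
    Continuous fun z => orderedExp q (μ.restrict (Iio z)) :=
  continuous_tsum (continuous_dyson_Iio hq) summable_norm_dyson_bound (norm_dyson_Iio_le hq)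

theorem norm_orderedExp_Iio_le {q : ℝ → 𝔸} (hq : Integrable q μ) (z : ℝ) :
    ‖orderedExp q (μ.restrict (Iio z))‖ ≤ ∑' k : ℕ, ‖(1 : 𝔸)‖ * ((∫ z, ‖q z‖ ∂μ) ^ k / k !) :=
  tsum_of_norm_bounded summable_norm_dyson_bound.hasSum fun k => norm_dyson_Iio_le hq k z

theorem integrable_orderedExp_mul {q f : ℝ → 𝔸} (hq : Integrable q μ) (hf : Integrable f μ) :
    Integrable (fun z => orderedExp q (μ.restrict (Iio z)) * f z) μ :=
  hf.continuous_bdd_mul (continuous_orderedExp_Iio hq) (norm_orderedExp_Iio_le hq)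

/-- The Volterra equation of U: split off the term k = 0 and sum under the integral, which the
factorial bound permits. -/
theorem orderedExp_eq {q : ℝ → 𝔸} (hq : Integrable q μ) :
    orderedExp q μ = 1 + ∫ z, orderedExp q (μ.restrict (Iio z)) * q z ∂μ := by
  rw [orderedExp, (summable_dyson hq).tsum_eq_zero_add]
  congr 1
  have hi : ∀ k, Integrable (fun z => dyson q k (μ.restrict (Iio z)) * q z) μ := fun k =>
    hq.continuous_bdd_mul (continuous_dyson_Iio hq k) (norm_dyson_Iio_le hq k)
  have hs : Summable fun k => ∫ z, ‖dyson q k (μ.restrict (Iio z)) * q z‖ ∂μ := by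
    refine .of_nonneg_of_le (fun k => integral_nonneg fun _ => norm_nonneg _) (fun k => ?_)
      ((summable_norm_dyson_bound (𝔸 := 𝔸) (μ := μ) (q := q)).mul_right (∫ z, ‖q z‖ ∂μ))
    rw [← integral_const_mul]
    refine integral_mono (hi k).norm (hq.norm.const_mul _) fun z => ?_
    exact (norm_mul_le _ _).trans
      (mul_le_mul_of_nonneg_right (norm_dyson_Iio_le hq k z) (norm_nonneg _))
  refine (hasSum_integral_of_summable_integral_norm hi hs).tsum_eq.trans ?_
  refine integral_congr_ae (.of_forall fun z => ?_)
  exact Summable.tsum_mul_right _ (summable_dyson hq.restrict)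

theorem orderedExp_Iio {q : ℝ → 𝔸} (hq : Integrable q μ) (z : ℝ) :
    orderedExp q (μ.restrict (Iio z))
      = 1 + ∫ w in Iio z, orderedExp q (μ.restrict (Iio w)) * q w ∂μ := by
  rw [orderedExp_eq hq.restrict]
  exact congrArg _ (setIntegral_Iio_restrict (f := fun ν w => orderedExp q ν * q w) z)

omit [NormedAlgebra ℝ 𝔸] [CompleteSpace 𝔸] [SFinite μ] [NullSingletonClass μ] in
theorem integrable_op {q : ℝ → 𝔸} (hq : Integrable q μ) :
    Integrable (fun z => MulOpposite.op (q z)) μ := by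
  refine (hq.norm.congr' ?_ (.of_forall fun z => by rw [norm_norm, MulOpposite.norm_op]))
  exact MulOpposite.continuous_op.comp_aestronglyMeasurable hq.aestronglyMeasurable

/-- The inverse of the path-ordered exponential. -/
noncomputable def orderedExpInv (q : ℝ → 𝔸) (μ : Measure ℝ) : 𝔸 :=
  (orderedExp (fun z => MulOpposite.op (-q z)) μ).unop

theorem continuous_orderedExpInv_Iio {q : ℝ → 𝔸} (hq : Integrable q μ) :
    Continuous fun z => orderedExpInv q (μ.restrict (Iio z)) :=
  MulOpposite.continuous_unop.comp (continuous_orderedExp_Iio (integrable_op hq.neg))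

theorem exists_norm_orderedExpInv_Iio_le {q : ℝ → 𝔸} (hq : Integrable q μ) :
    ∃ C, ∀ z, ‖orderedExpInv q (μ.restrict (Iio z))‖ ≤ C :=
  ⟨_, fun z => norm_orderedExp_Iio_le (integrable_op hq.neg) z⟩

/-- The opposite algebra reverses all products, so here the generator −q multiplies from the left.
-/
theorem orderedExpInv_Iio {q : ℝ → 𝔸} (hq : Integrable q μ) (z : ℝ) :
    orderedExpInv q (μ.restrict (Iio z))
      = 1 + ∫ w in Iio z, -(q w * orderedExpInv q (μ.restrict (Iio w))) ∂μ := by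
  have h := orderedExp_Iio (integrable_op hq.neg) z
  have hi := (integrable_orderedExp_mul (integrable_op hq.neg) (integrable_op hq.neg)).integrableOn
    (s := Iio z)
  have h2 := (MulOpposite.opContinuousLinearEquiv ℝ (M := 𝔸)).symm.toContinuousLinearMap.integral_comp_comm
    hi
  have h3 := congrArg MulOpposite.unop h
  simp only [MulOpposite.unop_add, MulOpposite.unop_one] at h3
  refine h3.trans (congrArg _ (h2.symm.trans ?_))
  refine integral_congr_ae (.of_forall fun w => ?_)
  simp [orderedExpInv]

theorem orderedExpInv_eq {q : ℝ → 𝔸} (hq : Integrable q μ) :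
    orderedExpInv q μ = 1 + ∫ w, -(q w * orderedExpInv q (μ.restrict (Iio w))) ∂μ := by
  have h := orderedExp_eq (integrable_op hq.neg)
  have hi := (integrable_orderedExp_mul (integrable_op hq.neg) (integrable_op hq.neg))
  have h2 := (MulOpposite.opContinuousLinearEquiv ℝ (M := 𝔸)).symm.toContinuousLinearMap.integral_comp_comm
    hi
  have h3 := congrArg MulOpposite.unop h
  simp only [MulOpposite.unop_add, MulOpposite.unop_one] at h3
  refine h3.trans (congrArg _ (h2.symm.trans ?_))
  refine integral_congr_ae (.of_forall fun w => ?_)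
  simp [orderedExpInv]

theorem integrable_mul_orderedExpInv {q f : ℝ → 𝔸} (hq : Integrable q μ) (hf : Integrable f μ) :
    Integrable (fun z => f z * orderedExpInv q (μ.restrict (Iio z))) μ := by
  obtain ⟨C, hC⟩ := exists_norm_orderedExpInv_Iio_le hq
  exact hf.mul_continuous_bdd (continuous_orderedExpInv_Iio hq) hC

/-- By the product rule U U⁻¹ has derivative U q U⁻¹ − U q U⁻¹ = 0. -/
theorem orderedExp_mul_orderedExpInv {q : ℝ → 𝔸} (hq : Integrable q μ) :
    orderedExp q μ * orderedExpInv q μ = 1 := by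
  have hn : Integrable (fun w => -(q w * orderedExpInv q (μ.restrict (Iio w)))) μ :=
    (integrable_mul_orderedExpInv hq hq).neg
  rw [orderedExp_eq hq, orderedExpInv_eq hq, add_integral_mul_add_integral _ _
    (integrable_orderedExp_mul hq hq) hn]
  simp only [← orderedExp_Iio hq, ← orderedExpInv_Iio hq]
  rw [integral_eq_zero_of_ae]
  · simp
  · refine .of_forall fun z => ?_
    simp [mul_assoc]

variable [IsDedekindFiniteMonoid 𝔸]

/-- Dedekind finiteness, which matrix algebras have, makes the right inverse two-sided. -/
theorem orderedExpInv_mul_orderedExp {q : ℝ → 𝔸} (hq : Integrable q μ) :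
    orderedExpInv q μ * orderedExp q μ = 1 :=
  mul_eq_one_symm (orderedExp_mul_orderedExpInv hq)

/-- Uniqueness of the solution of the Volterra equation `W z = c + ∫_{w < z} W w * q w`. -/
theorem add_integral_mul_eq_mul_orderedExp {q W : ℝ → 𝔸} {c : 𝔸} (hq : Integrable q μ)
    (hWq : Integrable (fun z => W z * q z) μ)
    (hW : ∀ᵐ z ∂μ, W z = c + ∫ w in Iio z, W w * q w ∂μ) :
    c + ∫ z, W z * q z ∂μ = c * orderedExp q μ := by
  have hV := (integrable_orderedExp_mul hq hq).const_mul c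
  have hf : Integrable (fun z => W z * q z - c * (orderedExp q (μ.restrict (Iio z)) * q z)) μ :=
    hWq.sub hV
  have hn : Integrable (fun w => -(q w * orderedExpInv q (μ.restrict (Iio w)))) μ :=
    (integrable_mul_orderedExpInv hq hq).neg
  -- The product rule for (W − cU) U⁻¹, which starts at 0 and has derivative 0.
  have key := add_integral_mul_add_integral (0 : 𝔸) 1 hf hn
  simp only [← orderedExpInv_Iio hq, ← orderedExpInv_eq hq, zero_mul, zero_add] at key
  rw [integral_eq_zero_of_ae (f := fun z => _ + _)] at key
  · have h0 : ∫ z, W z * q z - c * (orderedExp q (μ.restrict (Iio z)) * q z) ∂μ = 0 := by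
      have := congrArg (· * orderedExp q μ) key
      simpa [mul_assoc, orderedExpInv_mul_orderedExp hq] using this
    rw [integral_sub hWq hV, integral_const_mul_of_integrable (integrable_orderedExp_mul hq hq),
      sub_eq_zero] at h0
    rw [h0, orderedExp_eq hq, mul_add, mul_one]
  · filter_upwards [hW] with z hz
    rw [integral_sub hWq.restrict hV.restrict,
      integral_const_mul_of_integrable (integrable_orderedExp_mul hq hq).restrict,
      eq_sub_of_add_eq' hz.symm, eq_sub_of_add_eq' (orderedExp_Iio hq z).symm]
    simp only [Pi.zero_apply]
    noncomm_ring

omit [CompleteSpace 𝔸] [IsDedekindFiniteMonoid 𝔸] [SFinite μ] in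
theorem integral_eq_Iio_add_Ioi {f : ℝ → 𝔸} (hf : Integrable f μ) (x : ℝ) :
    ∫ z, f z ∂μ = ∫ z in Iio x, f z ∂μ + ∫ z in Ioi x, f z ∂μ := by
  rw [← integral_add_compl (measurableSet_Iio (a := x)) hf, compl_Iio,
    setIntegral_congr_set (Ioi_ae_eq_Ici (a := x)).symm]

/-- To the right of x the function U solves the Volterra equation with initial value U(x), so
uniqueness identifies its final value. -/
theorem orderedExp_Iio_mul_orderedExp_Ioi {q : ℝ → 𝔸} (hq : Integrable q μ) (x : ℝ) :
    orderedExp q (μ.restrict (Iio x)) * orderedExp q (μ.restrict (Ioi x)) = orderedExp q μ := by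
  have hV := integrable_orderedExp_mul hq hq
  rw [← add_integral_mul_eq_mul_orderedExp (W := fun z => orderedExp q (μ.restrict (Iio z)))
    hq.restrict hV.restrict, orderedExp_Iio hq, add_assoc, ← integral_eq_Iio_add_Ioi hV,
    ← orderedExp_eq hq]
  filter_upwards [ae_restrict_mem measurableSet_Ioi] with z hz
  have hz' : x < z := hz
  have h := integral_eq_Iio_add_Ioi (μ := μ.restrict (Iio z)) hV.restrict x
  rw [restrict_Iio_restrict_Iio hz'.le, Measure.restrict_restrict measurableSet_Ioi, inter_comm,
    ← Measure.restrict_restrict measurableSet_Iio] at h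
  rw [orderedExp_Iio hq z, h, orderedExp_Iio hq x, add_assoc]

/-- The interaction picture. -/
theorem orderedExp_add {q c : ℝ → 𝔸} (hq : Integrable q μ) (hc : Integrable c μ) :
    orderedExp (fun z => q z + c z) μ
      = orderedExp (fun z => orderedExp q (μ.restrict (Iio z)) * c z *
          orderedExpInv q (μ.restrict (Iio z))) μ * orderedExp q μ := by
  set c' := fun z => orderedExp q (μ.restrict (Iio z)) * c z *
          orderedExpInv q (μ.restrict (Iio z)) with hc'
  have hi : Integrable c' μ := integrable_mul_orderedExpInv hq (integrable_orderedExp_mul hq hc)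
  have hi2 : Integrable (fun z => orderedExp c' (μ.restrict (Iio z)) *
      orderedExp q (μ.restrict (Iio z)) * (q z + c z)) μ := by
    simp only [mul_assoc]
    exact integrable_orderedExp_mul hi (integrable_orderedExp_mul hq (hq.add hc))
  -- The derivative of the product of the two exponentials: the conjugation in c' cancels against
  -- the exponential of q. The product therefore solves the equation with generator q + c, and
  -- uniqueness applies.
  have e : ∀ z, orderedExp c' (μ.restrict (Iio z)) * c' z * orderedExp q (μ.restrict (Iio z))
      + orderedExp c' (μ.restrict (Iio z)) * (orderedExp q (μ.restrict (Iio z)) * q z)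
      = orderedExp c' (μ.restrict (Iio z)) * orderedExp q (μ.restrict (Iio z)) * (q z + c z) := by
    intro z
    simp only [hc', mul_add, mul_assoc, orderedExpInv_mul_orderedExp hq.restrict, mul_one]
    abel
  have prod := add_integral_mul_add_integral (1 : 𝔸) 1 (integrable_orderedExp_mul hi hi)
    (integrable_orderedExp_mul hq hq)
  simp only [← orderedExp_Iio hi, ← orderedExp_Iio hq, e, ← orderedExp_eq hi,
    ← orderedExp_eq hq, one_mul] at prod
  rw [prod, add_integral_mul_eq_mul_orderedExp (q := fun z => q z + c z) (hq.add hc) hi2, one_mul]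
  refine .of_forall fun z => ?_
  have prod := add_integral_mul_add_integral (μ := μ.restrict (Iio z)) (1 : 𝔸) 1
    (integrable_orderedExp_mul hi hi).restrict (integrable_orderedExp_mul hq hq).restrict
  rw [← orderedExp_Iio hi, ← orderedExp_Iio hq, one_mul] at prod
  rw [prod]
  refine congrArg _ (setIntegral_congr_fun measurableSet_Iio fun w hw => ?_)
  simp only [restrict_Iio_restrict_Iio (le_of_lt hw), ← orderedExp_Iio hi, ← orderedExp_Iio hq, e]

omit [IsDedekindFiniteMonoid 𝔸] in
theorem commute_orderedExp {q : ℝ → 𝔸} (hq : Integrable q μ) {a : 𝔸} (h : ∀ z, Commute a (q z)) :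
    Commute a (orderedExp q μ) := by
  refine Commute.tsum_right _ fun k => ?_
  induction k generalizing μ with
  | zero => exact Commute.one_right a
  | succ k ih =>
    have hi : Integrable (fun z => dyson q k (μ.restrict (Iio z)) * q z) μ :=
      hq.continuous_bdd_mul (continuous_dyson_Iio hq k) (norm_dyson_Iio_le hq k)
    rw [Commute, SemiconjBy, dyson, ← integral_const_mul_of_integrable hi,
      ← integral_mul_const_of_integrable hi]
    refine integral_congr_ae (.of_forall fun z => ?_)
    exact (ih hq.restrict).mul_right (h z)

/-- The conjugation in the interaction picture acts trivially on c, and the two exponentials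
commute. -/
theorem orderedExp_add_of_commute {q c : ℝ → 𝔸} (hq : Integrable q μ) (hc : Integrable c μ)
    (h : ∀ z w, Commute (q z) (c w)) :
    orderedExp (fun z => q z + c z) μ = orderedExp q μ * orderedExp c μ := by
  have h1 : ∀ z, Commute (c z) (orderedExp q (μ.restrict (Iio z))) := fun z =>
    commute_orderedExp hq.restrict fun w => (h w z).symm
  rw [orderedExp_add hq hc]
  have : (fun z => orderedExp q (μ.restrict (Iio z)) * c z *
          orderedExpInv q (μ.restrict (Iio z))) = c := by
    funext z
    rw [← (h1 z).eq, mul_assoc, orderedExp_mul_orderedExpInv hq.restrict, mul_one]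
  rw [this]
  exact (commute_orderedExp hq fun z => (commute_orderedExp hc fun w => h z w).symm).symm.eq ▸ rfl

omit [CompleteSpace 𝔸] [IsDedekindFiniteMonoid 𝔸] [SFinite μ] [NullSingletonClass μ] in
theorem integrable_map {𝔹 : Type*} [NormedRing 𝔹] [NormedAlgebra ℝ 𝔹] (f : 𝔸 →L[ℝ] 𝔹) {q : ℝ → 𝔸}
    (hq : Integrable q μ) : Integrable (fun z => f (q z)) μ :=
  f.integrable_comp hq

omit [IsDedekindFiniteMonoid 𝔸] in
theorem map_orderedExp {𝔹 : Type*} [NormedRing 𝔹] [NormedAlgebra ℝ 𝔹] [CompleteSpace 𝔹]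
    (f : 𝔸 →L[ℝ] 𝔹) (h1 : f 1 = 1) (hm : ∀ a b, f (a * b) = f a * f b) {q : ℝ → 𝔸}
    (hq : Integrable q μ) : f (orderedExp q μ) = orderedExp (fun z => f (q z)) μ := by
  rw [orderedExp, f.map_tsum (summable_dyson hq)]
  refine tsum_congr fun k => ?_
  induction k generalizing μ with
  | zero => exact h1
  | succ k ih =>
    have hi : Integrable (fun z => dyson q k (μ.restrict (Iio z)) * q z) μ :=
      hq.continuous_bdd_mul (continuous_dyson_Iio hq k) (norm_dyson_Iio_le hq k)
    rw [dyson, dyson, ← f.integral_comp_comm hi]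
    refine integral_congr_ae (.of_forall fun z => ?_)
    simp only [hm, ih hq.restrict]

end Dyson

/-! ### The operator-norm topology on matrices -/

namespace MatrixTopology

open scoped Matrix.Norms.Operator

/-- The topology of the operator norm on matrices. -/
noncomputable scoped instance (priority := 2000) normTopology {ι : Type} [Fintype ι] [DecidableEq ι] :
    TopologicalSpace (Matrix ι ι ℂ) :=
  (inferInstance : PseudoMetricSpace (Matrix ι ι ℂ)).toUniformSpace.toTopologicalSpace

/-- The uniformity of the operator norm on matrices. -/
noncomputable scoped instance (priority := 2000) normUniformity {ι : Type} [Fintype ι] [DecidableEq ι] :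
    UniformSpace (Matrix ι ι ℂ) :=
  (inferInstance : PseudoMetricSpace (Matrix ι ι ℂ)).toUniformSpace

scoped instance (priority := 2000) normComplete {ι : Type} [Fintype ι] [DecidableEq ι] :
    CompleteSpace (Matrix ι ι ℂ) :=
  FiniteDimensional.complete ℂ _

end MatrixTopology

/-! ### Coefficients in the interaction picture -/

section MatrixValued

open scoped Matrix.Norms.Operator MatrixTopology

variable {ι : Type} [Fintype ι] [DecidableEq ι]

/-- Evaluation of a matrix at an entry. -/
noncomputable def entryCLM (a b : ι) : Matrix ι ι ℂ →L[ℂ] ℂ :=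
  LinearMap.toContinuousLinearMap (Matrix.entryLinearMap ℂ ℂ a b)

@[simp] theorem entryCLM_apply (a b : ι) (M : Matrix ι ι ℂ) : entryCLM a b M = M a b := rfl

theorem memLp_matrix {α : Type*} [MeasurableSpace α] {μ : Measure α} {p : ℝ≥0∞}
    {M : α → Matrix ι ι ℂ} (h : ∀ a b, MemLp (fun x => M x a b) p μ) : MemLp M p μ := by
  have e : M = fun x => ∑ a, ∑ b, ContinuousLinearMap.toSpanSingleton ℂ
      (Matrix.single a b (1 : ℂ)) (M x a b) := by
    funext x
    conv_lhs => rw [Matrix.matrix_eq_sum_single (M x)]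
    simp [Matrix.smul_single]
  rw [e]
  exact memLp_finsetSum _ fun a _ => memLp_finsetSum _ fun b _ =>
    ContinuousLinearMap.comp_memLp' _ (h a b)

theorem MeasureTheory.MemLp.entry {α : Type*} [MeasurableSpace α] {μ : Measure α} {p : ℝ≥0∞}
    {M : α → Matrix ι ι ℂ} (h : MemLp M p μ) (a b : ι) : MemLp (fun x => M x a b) p μ :=
  ContinuousLinearMap.comp_memLp' (entryCLM a b) h

theorem memLp_matrix_iff {α : Type*} [MeasurableSpace α] {μ : Measure α} {p : ℝ≥0∞}
    {M : α → Matrix ι ι ℂ} : MemLp M p μ ↔ ∀ a b, MemLp (fun x => M x a b) p μ :=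
  ⟨fun h => h.entry, memLp_matrix⟩

theorem integrable_matrix_iff {α : Type*} [MeasurableSpace α] {μ : Measure α}
    {M : α → Matrix ι ι ℂ} : Integrable M μ ↔ ∀ a b, Integrable (fun x => M x a b) μ := by
  simp only [← memLp_one_iff_integrable, memLp_matrix_iff]

theorem dysonTerm_eq_dyson {Q : ℝ → Matrix ι ι ℂ} {S : Set ℝ} (hQ : IntegrableOn Q S) (k : ℕ) :
    dysonTerm Q k S = dyson Q k (volume.restrict S) := by
  induction k generalizing S with
  | zero => rfl
  | succ k ih =>
    have hS : ∀ z, volume.restrict (S ∩ Iio z) = (volume.restrict S).restrict (Iio z) := fun z => by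
      rw [Measure.restrict_restrict measurableSet_Iio, inter_comm]
    have hi : Integrable (fun z => dyson Q k ((volume.restrict S).restrict (Iio z)) * Q z)
        (volume.restrict S) :=
      Integrable.continuous_bdd_mul hQ (continuous_dyson_Iio hQ k) (norm_dyson_Iio_le hQ k)
    ext a b
    have := (entryCLM a b).integral_comp_comm hi
    simp only [entryCLM_apply] at this
    rw [dysonTerm, dyson, Matrix.of_apply, ← this]
    refine integral_congr_ae (.of_forall fun z => ?_)
    dsimp only
    rw [ih (hQ.mono_set inter_subset_left), hS]

theorem pathExp_eq_orderedExp {Q : ℝ → Matrix ι ι ℂ} {S : Set ℝ} (hQ : IntegrableOn Q S) :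
    pathExp Q S = orderedExp Q (volume.restrict S) := by
  ext a b
  have h := (entryCLM a b).map_tsum (summable_dyson hQ)
  simp only [entryCLM_apply] at h
  rw [pathExp, Matrix.of_apply, orderedExp, h]
  simp only [dysonTerm_eq_dyson hQ]

namespace CMPOTensors

variable {t : CMPOTensors ι} {I : Set ℝ}

theorem Regular.integrable_Q (ht : t.Regular I) : Integrable t.Q (volume.restrict I) :=
  integrable_matrix_iff.2 ht.Q_mem

theorem Regular.memLp_L (ht : t.Regular I) : MemLp t.L 2 (volume.restrict I) :=
  memLp_matrix ht.L_mem

theorem Regular.memLp_R (ht : t.Regular I) : MemLp t.R 2 (volume.restrict I) :=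
  memLp_matrix ht.R_mem

theorem Regular.memLp_T (ht : t.Regular I) : MemLp t.T ∞ (volume.restrict I) :=
  memLp_matrix ht.T_mem

/-- The matrix `K^α(x)` in the interaction picture. -/
noncomputable def dressed (t : CMPOTensors ι) (I : Set ℝ) (α : Ladder) (x : ℝ) : Matrix ι ι ℂ :=
  orderedExp t.Q ((volume.restrict I).restrict (Iio x)) * t.K α x *
    orderedExpInv t.Q ((volume.restrict I).restrict (Iio x))

/-- Every propagator from x to y is U(x)⁻¹U(y), so each U(x)⁻¹ can be grouped with the K(x) before
it and the U(x) preceding that. The left end y is a free parameter for the induction along the word.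
-/
theorem word_Ioi (hQ : Integrable t.Q (volume.restrict I)) (l : List (Ladder × ℝ))
    (hl : l.Pairwise fun p q => p.2 ≤ q.2) (y : ℝ) (hy : ∀ p ∈ l, y ≤ p.2) :
    t.word (I ∩ Ioi y) l = orderedExpInv t.Q ((volume.restrict I).restrict (Iio y)) *
      ((l.map fun p => t.dressed I p.1 p.2).prod * orderedExp t.Q (volume.restrict I)) := by
  have hI : volume.restrict (I ∩ Ioi y) = (volume.restrict I).restrict (Ioi y) := by
    rw [Measure.restrict_restrict measurableSet_Ioi, inter_comm]
  induction l generalizing y with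
  | nil =>
    rw [word, pathExp_eq_orderedExp (IntegrableOn.mono_set hQ inter_subset_left), hI,
      ← orderedExp_Iio_mul_orderedExp_Ioi hQ y]
    rw [← mul_assoc, List.map_nil, List.prod_nil, mul_one, ← mul_assoc,
      orderedExpInv_mul_orderedExp hQ.restrict, one_mul]
  | cons p l ih =>
    obtain ⟨α, x⟩ := p
    rw [List.pairwise_cons] at hl
    have hyx : y ≤ x := hy (α, x) (by simp)
    have e : I ∩ Ioi y ∩ Ioi x = I ∩ Ioi x := by
      rw [inter_assoc, Ioi_inter_Ioi, sup_eq_right.2 hyx]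
    rw [word, e, ih hl.2 x (fun p hp => hl.1 p hp)
      (by rw [Measure.restrict_restrict measurableSet_Ioi, inter_comm]),
      pathExp_eq_orderedExp (IntegrableOn.mono_set hQ fun z hz => hz.1.1)]
    have h := orderedExp_Iio_mul_orderedExp_Ioi (hQ.restrict (s := Iio x)) y
    have e2 : volume.restrict (I ∩ Ioi y ∩ Iio x)
        = ((volume.restrict I).restrict (Iio x)).restrict (Ioi y) := by
      rw [Measure.restrict_restrict measurableSet_Ioi,
        Measure.restrict_restrict (measurableSet_Ioi.inter measurableSet_Iio)]
      congr 1
      ext; simp; tauto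
    rw [restrict_Iio_restrict_Iio hyx, ← e2] at h
    have h' : orderedExp t.Q (volume.restrict (I ∩ Ioi y ∩ Iio x))
        = orderedExpInv t.Q ((volume.restrict I).restrict (Iio y)) *
          orderedExp t.Q ((volume.restrict I).restrict (Iio x)) := by
      rw [← h, ← mul_assoc, orderedExpInv_mul_orderedExp hQ.restrict, one_mul]
    rw [h', List.map_cons, List.prod_cons, dressed]
    simp only [mul_assoc]

theorem word_eq (hQ : Integrable t.Q (volume.restrict I)) (l : List (Ladder × ℝ))
    (hl : l.Pairwise fun p q => p.2 ≤ q.2) :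
    t.word I l = (l.map fun p => t.dressed I p.1 p.2).prod *
      orderedExp t.Q (volume.restrict I) := by
  cases l with
  | nil => rw [word, pathExp_eq_orderedExp hQ]; simp
  | cons p l =>
    obtain ⟨α, x⟩ := p
    rw [List.pairwise_cons] at hl
    rw [word, word_Ioi hQ l hl.2 x (fun p hp => hl.1 p hp),
      pathExp_eq_orderedExp (IntegrableOn.mono_set hQ inter_subset_left), inter_comm,
      ← Measure.restrict_restrict measurableSet_Iio, List.map_cons, List.prod_cons, dressed]
    simp only [mul_assoc]

/-- Coinciding points are allowed; this is what later gives the coefficients on the closed chamber.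
-/
theorem coeff_eq (hQ : Integrable t.Q (volume.restrict I)) {j : ℕ} (α : Fin j → Ladder)
    {x : Fin j → ℝ} (hx : Monotone x) :
    t.coeff I α x = Matrix.trace (t.B * ((List.ofFn fun i => t.dressed I (α i) (x i)).prod *
      orderedExp t.Q (volume.restrict I))) := by
  rw [coeff, word_eq hQ, List.map_ofFn]
  · rfl
  · rw [List.pairwise_ofFn]
    exact fun i k h => hx h.le

/-- The conjugating factors are continuous and uniformly bounded. -/
theorem memLp_dressed (hQ : Integrable t.Q (volume.restrict I)) {α : Ladder} {p : ℝ≥0∞}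
    (h : MemLp (t.K α) p (volume.restrict I)) : MemLp (t.dressed I α) p (volume.restrict I) := by
  obtain ⟨C, hC⟩ := exists_norm_orderedExpInv_Iio_le hQ
  set C' := ∑' k : ℕ, ‖(1 : Matrix ι ι ℂ)‖ * ((∫ z in I, ‖t.Q z‖) ^ k / k !)
  have hC' : ∀ z, ‖orderedExp t.Q ((volume.restrict I).restrict (Iio z))‖ ≤ C' :=
    norm_orderedExp_Iio_le hQ
  refine h.of_le_mul (c := C' * C) ?_ (.of_forall fun x => ?_)
  · exact ((continuous_orderedExp_Iio hQ).aestronglyMeasurable.mul h.aestronglyMeasurable).mul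
      (continuous_orderedExpInv_Iio hQ).aestronglyMeasurable
  · have h0 : 0 ≤ C' := (norm_nonneg _).trans (hC' 0)
    calc ‖t.dressed I α x‖ ≤ C' * ‖t.K α x‖ * C :=
          (norm_mul_le _ _).trans (mul_le_mul ((norm_mul_le _ _).trans
            (mul_le_mul_of_nonneg_right (hC' x) (norm_nonneg _))) (hC x) (norm_nonneg _)
            (by positivity))
      _ = C' * C * ‖t.K α x‖ := by ring

theorem continuousOn_dressed (hQ : Integrable t.Q (volume.restrict I)) (h : t.ContinuousLRT I)
    (α : Ladder) : ContinuousOn (t.dressed I α) I := by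
  have hK : ContinuousOn (t.K α) I := by
    cases α
    · exact h.1
    · exact h.2.1
    · exact h.2.2
  exact ((continuous_orderedExp_Iio hQ).continuousOn.mul hK).mul
    (continuous_orderedExpInv_Iio hQ).continuousOn

end CMPOTensors

/-- The trace as a continuous linear functional. -/
noncomputable def traceCLM (B V : Matrix ι ι ℂ) : Matrix ι ι ℂ →L[ℂ] ℂ :=
  LinearMap.toContinuousLinearMap
    { toFun := fun M => Matrix.trace (B * (M * V))
      map_add' := fun M N => by rw [add_mul, mul_add, Matrix.trace_add]
      map_smul' := fun c M => by simp [Matrix.trace_smul] }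

@[simp] theorem traceCLM_apply (B V M : Matrix ι ι ℂ) :
    traceCLM B V M = Matrix.trace (B * (M * V)) := rfl

theorem norm_list_prod_le_mul {𝔸 : Type*} [NormedRing 𝔸] (l : List 𝔸) :
    ‖l.prod‖ ≤ ‖(1 : 𝔸)‖ * (l.map norm).prod := by
  induction l with
  | nil => simp
  | cons a l ih =>
    rw [List.prod_cons, List.map_cons, List.prod_cons]
    calc ‖a * l.prod‖ ≤ ‖a‖ * (‖(1 : 𝔸)‖ * (l.map norm).prod) :=
          (norm_mul_le _ _).trans (mul_le_mul_of_nonneg_left ih (norm_nonneg _))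
      _ = _ := by ring

theorem CMPOTensors.exists_norm_coeff_le {t : CMPOTensors ι} {I : Set ℝ}
    (hQ : Integrable t.Q (volume.restrict I)) :
    ∃ C, 0 ≤ C ∧ ∀ (j : ℕ) (α : Fin j → Ladder) (x : Fin j → ℝ), Monotone x →
      ‖t.coeff I α x‖ ≤ C * ∏ i, ‖t.dressed I (α i) (x i)‖ := by
  refine ⟨‖traceCLM t.B (orderedExp t.Q (volume.restrict I))‖ * ‖(1 : Matrix ι ι ℂ)‖,
    by positivity, fun j α x hx => ?_⟩
  rw [coeff_eq hQ α hx, ← traceCLM_apply, mul_assoc]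
  refine (ContinuousLinearMap.le_opNorm _ _).trans
    (mul_le_mul_of_nonneg_left ?_ (norm_nonneg _))
  refine (norm_list_prod_le_mul _).trans (le_of_eq ?_)
  rw [List.map_ofFn, List.prod_ofFn]
  rfl

end MatrixValued

/-! ### Ordered configurations and permutations of coordinates -/

section OrderedConfigurations

theorem measurableSet_strictMono (n : ℕ) : MeasurableSet {x : Fin n → ℝ | StrictMono x} := by
  simp only [StrictMono, ofPred_forall]
  exact .iInter fun i => .iInter fun j => .iInter fun _ =>
    measurableSet_lt (measurable_pi_apply i) (measurable_pi_apply j)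

theorem aestronglyMeasurable_list_prod {𝔸 : Type*} [NormedRing 𝔸] {μ : Measure ℝ} [SigmaFinite μ]
    {n : ℕ} {C : Fin n → ℝ → 𝔸} (hC : ∀ i, AEStronglyMeasurable (C i) μ) :
    AEStronglyMeasurable (fun x : Fin n → ℝ => (List.ofFn fun i => C i (x i)).prod)
      (Measure.pi fun _ => μ) := by
  have h := List.aestronglyMeasurable_fun_prod (μ := Measure.pi fun _ : Fin n => μ)
    (List.ofFn fun i => fun x : Fin n → ℝ => C i (x i)) (fun f hf => by
      obtain ⟨i, rfl⟩ := (List.mem_ofFn' _ _).1 hf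
      exact (hC i).comp_quasiMeasurePreserving (Measure.quasiMeasurePreserving_eval _ i))
  simpa [List.map_ofFn, Function.comp_def] using h

theorem integrable_list_prod {𝔸 : Type*} [NormedRing 𝔸] {μ : Measure ℝ} [SigmaFinite μ]
    {n : ℕ} {C : Fin n → ℝ → 𝔸} (hC : ∀ i, Integrable (C i) μ) :
    Integrable (fun x : Fin n → ℝ => (List.ofFn fun i => C i (x i)).prod)
      (Measure.pi fun _ => μ) := by
  have h : Integrable (fun x : Fin n → ℝ => ‖(1 : 𝔸)‖ * ∏ i, ‖C i (x i)‖) (Measure.pi fun _ => μ) :=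
    (Integrable.fintype_prod (f := fun i z => ‖C i z‖) fun i => (hC i).norm).const_mul _
  refine h.mono' (aestronglyMeasurable_list_prod fun i => (hC i).aestronglyMeasurable)
    (.of_forall fun x => ?_)
  refine (norm_list_prod_le_mul _).trans (le_of_eq ?_)
  rw [List.map_ofFn, List.prod_ofFn]
  rfl

/-- Fubini in the last, largest coordinate z: the remaining coordinates form an ordered
configuration below z, which is the recursion that defines `dyson`. -/
theorem setIntegral_strictMono_list_prod {𝔸 : Type*} [NormedRing 𝔸] [NormedAlgebra ℝ 𝔸]
    [CompleteSpace 𝔸] {μ : Measure ℝ} [SigmaFinite μ] {C : ℝ → 𝔸} (hC : Integrable C μ) (k : ℕ) :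
    ∫ x in {x : Fin k → ℝ | StrictMono x}, (List.ofFn fun i => C (x i)).prod
      ∂(Measure.pi fun _ => μ) = dyson C k μ := by
  induction k generalizing μ with
  | zero =>
    have : {x : Fin 0 → ℝ | StrictMono x} = univ := by
      ext x; simp [StrictMono]
    simp [this, dyson, Measure.real]
  | succ k ih =>
    have hmp := (measurePreserving_piFinSuccAbove (fun _ : Fin (k + 1) => μ) (Fin.last k)).symm
    have hi := (integrable_list_prod (n := k + 1) fun _ => hC).indicator
      (measurableSet_strictMono (k + 1))
    have hi' := hmp.integrable_comp_of_integrable hi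
    rw [← integral_indicator (measurableSet_strictMono _), ← hmp.integral_comp'
      (g := indicator _ _)]
    refine (integral_prod _ hi').trans ?_
    rw [dyson]
    refine integral_congr_ae (.of_forall fun z => ?_)
    dsimp only
    have hr : (Measure.pi fun _ : Fin k => μ.restrict (Iio z))
        = (Measure.pi fun _ : Fin k => μ).restrict (univ.pi fun _ => Iio z) := by
      rw [Measure.restrict_pi_pi]
    rw [← ih hC.restrict, hr, Measure.restrict_restrict (measurableSet_strictMono k),
      ← integral_mul_const_of_integrable (integrable_list_prod fun _ => hC).integrableOn,
      ← integral_indicator ((measurableSet_strictMono k).inter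
        (.univ_pi fun _ => measurableSet_Iio))]
    refine integral_congr_ae (.of_forall fun x => ?_)
    have hx : (MeasurableEquiv.piFinSuccAbove (fun _ : Fin (k + 1) => ℝ) (Fin.last k)).symm (z, x)
        = Fin.snoc (α := fun _ => ℝ) x z := by
      exact Fin.insertNth_last (α := fun _ => ℝ) z x
    have hm : StrictMono (Fin.snoc (α := fun _ => ℝ) x z) ↔
        x ∈ {x : Fin k → ℝ | StrictMono x} ∩ univ.pi fun _ => Iio z := by
      constructor
      · intro h
        refine ⟨fun i j hij => ?_, fun i _ => ?_⟩
        · simpa using h (Fin.castSucc_lt_castSucc_iff.2 hij)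
        · simpa using h (Fin.castSucc_lt_last i)
      · rintro ⟨h1, h2⟩ i j
        refine Fin.lastCases (fun h => ?_) (fun i => ?_) i
        · exact absurd h (not_lt.2 (Fin.le_last j))
        · refine Fin.lastCases (fun _ => ?_) (fun j h => ?_) j
          · simpa using h2 i (mem_univ i)
          · simpa using h1 (Fin.castSucc_lt_castSucc_iff.1 h)
    dsimp only
    rw [Function.comp_apply, hx]
    by_cases h : x ∈ {x : Fin k → ℝ | StrictMono x} ∩ univ.pi fun _ => Iio z
    · rw [indicator_of_mem h, indicator_of_mem (show _ ∈ {x | StrictMono x} from hm.2 h),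
        List.ofFn_succ', List.concat_eq_append, List.prod_append]
      simp
    · rw [indicator_of_notMem h, indicator_of_notMem fun h' => h (hm.1 h')]

variable {I : Set ℝ}

theorem boxMeasure_eq (I : Set ℝ) (n : ℕ) :
    boxMeasure I n = (volume : Measure (Fin n → ℝ)).restrict (univ.pi fun _ => I) := by
  rw [volume_pi, Measure.restrict_pi_pi]
  rfl

instance (I : Set ℝ) (n : ℕ) : SigmaFinite (boxMeasure I n) := by
  unfold boxMeasure; infer_instance

/-- Lebesgue measure on the ordered configurations. -/
noncomputable abbrev orderedMeasure (I : Set ℝ) (n : ℕ) : Measure (Fin n → ℝ) :=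
  volume.restrict (orderedConfigs I n)

theorem orderedMeasure_eq (I : Set ℝ) (n : ℕ) :
    orderedMeasure I n = (boxMeasure I n).restrict {x | StrictMono x} := by
  have : orderedConfigs I n = {x | StrictMono x} ∩ univ.pi fun _ => I := by
    ext x; simp [orderedConfigs]
  rw [boxMeasure_eq, Measure.restrict_restrict (measurableSet_strictMono n), ← this]

theorem orderedMeasure_le (I : Set ℝ) (n : ℕ) : orderedMeasure I n ≤ boxMeasure I n := by
  rw [orderedMeasure_eq]
  exact Measure.restrict_le_self

theorem ae_orderedMeasure_of_box {n : ℕ} {p : (Fin n → ℝ) → Prop}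
    (h : ∀ᵐ x ∂boxMeasure I n, p x) : ∀ᵐ x ∂orderedMeasure I n, p x :=
  (orderedMeasure_le I n).absolutelyContinuous.ae_le h

theorem ae_strictMono (I : Set ℝ) (n : ℕ) : ∀ᵐ x ∂orderedMeasure I n, StrictMono x := by
  rw [orderedMeasure_eq]
  exact ae_restrict_mem (measurableSet_strictMono n)

theorem ae_mem_orderedConfigs (hI : MeasurableSet I) (n : ℕ) :
    ∀ᵐ x ∂orderedMeasure I n, x ∈ orderedConfigs I n := by
  refine ae_restrict_mem ?_
  have : orderedConfigs I n = {x | StrictMono x} ∩ univ.pi fun _ => I := by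
    ext x; simp [orderedConfigs]
  rw [this]
  exact (measurableSet_strictMono n).inter (.univ_pi fun _ => hI)

theorem setIntegral_orderedConfigs_list_prod {𝔸 : Type*} [NormedRing 𝔸] [NormedAlgebra ℝ 𝔸]
    [CompleteSpace 𝔸] {C : ℝ → 𝔸} (hC : Integrable C (volume.restrict I)) (k : ℕ) :
    ∫ x in orderedConfigs I k, (List.ofFn fun i => C (x i)).prod
      = dyson C k (volume.restrict I) := by
  have := setIntegral_strictMono_list_prod hC k
  rw [← this]
  exact congrArg (fun μ => ∫ x, (List.ofFn fun i => C (x i)).prod ∂μ) (orderedMeasure_eq I k)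

/-- The points with xᵢ = xⱼ form a proper subspace, which is a Lebesgue null set. -/
theorem ae_injective (I : Set ℝ) (n : ℕ) : ∀ᵐ x ∂boxMeasure I n, Function.Injective x := by
  have h : ∀ i j : Fin n, i ≠ j → ∀ᵐ x ∂(volume : Measure (Fin n → ℝ)), x i ≠ x j := by
    intro i j hij
    let f : (Fin n → ℝ) →ₗ[ℝ] ℝ := (LinearMap.proj i : (Fin n → ℝ) →ₗ[ℝ] ℝ) - LinearMap.proj j
    have hf : LinearMap.ker f ≠ ⊤ := by
      intro h
      have : Pi.single i (1 : ℝ) ∈ LinearMap.ker f := h ▸ Submodule.mem_top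
      simp [f, hij.symm] at this
    have := Measure.addHaar_submodule (volume : Measure (Fin n → ℝ)) _ hf
    refine measure_mono_null (fun x hx => ?_) this
    simp only [ne_eq, mem_compl_iff, mem_ofPred_eq, not_not] at hx
    simp [f, hx]
  rw [boxMeasure_eq]
  refine ae_restrict_of_ae ?_
  have h' : ∀ᵐ x ∂(volume : Measure (Fin n → ℝ)), ∀ i j : Fin n, i ≠ j → x i ≠ x j := by
    simpa only [ae_all_iff] using h
  filter_upwards [h'] with x hx i j hij
  by_contra hne
  exact hx i j hne hij

theorem measurable_comp_perm {n : ℕ} (σ : Equiv.Perm (Fin n)) :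
    Measurable fun x : Fin n → ℝ => x ∘ σ :=
  measurable_pi_lambda _ fun i => measurable_pi_apply (σ i)

/-- Up to null sets, the box is the disjoint union of the images of the ordered configurations
under permutations of the coordinates. -/
theorem boxMeasure_eq_sum (I : Set ℝ) (n : ℕ) :
    boxMeasure I n
      = ∑ σ : Equiv.Perm (Fin n), (orderedMeasure I n).map fun x : Fin n → ℝ => x ∘ σ := by
  ext A hA
  let E : Equiv.Perm (Fin n) → Set (Fin n → ℝ) := fun τ => {x | StrictMono (x ∘ τ)}
  have hE : ∀ τ, MeasurableSet (E τ) := fun τ =>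
    measurable_comp_perm τ (measurableSet_strictMono n)
  have hd : Pairwise (Function.onFun Disjoint fun τ => A ∩ E τ) := by
    intro τ τ' hne
    refine Set.disjoint_left.2 fun x hx hx' => hne ?_
    have h1 : StrictMono (x ∘ τ) := hx.2
    have h2 : StrictMono (x ∘ τ') := hx'.2
    have := Tuple.unique_monotone h1.monotone h2.monotone
    have hinj : Function.Injective x := by
      have := h1.injective
      intro i j hij
      have h3 := @this (τ.symm i) (τ.symm j) (by simpa using hij)
      simpa using h3
    exact Equiv.ext fun i => hinj (congrFun this i)
  have hu : boxMeasure I n A = boxMeasure I n (⋃ τ, A ∩ E τ) := by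
    refine measure_congr ?_
    filter_upwards [ae_injective I n] with x hx
    refine propext ⟨fun h => ?_, fun h => ?_⟩
    · refine mem_iUnion.2 ⟨Tuple.sort x, h, ?_⟩
      exact (Tuple.monotone_sort x).strictMono_of_injective
        (hx.comp (Tuple.sort x).injective)
    · obtain ⟨τ, h, -⟩ := mem_iUnion.1 h
      exact h
  -- Composition with σ carries the ordered chamber onto the points sorted by σ⁻¹, hence the
  -- reindexing by inverses.
  rw [hu, measure_iUnion hd fun τ => hA.inter (hE τ), tsum_fintype, Measure.finsetSum_apply,
    ← Equiv.sum_comp (Equiv.inv (Equiv.Perm (Fin n)))]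
  refine Finset.sum_congr rfl fun σ _ => ?_
  have hs : MeasurableSet ((fun x : Fin n → ℝ => x ∘ σ) ⁻¹' A) := measurable_comp_perm σ hA
  rw [Measure.map_apply (measurable_comp_perm σ) hA, orderedMeasure_eq, Measure.restrict_apply hs,
    ← (measurePreserving_perm I σ).measure_preimage (hA.inter (hE _)).nullMeasurableSet]
  congr 1
  ext x
  have : (x ∘ σ) ∘ (σ⁻¹ : Equiv.Perm (Fin n)) = x := by
    funext i; simp
  simp only [Equiv.inv_apply, mem_preimage, mem_inter_iff, E, mem_ofPred_eq, this]

theorem aemeasurable_of_ordered {β : Type*} [MeasurableSpace β] {n : ℕ} {f : (Fin n → ℝ) → β}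
    (hf : AEMeasurable f (boxMeasure I n)) : AEMeasurable f (orderedMeasure I n) :=
  hf.mono_measure (orderedMeasure_le I n)

theorem lintegral_box_of_symm {n : ℕ} {f : (Fin n → ℝ) → ℝ≥0∞}
    (hf : AEMeasurable f (boxMeasure I n))
    (hs : ∀ σ : Equiv.Perm (Fin n), (fun x => f (x ∘ σ)) =ᵐ[boxMeasure I n] f) :
    ∫⁻ x, f x ∂boxMeasure I n = n ! * ∫⁻ x, f x ∂orderedMeasure I n := by
  have hle : ∀ σ : Equiv.Perm (Fin n),
      (orderedMeasure I n).map (fun x : Fin n → ℝ => x ∘ σ) ≤ boxMeasure I n := fun σ => by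
    refine (Measure.map_mono (orderedMeasure_le I n) (measurable_comp_perm σ)).trans ?_
    rw [(measurePreserving_perm I σ).map_eq]
  have h : ∀ σ : Equiv.Perm (Fin n),
      ∫⁻ x, f x ∂(orderedMeasure I n).map (fun x : Fin n → ℝ => x ∘ σ)
        = ∫⁻ x, f x ∂orderedMeasure I n := fun σ => by
    rw [lintegral_map' (hf.mono_measure (hle σ)) (measurable_comp_perm σ).aemeasurable]
    exact lintegral_congr_ae (ae_orderedMeasure_of_box (hs σ))
  conv_lhs => rw [boxMeasure_eq_sum]
  rw [lintegral_finsetSum_measure]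
  simp [h, Fintype.card_perm]

theorem integral_box_of_symm {n : ℕ} {f : (Fin n → ℝ) → ℂ}
    (hf : Integrable f (boxMeasure I n))
    (hs : ∀ σ : Equiv.Perm (Fin n), (fun x => f (x ∘ σ)) =ᵐ[boxMeasure I n] f) :
    ∫ x, f x ∂boxMeasure I n = n ! * ∫ x, f x ∂orderedMeasure I n := by
  have hle : ∀ σ : Equiv.Perm (Fin n),
      (orderedMeasure I n).map (fun x : Fin n → ℝ => x ∘ σ) ≤ boxMeasure I n := fun σ => by
    refine (Measure.map_mono (orderedMeasure_le I n) (measurable_comp_perm σ)).trans ?_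
    rw [(measurePreserving_perm I σ).map_eq]
  have h : ∀ σ : Equiv.Perm (Fin n),
      ∫ x, f x ∂(orderedMeasure I n).map (fun x : Fin n → ℝ => x ∘ σ)
        = ∫ x, f x ∂orderedMeasure I n := fun σ => by
    rw [integral_map (measurable_comp_perm σ).aemeasurable
      (hf.aestronglyMeasurable.mono_measure (hle σ))]
    exact integral_congr_ae (ae_orderedMeasure_of_box (hs σ))
  conv_lhs => rw [boxMeasure_eq_sum]
  rw [integral_finsetSum_measure fun σ _ => hf.mono_measure (hle σ)]
  simp [h, Fintype.card_perm]

theorem aemeasurable_prod_eval {μ : Measure ℝ} [SigmaFinite μ] {h : ℝ → ℝ≥0∞}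
    (hh : AEMeasurable h μ) (n : ℕ) :
    AEMeasurable (fun x : Fin n → ℝ => ∏ i, h (x i)) (Measure.pi fun _ => μ) :=
  Finset.aemeasurable_fun_prod _ fun i _ =>
    hh.comp_quasiMeasurePreserving (Measure.quasiMeasurePreserving_eval _ i)

theorem lintegral_pi_prod_eq_pow {μ : Measure ℝ} [SigmaFinite μ] {h : ℝ → ℝ≥0∞}
    (hh : AEMeasurable h μ) (n : ℕ) :
    ∫⁻ x : Fin n → ℝ, ∏ i, h (x i) ∂(Measure.pi fun _ => μ) = (∫⁻ z, h z ∂μ) ^ n := by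
  induction n with
  | zero => simp
  | succ n ih =>
    have hmp := (measurePreserving_piFinSuccAbove (fun _ : Fin (n + 1) => μ) 0).symm
    rw [← hmp.lintegral_comp_emb (MeasurableEquiv.measurableEmbedding _)]
    have e : ∀ p : ℝ × (Fin n → ℝ), ∏ i, h ((MeasurableEquiv.piFinSuccAbove
        (fun _ : Fin (n + 1) => ℝ) 0).symm p i) = h p.1 * ∏ i, h (p.2 i) := fun p => by
      rw [Fin.prod_univ_succ]
      simp [MeasurableEquiv.piFinSuccAbove]
    simp only [e]
    rw [lintegral_prod_mul hh (aemeasurable_prod_eval hh n), ih, pow_succ']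

/-- The integrand is symmetric, so each of the n! chambers carries the same share. This is the
source of the factorials in the convergence proof. -/
theorem lintegral_ordered_prod {h : ℝ → ℝ≥0∞} (hh : AEMeasurable h (volume.restrict I)) (n : ℕ) :
    ∫⁻ x, ∏ i, h (x i) ∂orderedMeasure I n = (∫⁻ z in I, h z) ^ n / n ! := by
  have h1 := lintegral_box_of_symm (I := I) (f := fun x : Fin n → ℝ => ∏ i, h (x i))
    (aemeasurable_prod_eval hh n) (fun σ => .of_forall fun x => Equiv.prod_comp σ fun i => h (x i))
  rw [ENNReal.eq_div_iff (by positivity) (by simp), ← h1]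
  exact lintegral_pi_prod_eq_pow hh n

theorem measurePreserving_comp_equiv {α β : Type*} [Fintype α] [Fintype β] {μ : Measure ℝ}
    [SigmaFinite μ] (e : α ≃ β) :
    MeasurePreserving (fun y : β → ℝ => y ∘ e) (Measure.pi fun _ => μ) (Measure.pi fun _ => μ) := by
  have h := measurePreserving_piCongrLeft (α := fun _ : α => ℝ) (fun _ : α => μ) e.symm
  have e' : (fun x : β → ℝ => x ∘ e)
      = MeasurableEquiv.piCongrLeft (fun _ : α => ℝ) e.symm := by
    funext x i
    have := Equiv.piCongrLeft_apply_apply (fun _ : α => ℝ) e.symm x (e i)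
    simpa [MeasurableEquiv.coe_piCongrLeft] using this.symm
  rw [e']
  exact h

theorem measurePreserving_subConfig {j : ℕ} (s : Finset (Fin j)) :
    MeasurePreserving (fun x : Fin j → ℝ => (subConfig s x, subConfig sᶜ x)) (boxMeasure I j)
      ((boxMeasure I s.card).prod (boxMeasure I sᶜ.card)) := by
  have h1 := measurePreserving_piEquivPiSubtypeProd
    (fun _ : Fin j => (volume : Measure ℝ).restrict I) (fun i => i ∈ s)
  let e1 : Fin s.card ≃ {i // i ∈ s} := (s.orderIsoOfFin rfl).toEquiv
  let e2 : Fin sᶜ.card ≃ {i // i ∉ s} := (sᶜ.orderIsoOfFin rfl).toEquiv.trans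
    (Equiv.subtypeEquivRight fun i => Finset.mem_compl)
  have h2 := (measurePreserving_comp_equiv (μ := volume.restrict I) e1).prod
    (measurePreserving_comp_equiv (μ := volume.restrict I) e2)
  have hinst : Subtype.fintype (fun i => i ∈ s) = Finset.Subtype.fintype s := Subsingleton.elim _ _
  rw [hinst] at h1
  exact h2.comp h1

theorem measurable_subConfig {j : ℕ} (s : Finset (Fin j)) : Measurable (subConfig s) :=
  measurable_pi_lambda _ fun _ => measurable_pi_apply _

theorem quasiMeasurePreserving_subConfig {j : ℕ} (s : Finset (Fin j)) :
    Measure.QuasiMeasurePreserving (subConfig s) (boxMeasure I j) (boxMeasure I s.card) :=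
  Measure.quasiMeasurePreserving_fst.comp (measurePreserving_subConfig s).quasiMeasurePreserving

theorem StrictMono.subConfig {j : ℕ} (s : Finset (Fin j)) {x : Fin j → ℝ} (hx : StrictMono x) :
    StrictMono (subConfig s x) :=
  hx.comp (s.orderEmbOfFin rfl).strictMono

/-- Amplitudes are defined only almost everywhere; this lets such statements be pulled back to
subconfigurations. -/
theorem quasiMeasurePreserving_subConfig_ordered {j : ℕ} (s : Finset (Fin j)) :
    Measure.QuasiMeasurePreserving (subConfig s) (orderedMeasure I j)
      (orderedMeasure I s.card) := by
  refine ⟨measurable_subConfig s, Measure.AbsolutelyContinuous.mk fun A hA h => ?_⟩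
  rw [orderedMeasure_eq, Measure.restrict_apply hA] at h
  rw [Measure.map_apply (measurable_subConfig s) hA, orderedMeasure_eq,
    Measure.restrict_apply (measurable_subConfig s hA)]
  refine measure_mono_null (fun x hx => ?_) ((quasiMeasurePreserving_subConfig s).preimage_null h)
  exact ⟨hx.1, hx.2.subConfig s⟩

/-- Forgetting the relative order of the coordinates in s and in its complement, while keeping the
order within each, enlarges the domain to a product of two chambers. Tonelli does the rest. -/
theorem lintegral_ordered_subConfig_le {j : ℕ} (s : Finset (Fin j)) {A : (Fin s.card → ℝ) → ℝ≥0∞}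
    (hA : Measurable A) {h : ℝ → ℝ≥0∞} (hh : AEMeasurable h (volume.restrict I)) :
    ∫⁻ x, A (subConfig s x) * ∏ i ∈ sᶜ, h (x i) ∂orderedMeasure I j
      ≤ (∫⁻ y, A y ∂orderedMeasure I s.card) * ((∫⁻ z in I, h z) ^ sᶜ.card / sᶜ.card !) := by
  let F : (Fin s.card → ℝ) × (Fin sᶜ.card → ℝ) → ℝ≥0∞ := fun p =>
    {y | StrictMono y}.indicator A p.1 * {w | StrictMono w}.indicator (fun w => ∏ i, h (w i)) p.2
  have h1 : AEMeasurable ({y | StrictMono y}.indicator A) (boxMeasure I s.card) :=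
    (hA.indicator (measurableSet_strictMono _)).aemeasurable
  have h2 : AEMeasurable ({w | StrictMono w}.indicator (fun w => ∏ i, h (w i)))
      (boxMeasure I sᶜ.card) :=
    (aemeasurable_prod_eval hh _).indicator (measurableSet_strictMono _)
  have hF : AEMeasurable F ((boxMeasure I s.card).prod (boxMeasure I sᶜ.card)) :=
    (h1.comp_quasiMeasurePreserving Measure.quasiMeasurePreserving_fst).mul
      (h2.comp_quasiMeasurePreserving Measure.quasiMeasurePreserving_snd)
  have hmp := measurePreserving_subConfig (I := I) s
  calc ∫⁻ x, A (subConfig s x) * ∏ i ∈ sᶜ, h (x i) ∂orderedMeasure I j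
      = ∫⁻ x, F (subConfig s x, subConfig sᶜ x) ∂orderedMeasure I j := by
        refine lintegral_congr_ae ?_
        filter_upwards [ae_strictMono I j] with x hx
        simp only [F]
        rw [indicator_of_mem (show _ ∈ {y | StrictMono y} from hx.subConfig s),
          indicator_of_mem (show _ ∈ {y | StrictMono y} from hx.subConfig sᶜ)]
        congr 1
        have := Finset.prod_map Finset.univ (sᶜ.orderEmbOfFin rfl).toEmbedding fun i => h (x i)
        rwa [Finset.map_orderEmbOfFin_univ] at this
    _ ≤ ∫⁻ x, F (subConfig s x, subConfig sᶜ x) ∂boxMeasure I j :=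
        lintegral_mono' (orderedMeasure_le I j) le_rfl
    _ = ∫⁻ p, F p ∂(boxMeasure I s.card).prod (boxMeasure I sᶜ.card) := by
        rw [← hmp.map_eq] at hF ⊢
        rw [lintegral_map' hF hmp.measurable.aemeasurable]
    _ = _ := by
        rw [lintegral_prod_mul h1 h2, lintegral_indicator (measurableSet_strictMono _),
          lintegral_indicator (measurableSet_strictMono _), ← orderedMeasure_eq,
          ← orderedMeasure_eq, lintegral_ordered_prod hh]

end OrderedConfigurations

/-! ### Amplitudes of Fock space vectors -/

section FockSpace

variable {I : Set ℝ}

theorem measurable_amplitude (Φ : Fock I) (n : ℕ) : Measurable (amplitude Φ n) :=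
  (Lp.stronglyMeasurable _).measurable.const_mul _

theorem amplitude_add (Φ Ψ : Fock I) (n : ℕ) :
    amplitude (Φ + Ψ) n =ᵐ[orderedMeasure I n] fun x => amplitude Φ n x + amplitude Ψ n x := by
  refine ae_orderedMeasure_of_box ?_
  filter_upwards [Lp.coeFn_add (Φ n : Lp ℂ 2 (boxMeasure I n)) (Ψ n)] with x hx
  simp only [amplitude, lp.coeFn_add, Pi.add_apply, Submodule.coe_add, hx]
  ring

theorem amplitude_smul (c : ℂ) (Φ : Fock I) (n : ℕ) :
    amplitude (c • Φ) n =ᵐ[orderedMeasure I n] fun x => c * amplitude Φ n x := by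
  refine ae_orderedMeasure_of_box ?_
  filter_upwards [Lp.coeFn_smul c (Φ n : Lp ℂ 2 (boxMeasure I n))] with x hx
  simp only [amplitude, lp.coeFn_smul, Pi.smul_apply, Submodule.coe_smul, hx, smul_eq_mul]
  ring

theorem amplitude_zero {Φ : Fock I} {n : ℕ} (h : Φ n = 0) :
    amplitude Φ n =ᵐ[orderedMeasure I n] 0 := by
  refine ae_orderedMeasure_of_box ?_
  filter_upwards [Lp.coeFn_zero ℂ 2 (boxMeasure I n)] with x hx
  rw [amplitude, h, Submodule.coe_zero, hx]
  simp

theorem nparticle_symm (f : NParticle I n) (σ : Equiv.Perm (Fin n)) :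
    (fun x : Fin n → ℝ => (f : Lp ℂ 2 (boxMeasure I n)) (x ∘ σ)) =ᵐ[boxMeasure I n]
      (f : Lp ℂ 2 (boxMeasure I n)) := f.2 σ

theorem enorm_sq_eq_lintegral {α : Type*} [MeasurableSpace α] {μ : Measure α} (f : Lp ℂ 2 μ) :
    ‖f‖ₑ ^ 2 = ∫⁻ x, ‖f x‖ₑ ^ 2 ∂μ := by
  have := eLpNorm_nnreal_pow_eq_lintegral (f := f) (μ := μ) (p := 2) (by norm_num)
  rw [Lp.enorm_def]
  simpa using this

/-- The square of the prefactor √(n!) makes up for integrating over one chamber out of n!. -/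
theorem lintegral_amplitude (Φ : Fock I) (n : ℕ) :
    ∫⁻ x, ‖amplitude Φ n x‖ₑ ^ 2 ∂orderedMeasure I n = ‖Φ n‖ₑ ^ 2 := by
  have h1 : ‖Φ n‖ₑ ^ 2 = ∫⁻ x, ‖(Φ n : Lp ℂ 2 (boxMeasure I n)) x‖ₑ ^ 2 ∂boxMeasure I n :=
    enorm_sq_eq_lintegral _
  have hm : Measurable fun x => ‖(Φ n : Lp ℂ 2 (boxMeasure I n)) x‖ₑ ^ 2 :=
    (Lp.stronglyMeasurable _).measurable.enorm.pow_const 2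
  rw [h1, lintegral_box_of_symm hm.aemeasurable (fun σ => ?_), ← lintegral_const_mul _ hm]
  · refine lintegral_congr fun x => ?_
    rw [amplitude, enorm_mul, mul_pow]
    congr 1
    have : (‖((Real.sqrt (n ! : ℝ) : ℝ) : ℂ)‖ₑ) = ENNReal.ofReal (Real.sqrt (n ! : ℝ)) := by
      rw [← ofReal_norm, Complex.norm_real, Real.norm_of_nonneg (Real.sqrt_nonneg _)]
    rw [this, ← ENNReal.ofReal_pow (Real.sqrt_nonneg _), Real.sq_sqrt (by positivity)]
    simp
  · filter_upwards [nparticle_symm (Φ n) σ] with x hx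
    rw [hx]

theorem memLp_two_of_lintegral {α : Type*} [MeasurableSpace α] {μ : Measure α} {f : α → ℂ}
    (hf : AEStronglyMeasurable f μ) (h : ∫⁻ x, ‖f x‖ₑ ^ 2 ∂μ < ∞) : MemLp f 2 μ := by
  refine ⟨hf, ?_⟩
  have := eLpNorm_nnreal_pow_eq_lintegral (f := f) (μ := μ) (p := 2) (by norm_num)
  simp only [NNReal.coe_ofNat, ENNReal.rpow_ofNat, ENNReal.coe_ofNat] at this
  rw [← this] at h
  by_contra hn
  rw [not_lt, top_le_iff] at hn
  rw [hn] at h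
  simp at h

theorem memLp_amplitude (Φ : Fock I) (n : ℕ) : MemLp (amplitude Φ n) 2 (orderedMeasure I n) := by
  refine memLp_two_of_lintegral (measurable_amplitude Φ n).aestronglyMeasurable ?_
  rw [lintegral_amplitude]
  exact ENNReal.pow_lt_top enorm_lt_top

theorem eq_zero_of_amplitude {Φ : Fock I} {n : ℕ} (h : amplitude Φ n =ᵐ[orderedMeasure I n] 0) :
    Φ n = 0 := by
  have h1 := lintegral_amplitude Φ n
  rw [lintegral_congr_ae (g := fun _ => 0) (by
    filter_upwards [h] with x hx
    rw [hx]; simp), lintegral_zero] at h1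
  exact enorm_eq_zero.1 (pow_eq_zero_iff two_ne_zero |>.1 h1.symm)

theorem inner_apply_eq_integral (Φ Ψ : Fock I) (n : ℕ) :
    inner ℂ (Φ n) (Ψ n)
      = ∫ x in orderedConfigs I n, conj (amplitude Φ n x) * amplitude Ψ n x := by
  have h1 : inner ℂ (Φ n) (Ψ n) = ∫ x, conj ((Φ n : Lp ℂ 2 (boxMeasure I n)) x) *
      (Ψ n : Lp ℂ 2 (boxMeasure I n)) x ∂boxMeasure I n := by
    rw [Submodule.coe_inner, L2.inner_def]
    simp only [RCLike.inner_apply, mul_comm]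
  have hi : Integrable (fun x => conj ((Φ n : Lp ℂ 2 (boxMeasure I n)) x) *
      (Ψ n : Lp ℂ 2 (boxMeasure I n)) x) (boxMeasure I n) := by
    have := L2.integrable_inner (𝕜 := ℂ) (Φ n : Lp ℂ 2 (boxMeasure I n)) (Ψ n)
    simpa only [RCLike.inner_apply, mul_comm] using this
  rw [h1, integral_box_of_symm hi fun σ => ?_, ← integral_const_mul]
  · refine integral_congr_ae (.of_forall fun x => ?_)
    simp only [amplitude, map_mul, Complex.conj_ofReal]
    have : (n ! : ℂ) = (Real.sqrt (n ! : ℝ) : ℂ) * (Real.sqrt (n ! : ℝ) : ℂ) := by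
      rw [← Complex.ofReal_mul, Real.mul_self_sqrt (by positivity)]
      simp
    rw [this]
    ring
  · filter_upwards [nparticle_symm (Φ n) σ, nparticle_symm (Ψ n) σ] with x hx hx'
    rw [hx, hx']

theorem hasSum_inner_amplitude (Φ Ψ : Fock I) :
    HasSum (fun n => ∫ x in orderedConfigs I n, conj (amplitude Φ n x) * amplitude Ψ n x)
      (inner ℂ Φ Ψ) := by
  simpa only [inner_apply_eq_integral] using lp.hasSum_inner (𝕜 := ℂ) Φ Ψ

/-- The symmetric function on the box that extends `h` from the ordered configurations. -/
noncomputable def symmExtension {n : ℕ} (h : (Fin n → ℝ) → ℂ) (x : Fin n → ℝ) : ℂ :=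
  (Real.sqrt (n ! : ℝ) : ℂ)⁻¹ *
    ∑ σ : Equiv.Perm (Fin n), {y : Fin n → ℝ | StrictMono y}.indicator h (x ∘ σ)

theorem memLp_symmExtension {n : ℕ} {h : (Fin n → ℝ) → ℂ} (hh : MemLp h 2 (orderedMeasure I n)) :
    MemLp (symmExtension h) 2 (boxMeasure I n) := by
  have h1 : MemLp ({y : Fin n → ℝ | StrictMono y}.indicator h) 2 (boxMeasure I n) := by
    rw [memLp_indicator_iff_restrict (measurableSet_strictMono n), ← orderedMeasure_eq]
    exact hh
  have h2 : MemLp (fun x => ∑ σ : Equiv.Perm (Fin n),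
      {y : Fin n → ℝ | StrictMono y}.indicator h (x ∘ σ)) 2 (boxMeasure I n) :=
    memLp_finsetSum Finset.univ
      (f := fun (σ : Equiv.Perm (Fin n)) x => {y : Fin n → ℝ | StrictMono y}.indicator h (x ∘ σ))
      fun σ _ => h1.comp_measurePreserving (measurePreserving_perm I σ)
  exact h2.const_mul _

theorem symmExtension_perm {n : ℕ} (h : (Fin n → ℝ) → ℂ) (x : Fin n → ℝ)
    (τ : Equiv.Perm (Fin n)) : symmExtension h (x ∘ τ) = symmExtension h x := by
  exact congrArg (fun z => (Real.sqrt (n ! : ℝ) : ℂ)⁻¹ * z) (Equiv.sum_comp (Equiv.mulLeft τ)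
    fun σ : Equiv.Perm (Fin n) => {y : Fin n → ℝ | StrictMono y}.indicator h (x ∘ σ))

theorem symmExtension_of_strictMono {n : ℕ} (h : (Fin n → ℝ) → ℂ) {x : Fin n → ℝ}
    (hx : StrictMono x) : (Real.sqrt (n ! : ℝ) : ℂ) * symmExtension h x = h x := by
  have h0 : (Real.sqrt (n ! : ℝ) : ℂ) ≠ 0 := by
    rw [Complex.ofReal_ne_zero]
    positivity
  -- A strictly ordered point is sorted by the identity permutation only.
  rw [symmExtension, mul_inv_cancel_left₀ h0, Finset.sum_eq_single 1]
  · exact indicator_of_mem (show x ∈ {y : Fin n → ℝ | StrictMono y} from hx) h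
  · intro σ _ hσ
    refine indicator_of_notMem (fun hm => hσ ?_) h
    have hm' : StrictMono (x ∘ σ) := hm
    have := Tuple.unique_monotone (f := x) (σ := σ) (τ := 1) hm'.monotone hx.monotone
    exact Equiv.ext fun i => hx.injective (congrFun this i)
  · simp

/-- The `n`-particle vector whose amplitude on the ordered configurations is `h`. -/
noncomputable def ofOrdered (I : Set ℝ) {n : ℕ} (h : (Fin n → ℝ) → ℂ)
    (hh : MemLp h 2 (orderedMeasure I n)) : NParticle I n :=
  ⟨(memLp_symmExtension hh).toLp, fun σ => by
    have h1 := (memLp_symmExtension hh).coeFn_toLp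
    have h2 := (measurePreserving_perm I σ).quasiMeasurePreserving.ae_eq_comp h1
    filter_upwards [h1, h2] with x hx hx'
    simp only [Function.comp_apply] at hx'
    rw [hx, hx', symmExtension_perm]⟩

theorem amplitude_of_apply_eq_ofOrdered {n : ℕ} {h : (Fin n → ℝ) → ℂ}
    {hh : MemLp h 2 (orderedMeasure I n)} {Φ : Fock I} (hΦ : Φ n = ofOrdered I h hh) :
    amplitude Φ n =ᵐ[orderedMeasure I n] h := by
  filter_upwards [ae_orderedMeasure_of_box (memLp_symmExtension hh).coeFn_toLp, ae_strictMono I n]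
    with x hx hm
  rw [amplitude, hΦ, ← symmExtension_of_strictMono h hm, ← hx]
  rfl

theorem single_mem_finiteParticle (n : ℕ) (f : NParticle I n) :
    lp.single 2 n f ∈ finiteParticle I := by
  refine (finite_singleton n).subset fun m hm => ?_
  by_contra hne
  exact hm (lp.single_apply_ne (E := fun n => NParticle I n) 2 n f hne)

theorem mem_finiteParticle_iff {Φ : Fock I} :
    Φ ∈ finiteParticle I ↔ ∃ M, ∀ n, M < n → Φ n = 0 := by
  constructor
  · intro h
    obtain ⟨M, hM⟩ := (show {n : ℕ | Φ n ≠ 0}.Finite from h).bddAbove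
    refine ⟨M, fun n hn => ?_⟩
    by_contra hne
    exact absurd (hM hne) (not_le.2 hn)
  · rintro ⟨M, hM⟩
    refine (finite_Iic M).subset fun n hn => ?_
    by_contra hne
    exact hn (hM n (not_le.1 hne))

theorem sum_single_eq {Φ : Fock I} {M : ℕ} (h : ∀ n, M < n → Φ n = 0) :
    Φ = ∑ n ∈ Finset.range (M + 1), lp.single 2 n (Φ n) := by
  ext1
  funext n
  rw [lp.coeFn_sum, Finset.sum_apply]
  by_cases hn : n < M + 1
  · rw [Finset.sum_eq_single n (fun m _ hm => lp.single_apply_ne 2 m _ hm.symm)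
      (fun h' => absurd (Finset.mem_range.2 hn) h'), lp.single_apply_self]
  · rw [h n (by omega), Finset.sum_eq_zero fun m hm => ?_]
    exact lp.single_apply_ne 2 m _ (by rintro rfl; exact hn (Finset.mem_range.1 hm))

theorem dense_finiteParticle (I : Set ℝ) : Dense (finiteParticle I : Set (Fock I)) := by
  intro Φ
  refine mem_closure_of_tendsto (lp.hasSum_single (p := 2) (by norm_num) Φ) (.of_forall fun s => ?_)
  exact Submodule.sum_mem _ fun n _ => single_mem_finiteParticle n _

/-! ### Functions whose integrals over all ordered cubes vanish -/

theorem ae_eq_zero_of_setIntegral_closedBall_eq_zero (hI : I.OrdConnected) {n : ℕ}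
    {h : (Fin n → ℝ) → ℂ}
    (H : ∀ (c : Fin n → ℝ) (r : ℝ), 0 < r → Metric.closedBall c r ⊆ orderedConfigs I n →
      IntegrableOn h (Metric.closedBall c r) ∧ ∫ x in Metric.closedBall c r, h x = 0) :
    h =ᵐ[orderedMeasure I n] 0 := by
  have hU : IsOpen {x : Fin n → ℝ | StrictMono x ∧ ∀ i, x i ∈ interior I} := by
    simp only [StrictMono, ofPred_and, ofPred_forall]
    refine .inter ?_ ?_
    · exact isOpen_iInter_of_finite fun i => isOpen_iInter_of_finite fun j =>
        isOpen_iInter_of_finite fun _ => isOpen_lt (continuous_apply i) (continuous_apply j)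
    · exact isOpen_iInter_of_finite fun i => isOpen_interior.preimage (continuous_apply i)
  have key : volume {x : Fin n → ℝ | (StrictMono x ∧ ∀ i, x i ∈ interior I) ∧ h x ≠ 0} = 0 := by
    refine measure_null_of_locally_null _ fun c hc => ?_
    obtain ⟨r, hr, hrU⟩ := Metric.nhds_basis_closedBall.mem_iff.1 (hU.mem_nhds hc.1)
    have hsub : ∀ {x s}, Metric.closedBall x s ⊆ Metric.closedBall c r →
        Metric.closedBall x s ⊆ orderedConfigs I n := fun hs y hy =>
      ⟨(hrU (hs hy)).1, fun i => interior_subset ((hrU (hs hy)).2 i)⟩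
    refine ⟨_, inter_mem_nhdsWithin _ (Metric.ball_mem_nhds c hr), ?_⟩
    let f := (Metric.closedBall c r).indicator h
    have hf : Integrable f :=
      (integrable_indicator_iff Metric.isClosed_closedBall.measurableSet).2
        (H c r hr (hsub subset_rfl)).1
    -- Lebesgue differentiation: for almost every x the averages over cubes shrinking to x converge
    -- to the value at x, and these averages vanish. Closed balls of the sup metric are the cubes.
    have hav := IsUnifLocDoublingMeasure.ae_tendsto_average (volume : Measure (Fin n → ℝ))
      hf.locallyIntegrable 1
    refine measure_mono_null (t := {x | ¬ (x ∈ Metric.ball c r → f x = 0)}) ?_ ?_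
    · rintro x ⟨hx, hxb⟩ hx'
      have := hx' hxb
      simp only [f] at this
      rw [indicator_of_mem (Metric.ball_subset_closedBall hxb)] at this
      exact hx.2 this
    · rw [← ae_iff]
      filter_upwards [hav] with x hx hxb
      have hδ : Filter.Tendsto (fun k : ℕ => 1 / ((k : ℝ) + 1)) Filter.atTop
          (nhdsWithin 0 (Ioi 0)) :=
        tendsto_nhdsWithin_iff.2 ⟨tendsto_one_div_add_atTop_nhds_zero_nat,
          .of_forall fun k => by simp only [mem_Ioi]; positivity⟩
      have h1 := hx (fun _ => x) _ hδ (.of_forall fun k => by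
        simp only [one_mul, Metric.mem_closedBall, dist_self]; positivity)
      refine tendsto_nhds_unique h1 ?_
      refine tendsto_const_nhds.congr' ?_
      obtain ⟨ε, hε, hεb⟩ := Metric.nhds_basis_closedBall.mem_iff.1
        (Metric.isOpen_ball.mem_nhds hxb)
      have h2 := (tendsto_nhdsWithin_iff.1 hδ).1.eventually (gt_mem_nhds hε)
      filter_upwards [h2] with k hk
      have h3 : Metric.closedBall x (1 / ((k : ℝ) + 1)) ⊆ Metric.closedBall c r :=
        ((Metric.closedBall_subset_closedBall hk.le).trans hεb).trans Metric.ball_subset_closedBall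
      rw [setAverage_eq, setIntegral_congr_fun (g := h) Metric.isClosed_closedBall.measurableSet
        (fun y hy => indicator_of_mem (h3 hy) h),
        (H x _ (by positivity) (hsub h3)).2, smul_zero]
  -- The frontier of a convex set is null, so endpoints of I do not matter.
  have hint : ∀ᵐ x ∂orderedMeasure I n, ∀ i, x i ∈ interior I := by
    rw [ae_all_iff]
    intro i
    have h0 : volume (frontier I) = 0 := hI.convex.addHaar_frontier volume
    have h1 : ∀ᵐ z ∂volume.restrict I, z ∈ interior I := by
      rw [ae_restrict_iff' hI.measurableSet]
      filter_upwards [measure_eq_zero_iff_ae_notMem.1 h0] with z hz hzI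
      by_contra hn
      exact hz ⟨subset_closure hzI, hn⟩
    exact ae_orderedMeasure_of_box
      ((Measure.quasiMeasurePreserving_eval (fun _ : Fin n => volume.restrict I) i).ae h1)
  filter_upwards [ae_strictMono I n, hint, ae_restrict_of_ae (measure_eq_zero_iff_ae_notMem.1 key)]
    with x h1 h2 h3
  by_contra hne
  exact h3 ⟨⟨h1, h2⟩, hne⟩

end FockSpace

/-! ### Adjoint tensors, product tensors and matrix elements -/

section MatrixElements

variable {I : Set ℝ} {ι κ : Type}

/-! ### Regularity of adjoints and products -/

theorem MeasureTheory.MemLp.conj {α : Type*} [MeasurableSpace α] {μ : Measure α} {p : ℝ≥0∞}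
    {f : α → ℂ} (hf : MemLp f p μ) : MemLp (fun x => conj (f x)) p μ :=
  hf.of_le (Complex.continuous_conj.comp_aestronglyMeasurable hf.aestronglyMeasurable)
    (.of_forall fun x => by simp)

namespace CMPOTensors

theorem Regular.adj {t : CMPOTensors ι} (ht : t.Regular I) : t.adj.Regular I where
  Q_mem a b := by
    have := memLp_one_iff_integrable.2 (ht.Q_mem a b)
    exact memLp_one_iff_integrable.1 this.conj
  L_mem a b := (ht.R_mem a b).conj
  R_mem a b := (ht.L_mem a b).conj
  T_mem a b := (ht.T_mem a b).conj

/-- The regularity classes are closed under the product rule: R₁ ⊗ L₂ is integrable by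
Cauchy–Schwarz, and multiplication by the bounded T preserves L² and L^∞. -/
theorem Regular.mul [DecidableEq ι] [DecidableEq κ] {s : CMPOTensors ι} {t : CMPOTensors κ}
    (hs : s.Regular I) (ht : t.Regular I) : (s.mul t).Regular I where
  Q_mem a b := by
    have h : Integrable (fun x => s.R x a.1 b.1 * t.L x a.2 b.2) (volume.restrict I) :=
      (hs.R_mem a.1 b.1).integrable_mul (ht.L_mem a.2 b.2)
    exact (((hs.Q_mem a.1 b.1).mul_const _).add ((ht.Q_mem a.2 b.2).const_mul _)).add h
  L_mem a b := by
    have h : MemLp (fun x => s.T x a.1 b.1 * t.L x a.2 b.2) 2 (volume.restrict I) :=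
      (ht.L_mem a.2 b.2).mul (hs.T_mem a.1 b.1)
    exact ((hs.L_mem a.1 b.1).mul_const _).add h
  R_mem a b := by
    have h : MemLp (fun x => s.R x a.1 b.1 * t.T x a.2 b.2) 2 (volume.restrict I) :=
      (ht.T_mem a.2 b.2).mul (hs.R_mem a.1 b.1)
    exact ((ht.R_mem a.2 b.2).const_mul _).add h
  T_mem a b := (ht.T_mem a.2 b.2).mul (hs.T_mem a.1 b.1)

end CMPOTensors

variable [Fintype ι] [DecidableEq ι]

theorem dysonTerm_conj (Q : ℝ → Matrix ι ι ℂ) (k : ℕ) (S : Set ℝ) :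
    dysonTerm (fun x => (Q x).map conj) k S = (dysonTerm Q k S).map conj := by
  induction k generalizing S with
  | zero => exact (Matrix.map_one _ (map_zero _) (map_one _)).symm
  | succ k ih =>
    ext a b
    simp only [dysonTerm, Matrix.of_apply, Matrix.map_apply, ih]
    rw [← integral_conj]
    refine integral_congr_ae (.of_forall fun z => ?_)
    dsimp only
    rw [← Matrix.map_mul, Matrix.map_apply]

theorem pathExp_conj (Q : ℝ → Matrix ι ι ℂ) (S : Set ℝ) :
    pathExp (fun x => (Q x).map conj) S = (pathExp Q S).map conj := by
  ext a b
  simp only [pathExp, Matrix.of_apply, Matrix.map_apply, dysonTerm_conj, Complex.conj_tsum]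

/-- The label of the adjoint ladder map. -/
def Ladder.adj : Ladder → Ladder
  | Ladder.l => Ladder.r
  | Ladder.r => Ladder.l
  | Ladder.a => Ladder.a

theorem Ladder.adj_adj (α : Ladder) : α.adj.adj = α := by cases α <;> rfl

namespace CMPOTensors

theorem adj_K (t : CMPOTensors ι) (α : Ladder) (x : ℝ) : t.adj.K α.adj x = (t.K α x).map conj := by
  cases α <;> rfl

theorem adj_adj (t : CMPOTensors ι) : t.adj.adj = t := by
  cases t
  simp only [adj, mk.injEq]
  refine ⟨?_, ?_, ?_, ?_, ?_⟩
  · ext; simp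
  all_goals (funext x; ext a b; simp)

theorem adj_word (t : CMPOTensors ι) (S : Set ℝ) (l : List (Ladder × ℝ)) :
    t.adj.word S (l.map fun p => (p.1.adj, p.2)) = (t.word S l).map conj := by
  induction l generalizing S with
  | nil => exact pathExp_conj _ _
  | cons p l ih =>
    rw [List.map_cons, word, word, ih, adj_K, Matrix.map_mul, Matrix.map_mul]
    exact congrArg (fun M => M * _ * _) (pathExp_conj _ _)

theorem adj_coeff (t : CMPOTensors ι) {j : ℕ} (α : Fin j → Ladder) (x : Fin j → ℝ) :
    t.adj.coeff I (fun i => (α i).adj) x = conj (t.coeff I α x) := by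
  have h := t.adj_word I (List.ofFn fun i => (α i, x i))
  rw [List.map_ofFn] at h
  rw [coeff, coeff]
  refine (congrArg (fun M => Matrix.trace (t.adj.B * M)) h).trans ?_
  rw [show t.adj.B = t.B.map conj from rfl, ← Matrix.map_mul, Matrix.trace, Matrix.trace,
    map_sum]
  rfl

end CMPOTensors

theorem ketPos_adj {j : ℕ} (α : Fin j → Ladder) : ketPos (fun i => (α i).adj) = braPos α := by
  ext i
  simp only [ketPos, braPos, Finset.mem_filter, Finset.mem_univ, true_and]
  cases α i <;> simp [Ladder.adj]

theorem braPos_adj {j : ℕ} (α : Fin j → Ladder) : braPos (fun i => (α i).adj) = ketPos α := by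
  ext i
  simp only [ketPos, braPos, Finset.mem_filter, Finset.mem_univ, true_and]
  cases α i <;> simp [Ladder.adj]

/-- The amplitude at the subconfiguration at the positions in `s`. -/
noncomputable def subAmplitude (Φ : Fock I) {j : ℕ} (s : Finset (Fin j)) (x : Fin j → ℝ) : ℂ :=
  amplitude Φ s.card (subConfig s x)

namespace CMPOTensors

/-- The integrand of the matrix element. -/
noncomputable def integrand (t : CMPOTensors ι) (Φ Ψ : Fock I) {j : ℕ} (α : Fin j → Ladder)
    (x : Fin j → ℝ) : ℂ :=
  t.coeff I α x * conj (subAmplitude Φ (ketPos α) x) * subAmplitude Ψ (braPos α) x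

theorem matrixElement_eq (t : CMPOTensors ι) (Φ Ψ : Fock I) :
    t.matrixElement I Φ Ψ
      = ∑' j : ℕ, ∑ α : Fin j → Ladder, ∫ x in orderedConfigs I j, t.integrand Φ Ψ α x := rfl

/-- Exchanging the labels `l` and `r` is a bijection of words that swaps ket and bra positions and
conjugates the coefficients. -/
theorem matrixElement_adj (t : CMPOTensors ι) (Φ Ψ : Fock I) :
    t.adj.matrixElement I Ψ Φ = conj (t.matrixElement I Φ Ψ) := by
  rw [matrixElement_eq, matrixElement_eq, Complex.conj_tsum]
  refine tsum_congr fun j => ?_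
  rw [map_sum]
  refine (Fintype.sum_equiv
    (Equiv.piCongrRight fun _ : Fin j =>
      ⟨Ladder.adj, Ladder.adj, Ladder.adj_adj, Ladder.adj_adj⟩) _ _ fun α => ?_).symm
  rw [← integral_conj]
  refine integral_congr_ae (.of_forall fun x => ?_)
  change _ = t.adj.integrand Ψ Φ (fun i => (α i).adj) x
  simp only [integrand]
  rw [adj_coeff, ketPos_adj, braPos_adj]
  simp only [map_mul, Complex.conj_conj]
  ring

end CMPOTensors

end MatrixElements

/-! ### The Cauchy–Schwarz bound for one word -/

section Bounds

open scoped Matrix.Norms.Operator MatrixTopology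

variable {I : Set ℝ} {ι : Type} [Fintype ι] [DecidableEq ι]

theorem measurable_subAmplitude (Φ : Fock I) {j : ℕ} (s : Finset (Fin j)) :
    Measurable (subAmplitude Φ s) :=
  (measurable_amplitude Φ s.card).comp (measurable_subConfig s)

theorem subAmplitude_add (Φ Ψ : Fock I) {j : ℕ} (s : Finset (Fin j)) :
    subAmplitude (Φ + Ψ) s =ᵐ[orderedMeasure I j]
      fun x => subAmplitude Φ s x + subAmplitude Ψ s x :=
  (quasiMeasurePreserving_subConfig_ordered s).ae (amplitude_add Φ Ψ s.card)

theorem subAmplitude_smul (c : ℂ) (Φ : Fock I) {j : ℕ} (s : Finset (Fin j)) :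
    subAmplitude (c • Φ) s =ᵐ[orderedMeasure I j] fun x => c * subAmplitude Φ s x :=
  (quasiMeasurePreserving_subConfig_ordered s).ae (amplitude_smul c Φ s.card)

theorem subAmplitude_zero {Φ : Fock I} {j : ℕ} {s : Finset (Fin j)} (h : Φ s.card = 0) :
    subAmplitude Φ s =ᵐ[orderedMeasure I j] 0 :=
  (quasiMeasurePreserving_subConfig_ordered s).ae (amplitude_zero h)

namespace CMPOTensors

theorem aestronglyMeasurable_dressed {t : CMPOTensors ι} (ht : t.Regular I) (α : Ladder) :
    AEStronglyMeasurable (t.dressed I α) (volume.restrict I) := by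
  cases α
  · exact (memLp_dressed ht.integrable_Q (α := Ladder.l) ht.memLp_L).aestronglyMeasurable
  · exact (memLp_dressed ht.integrable_Q (α := Ladder.r) ht.memLp_R).aestronglyMeasurable
  · exact (memLp_dressed ht.integrable_Q (α := Ladder.a) ht.memLp_T).aestronglyMeasurable

theorem aestronglyMeasurable_coeff {t : CMPOTensors ι} (ht : t.Regular I) {j : ℕ}
    (α : Fin j → Ladder) : AEStronglyMeasurable (t.coeff I α) (orderedMeasure I j) := by
  have h1 := (aestronglyMeasurable_list_prod (μ := volume.restrict I)
    (C := fun i => t.dressed I (α i)) fun i => aestronglyMeasurable_dressed ht (α i)).mono_measure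
      (orderedMeasure_le I j)
  refine ((traceCLM t.B (orderedExp t.Q (volume.restrict I))).continuous.comp_aestronglyMeasurable
    h1).congr ?_
  filter_upwards [ae_strictMono I j] with x hx
  rw [coeff_eq ht.integrable_Q α hx.monotone]
  rfl

theorem aestronglyMeasurable_integrand {t : CMPOTensors ι} (ht : t.Regular I) (Φ Ψ : Fock I)
    {j : ℕ} (α : Fin j → Ladder) :
    AEStronglyMeasurable (t.integrand Φ Ψ α) (orderedMeasure I j) :=
  ((aestronglyMeasurable_coeff ht α).mul (Complex.continuous_conj.comp_aestronglyMeasurable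
    (measurable_subAmplitude Φ _).aestronglyMeasurable)).mul
    (measurable_subAmplitude Ψ _).aestronglyMeasurable

end CMPOTensors

/-- The complement of the ket positions carries exactly the labels `r`, that of the bra positions
exactly the labels `l`. Only positions labelled `a` need a factor τ; τ ≥ 1 allows one at every
position. -/
theorem prod_le_of_labels {j : ℕ} (α : Fin j → Ladder) {k : Ladder → Fin j → ℝ≥0∞} {τ : ℝ≥0∞}
    (hτ : 1 ≤ τ) (hk : ∀ i, k Ladder.a i ≤ τ) :
    ∏ i, k (α i) i ≤ τ ^ j * ((∏ i ∈ (ketPos α)ᶜ, k Ladder.r i) *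
      ∏ i ∈ (braPos α)ᶜ, k Ladder.l i) := by
  have h1 : (∏ i ∈ (ketPos α)ᶜ, k Ladder.r i)
      = ∏ i, if α i = Ladder.r then k Ladder.r i else 1 := by
    rw [Finset.prod_ite, Finset.prod_const_one, mul_one]
    refine Finset.prod_congr (Finset.ext fun i => ?_) fun _ _ => rfl
    simp only [ketPos, Finset.mem_compl, Finset.mem_filter, Finset.mem_univ, true_and]
    cases α i <;> simp
  have h2 : (∏ i ∈ (braPos α)ᶜ, k Ladder.l i)
      = ∏ i, if α i = Ladder.l then k Ladder.l i else 1 := by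
    rw [Finset.prod_ite, Finset.prod_const_one, mul_one]
    refine Finset.prod_congr (Finset.ext fun i => ?_) fun _ _ => rfl
    simp only [braPos, Finset.mem_compl, Finset.mem_filter, Finset.mem_univ, true_and]
    cases α i <;> simp
  have h3 : τ ^ j = ∏ _i : Fin j, τ := by simp
  rw [h1, h2, h3, ← Finset.prod_mul_distrib, ← Finset.prod_mul_distrib]
  refine Finset.prod_le_prod' fun i _ => ?_
  cases α i
  · simpa using le_mul_of_one_le_left zero_le hτ
  · simpa using le_mul_of_one_le_left zero_le hτ
  · simpa using hk i

theorem lintegral_mul_le_sqrt_mul_sqrt {α : Type*} [MeasurableSpace α] {μ : Measure α}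
    {f g : α → ℝ≥0∞} (hf : AEMeasurable f μ) (hg : AEMeasurable g μ) :
    ∫⁻ x, f x * g x ∂μ ≤ (∫⁻ x, f x ^ 2 ∂μ) ^ (1 / 2 : ℝ) * (∫⁻ x, g x ^ 2 ∂μ) ^ (1 / 2 : ℝ) := by
  have := ENNReal.lintegral_mul_le_Lp_mul_Lq μ Real.HolderConjugate.two_two hf hg
  simpa using this

theorem lintegral_subAmplitude_mul_le (Φ : Fock I) {j : ℕ} (s : Finset (Fin j)) {h : ℝ → ℝ≥0∞}
    (hh : AEMeasurable h (volume.restrict I)) :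
    (∫⁻ x, (‖subAmplitude Φ s x‖ₑ * ∏ i ∈ sᶜ, h (x i)) ^ 2 ∂orderedMeasure I j) ^ (1 / 2 : ℝ)
      ≤ ‖Φ‖ₑ * ((∫⁻ z in I, h z ^ 2) ^ sᶜ.card / sᶜ.card !) ^ (1 / 2 : ℝ) := by
  have h1 := lintegral_ordered_subConfig_le (I := I) s
    (A := fun y => ‖amplitude Φ s.card y‖ₑ ^ 2)
    ((measurable_amplitude Φ s.card).enorm.pow_const 2) (hh.pow_const 2)
  rw [lintegral_amplitude] at h1
  simp only [mul_pow, ← Finset.prod_pow]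
  refine (ENNReal.rpow_le_rpow h1 (by norm_num)).trans ?_
  rw [ENNReal.mul_rpow_of_nonneg _ _ (by norm_num : (0 : ℝ) ≤ 1 / 2)]
  gcongr
  rw [← ENNReal.rpow_natCast, ← ENNReal.rpow_mul]
  norm_num
  have := lp.norm_apply_le_norm (two_ne_zero) Φ s.card
  rw [← ofReal_norm, ← ofReal_norm]
  exact ENNReal.ofReal_le_ofReal this

namespace CMPOTensors

/-- The amplitude of Φ is paired with the `r` matrices and that of Ψ with the `l` matrices. Each
pair then involves every coordinate exactly once, so Cauchy–Schwarz leaves two integrals of the kind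
in `lintegral_ordered_subConfig_le`. Here P and Λ are the squared L² norms of the dressed R and L.
-/
theorem exists_lintegral_integrand_le {t : CMPOTensors ι} (ht : t.Regular I) :
    ∃ C τ P Λ : ℝ≥0∞, C ≠ ∞ ∧ τ ≠ ∞ ∧ P ≠ ∞ ∧ Λ ≠ ∞ ∧ ∀ (Φ Ψ : Fock I) (j : ℕ)
      (α : Fin j → Ladder), ∫⁻ x, ‖t.integrand Φ Ψ α x‖ₑ ∂orderedMeasure I j
        ≤ C * τ ^ j * ((‖Φ‖ₑ * (P ^ (ketPos α)ᶜ.card / (ketPos α)ᶜ.card !) ^ (1 / 2 : ℝ)) *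
          (‖Ψ‖ₑ * (Λ ^ (braPos α)ᶜ.card / (braPos α)ᶜ.card !) ^ (1 / 2 : ℝ))) := by
  obtain ⟨C, hC0, hC⟩ := exists_norm_coeff_le ht.integrable_Q
  have hl : MemLp (t.dressed I Ladder.l) 2 (volume.restrict I) :=
    memLp_dressed ht.integrable_Q ht.memLp_L
  have hr : MemLp (t.dressed I Ladder.r) 2 (volume.restrict I) :=
    memLp_dressed ht.integrable_Q ht.memLp_R
  have ha : MemLp (t.dressed I Ladder.a) ∞ (volume.restrict I) :=
    memLp_dressed ht.integrable_Q ht.memLp_T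
  have hsq : ∀ {f : ℝ → Matrix ι ι ℂ}, MemLp f 2 (volume.restrict I) →
      ∫⁻ z in I, ‖f z‖ₑ ^ 2 ≠ ∞ := fun {f} hf => by
    have := eLpNorm_nnreal_pow_eq_lintegral (f := f) (μ := volume.restrict I) (p := 2) (by norm_num)
    simp only [NNReal.coe_ofNat, ENNReal.rpow_ofNat, ENNReal.coe_ofNat] at this
    rw [← this]
    exact (ENNReal.pow_lt_top hf.2).ne
  set τ : ℝ≥0∞ := max 1 (eLpNorm (t.dressed I Ladder.a) ∞ (volume.restrict I))
  have hτ : ∀ᵐ z ∂volume.restrict I, ‖t.dressed I Ladder.a z‖ₑ ≤ τ := by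
    filter_upwards [ae_le_eLpNormEssSup (f := t.dressed I Ladder.a) (μ := volume.restrict I)]
      with z hz
    exact hz.trans (by rw [← eLpNorm_exponent_top]; exact le_max_right _ _)
  refine ⟨ENNReal.ofReal C, τ, ∫⁻ z in I, ‖t.dressed I Ladder.r z‖ₑ ^ 2,
    ∫⁻ z in I, ‖t.dressed I Ladder.l z‖ₑ ^ 2, ENNReal.ofReal_ne_top,
    max_ne_top ENNReal.one_ne_top ha.2.ne, hsq hr, hsq hl, fun Φ Ψ j α => ?_⟩
  have hτ' : ∀ᵐ x ∂orderedMeasure I j, ∀ i, ‖t.dressed I Ladder.a (x i)‖ₑ ≤ τ := by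
    rw [ae_all_iff]
    exact fun i => ae_orderedMeasure_of_box
      ((Measure.quasiMeasurePreserving_eval (fun _ : Fin j => volume.restrict I) i).ae hτ)
  have hprod : ∀ (s : Finset (Fin j)) {β : Ladder}, AEStronglyMeasurable (t.dressed I β)
      (volume.restrict I) → AEMeasurable (fun x : Fin j → ℝ => ∏ i ∈ s, ‖t.dressed I β (x i)‖ₑ)
      (orderedMeasure I j) := fun s β hβ =>
    aemeasurable_of_ordered <| Finset.aemeasurable_fun_prod _ fun i _ =>
      hβ.enorm.comp_quasiMeasurePreserving
        (Measure.quasiMeasurePreserving_eval (fun _ : Fin j => volume.restrict I) i)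
  have m1 : AEMeasurable (fun x => ‖subAmplitude Φ (ketPos α) x‖ₑ *
      ∏ i ∈ (ketPos α)ᶜ, ‖t.dressed I Ladder.r (x i)‖ₑ) (orderedMeasure I j) :=
    (measurable_subAmplitude Φ _).enorm.aemeasurable.mul (hprod _ hr.aestronglyMeasurable)
  have m2 : AEMeasurable (fun x => ‖subAmplitude Ψ (braPos α) x‖ₑ *
      ∏ i ∈ (braPos α)ᶜ, ‖t.dressed I Ladder.l (x i)‖ₑ) (orderedMeasure I j) :=
    (measurable_subAmplitude Ψ _).enorm.aemeasurable.mul (hprod _ hl.aestronglyMeasurable)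
  calc ∫⁻ x, ‖t.integrand Φ Ψ α x‖ₑ ∂orderedMeasure I j
      ≤ ∫⁻ x, ENNReal.ofReal C * τ ^ j * ((‖subAmplitude Φ (ketPos α) x‖ₑ *
          ∏ i ∈ (ketPos α)ᶜ, ‖t.dressed I Ladder.r (x i)‖ₑ) *
          (‖subAmplitude Ψ (braPos α) x‖ₑ *
          ∏ i ∈ (braPos α)ᶜ, ‖t.dressed I Ladder.l (x i)‖ₑ)) ∂orderedMeasure I j := by
        refine lintegral_mono_ae ?_
        filter_upwards [ae_strictMono I j, hτ'] with x hx hxτ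
        have h1 : ‖t.coeff I α x‖ₑ ≤ ENNReal.ofReal C * ∏ i, ‖t.dressed I (α i) (x i)‖ₑ := by
          have := ENNReal.ofReal_le_ofReal (hC j α x hx.monotone)
          rw [ofReal_norm, ENNReal.ofReal_mul hC0,
            ENNReal.ofReal_prod_of_nonneg fun i _ => norm_nonneg _] at this
          simpa only [ofReal_norm] using this
        have h2 := prod_le_of_labels α (k := fun β i => ‖t.dressed I β (x i)‖ₑ)
          (le_max_left _ _) hxτ
        have h3 : ‖conj (subAmplitude Φ (ketPos α) x)‖ₑ = ‖subAmplitude Φ (ketPos α) x‖ₑ := by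
          rw [← ofReal_norm, RCLike.norm_conj, ofReal_norm]
        rw [integrand, enorm_mul, enorm_mul, h3]
        calc _ ≤ ENNReal.ofReal C * (τ ^ j * ((∏ i ∈ (ketPos α)ᶜ, ‖t.dressed I Ladder.r (x i)‖ₑ) *
              ∏ i ∈ (braPos α)ᶜ, ‖t.dressed I Ladder.l (x i)‖ₑ)) *
              ‖subAmplitude Φ (ketPos α) x‖ₑ * ‖subAmplitude Ψ (braPos α) x‖ₑ := by
              gcongr
              exact h1.trans (by gcongr)
          _ = _ := by ring
    _ = ENNReal.ofReal C * τ ^ j * ∫⁻ x, ((‖subAmplitude Φ (ketPos α) x‖ₑ *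
          ∏ i ∈ (ketPos α)ᶜ, ‖t.dressed I Ladder.r (x i)‖ₑ) *
          (‖subAmplitude Ψ (braPos α) x‖ₑ *
          ∏ i ∈ (braPos α)ᶜ, ‖t.dressed I Ladder.l (x i)‖ₑ)) ∂orderedMeasure I j :=
        lintegral_const_mul'' _ (m1.mul m2)
    _ ≤ _ := by
        gcongr
        refine (lintegral_mul_le_sqrt_mul_sqrt m1 m2).trans ?_
        exact mul_le_mul' (lintegral_subAmplitude_mul_le Φ _ hr.aestronglyMeasurable.enorm)
          (lintegral_subAmplitude_mul_le Ψ _ hl.aestronglyMeasurable.enorm)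

end CMPOTensors

end Bounds

/-! ### Convergence of the series and existence of the operator -/

section OperatorExistence

variable {I : Set ℝ} {ι : Type} [Fintype ι] [DecidableEq ι]

/-- After the shift by M, which disposes of the truncated subtraction, bᵏ/√(k!) is the product of
2⁻ᵏ and (2b)ᵏ/√(k!), hence at most the sum of their squares 4⁻ᵏ and (4b²)ᵏ/k!. -/
theorem summable_pow_mul_sqrt_factorial_inv (b : ℝ) (hb : 0 ≤ b) (M : ℕ) :
    Summable fun j : ℕ => b ^ j * (((j - M) ! : ℝ)⁻¹) ^ (1 / 2 : ℝ) := by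
  rw [← summable_nat_add_iff M]
  have h1 : Summable fun k : ℕ => b ^ M * ((1 / 4 : ℝ) ^ k + (4 * b ^ 2) ^ k / k !) :=
    ((summable_geometric_of_lt_one (by norm_num) (by norm_num)).add
      (Real.summable_pow_div_factorial _)).mul_left _
  refine .of_nonneg_of_le (fun k => by positivity) (fun k => ?_) h1
  rw [Nat.add_sub_cancel, pow_add, mul_comm (b ^ k), mul_assoc]
  refine mul_le_mul_of_nonneg_left ?_ (by positivity)
  set y := ((k ! : ℝ)⁻¹) ^ (1 / 2 : ℝ) with hy
  have hy2 : y * y = (k ! : ℝ)⁻¹ := by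
    rw [hy, ← Real.rpow_add (by positivity)]
    norm_num
  have e1 : b ^ k * y = (1 / 2 : ℝ) ^ k * ((2 * b) ^ k * y) := by
    rw [← mul_assoc, ← mul_pow]
    congr 2
    ring
  have e2 : (1 / 4 : ℝ) ^ k = (1 / 2 : ℝ) ^ k * (1 / 2 : ℝ) ^ k := by
    rw [← mul_pow]; norm_num
  have e3 : (4 * b ^ 2) ^ k / (k ! : ℝ) = ((2 * b) ^ k * y) * ((2 * b) ^ k * y) := by
    have : ((2 * b) ^ k * y) * ((2 * b) ^ k * y) = ((2 * b) * (2 * b)) ^ k * (y * y) := by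
      rw [mul_mul_mul_comm, ← mul_pow]
    rw [this, hy2, div_eq_mul_inv]
    congr 2
    ring
  rw [e1, e2, e3]
  nlinarith [sq_nonneg ((1 / 2 : ℝ) ^ k - (2 * b) ^ k * y), sq_nonneg ((1 / 2 : ℝ) ^ k),
    sq_nonneg ((2 * b) ^ k * y)]

theorem rpow_half_le {P : ℝ≥0∞} {c j : ℕ} (hc : c ≤ j) :
    (P ^ c) ^ (1 / 2 : ℝ) ≤ max 1 P ^ j := by
  have h1 : (1 : ℝ≥0∞) ≤ max 1 P := le_max_left _ _
  have h2 : (1 : ℝ≥0∞) ≤ max 1 P ^ j := one_le_pow₀ h1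
  calc (P ^ c) ^ (1 / 2 : ℝ) ≤ (max 1 P ^ j) ^ (1 / 2 : ℝ) := by
        refine ENNReal.rpow_le_rpow ?_ (by norm_num)
        exact (pow_le_pow_left' (le_max_right _ _) c).trans (pow_le_pow_right₀ h1 hc)
    _ ≤ (max 1 P ^ j) ^ (1 : ℝ) := ENNReal.rpow_le_rpow_of_exponent_le h2 (by norm_num)
    _ = _ := ENNReal.rpow_one _

namespace CMPOTensors

/-- Only the factorial of the number of labels `l` is kept: the particle number is to be bounded in
Ψ alone. -/
theorem exists_norm_integral_integrand_le {t : CMPOTensors ι} (ht : t.Regular I) :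
    ∃ C a : ℝ, 0 ≤ C ∧ 0 ≤ a ∧ ∀ (Φ Ψ : Fock I) (j : ℕ) (α : Fin j → Ladder),
      Integrable (t.integrand Φ Ψ α) (orderedMeasure I j) ∧
      ‖∫ x in orderedConfigs I j, t.integrand Φ Ψ α x‖
        ≤ C * a ^ j * (((braPos α)ᶜ.card ! : ℝ)⁻¹) ^ (1 / 2 : ℝ) * (‖Φ‖ * ‖Ψ‖) := by
  obtain ⟨C, τ, P, Λ, hC, hτ, hP, hΛ, h⟩ := exists_lintegral_integrand_le ht
  refine ⟨C.toReal, (τ * max 1 P * max 1 Λ).toReal, ENNReal.toReal_nonneg,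
    ENNReal.toReal_nonneg, fun Φ Ψ j α => ?_⟩
  set E : ℝ≥0∞ := C * (τ * max 1 P * max 1 Λ) ^ j *
    (((braPos α)ᶜ.card ! : ℝ≥0∞)⁻¹) ^ (1 / 2 : ℝ) * (‖Φ‖ₑ * ‖Ψ‖ₑ) with hE
  have hE_top : E ≠ ∞ := by
    refine ENNReal.mul_ne_top (ENNReal.mul_ne_top (ENNReal.mul_ne_top hC (ENNReal.pow_ne_top
      (ENNReal.mul_ne_top (ENNReal.mul_ne_top hτ ?_) ?_))) ?_) (ENNReal.mul_ne_top
        enorm_ne_top enorm_ne_top)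
    · exact max_ne_top ENNReal.one_ne_top hP
    · exact max_ne_top ENNReal.one_ne_top hΛ
    · refine ENNReal.rpow_ne_top_of_nonneg (by norm_num) (ENNReal.inv_ne_top.2 ?_)
      exact_mod_cast Nat.factorial_ne_zero _
  have hcard : ∀ s : Finset (Fin j), s.card ≤ j := fun s => (Finset.card_le_univ s).trans (by simp)
  have hle : ∫⁻ x, ‖t.integrand Φ Ψ α x‖ₑ ∂orderedMeasure I j ≤ E := by
    refine (h Φ Ψ j α).trans ?_
    have h1 : (P ^ (ketPos α)ᶜ.card / (ketPos α)ᶜ.card !) ^ (1 / 2 : ℝ) ≤ max 1 P ^ j := by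
      refine le_trans (ENNReal.rpow_le_rpow ?_ (by norm_num)) (rpow_half_le (hcard (ketPos α)ᶜ))
      refine ENNReal.div_le_of_le_mul (le_mul_of_one_le_right zero_le ?_)
      exact_mod_cast Nat.one_le_iff_ne_zero.2 (Nat.factorial_ne_zero _)
    have h2 : (Λ ^ (braPos α)ᶜ.card / (braPos α)ᶜ.card !) ^ (1 / 2 : ℝ)
        ≤ max 1 Λ ^ j * (((braPos α)ᶜ.card ! : ℝ≥0∞)⁻¹) ^ (1 / 2 : ℝ) := by
      rw [div_eq_mul_inv, ENNReal.mul_rpow_of_nonneg _ _ (by norm_num : (0 : ℝ) ≤ 1 / 2)]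
      gcongr
      exact rpow_half_le (hcard _)
    calc _ ≤ C * τ ^ j * ((‖Φ‖ₑ * max 1 P ^ j) *
          (‖Ψ‖ₑ * (max 1 Λ ^ j * (((braPos α)ᶜ.card ! : ℝ≥0∞)⁻¹) ^ (1 / 2 : ℝ)))) := by
          gcongr
      _ = E := by rw [hE, mul_pow, mul_pow]; ring
  refine ⟨⟨aestronglyMeasurable_integrand ht Φ Ψ α, hle.trans_lt hE_top.lt_top⟩, ?_⟩
  have h1 : ‖∫ x in orderedConfigs I j, t.integrand Φ Ψ α x‖ₑ ≤ E :=
    (enorm_integral_le_lintegral_enorm _).trans hle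
  have h2 := ENNReal.toReal_mono hE_top h1
  simpa [hE, ENNReal.toReal_mul, ENNReal.toReal_pow, ← ENNReal.toReal_rpow, toReal_enorm] using h2

theorem integrable_integrand {t : CMPOTensors ι} (ht : t.Regular I) (Φ Ψ : Fock I) {j : ℕ}
    (α : Fin j → Ladder) : Integrable (t.integrand Φ Ψ α) (orderedMeasure I j) := by
  obtain ⟨C, a, -, -, h⟩ := exists_norm_integral_integrand_le ht
  exact (h Φ Ψ j α).1

theorem integrand_ae_zero_right (t : CMPOTensors ι) (Φ : Fock I) {Ψ : Fock I} {j : ℕ}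
    {α : Fin j → Ladder} (h : Ψ (braPos α).card = 0) :
    t.integrand Φ Ψ α =ᵐ[orderedMeasure I j] 0 := by
  filter_upwards [subAmplitude_zero h] with x hx
  rw [integrand, hx]
  simp

theorem card_labels (j : ℕ) : Fintype.card (Fin j → Ladder) = 3 ^ j := by
  rw [Fintype.card_fun, Fintype.card_fin]
  rfl

/-- Words with more than M bra positions see a zero amplitude of Ψ; all others have at least j − M
labels `l`. The 3ʲ words of length j only change the base of the power. No condition on Φ is needed,
which makes Riesz applicable. -/
theorem exists_summable_bound {t : CMPOTensors ι} (ht : t.Regular I) (M : ℕ) :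
    ∃ u : ℕ → ℝ, Summable u ∧ ∀ Φ Ψ : Fock I, (∀ n, M < n → Ψ n = 0) → ∀ j,
      ‖∑ α : Fin j → Ladder, ∫ x in orderedConfigs I j, t.integrand Φ Ψ α x‖
        ≤ u j * (‖Φ‖ * ‖Ψ‖) := by
  obtain ⟨C, a, hC, ha, h⟩ := exists_norm_integral_integrand_le ht
  refine ⟨fun j => C * ((3 * a) ^ j * (((j - M) ! : ℝ)⁻¹) ^ (1 / 2 : ℝ)),
    (summable_pow_mul_sqrt_factorial_inv _ (by positivity) M).mul_left C, fun Φ Ψ hΨ j => ?_⟩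
  have hb : ∀ α : Fin j → Ladder, ‖∫ x in orderedConfigs I j, t.integrand Φ Ψ α x‖
      ≤ C * a ^ j * (((j - M) ! : ℝ)⁻¹) ^ (1 / 2 : ℝ) * (‖Φ‖ * ‖Ψ‖) := fun α => by
    by_cases hα : M < (braPos α).card
    · rw [integral_congr_ae (t.integrand_ae_zero_right Φ (hΨ _ hα))]
      simp only [Pi.zero_apply, integral_zero, norm_zero]
      positivity
    · refine (h Φ Ψ j α).2.trans ?_
      have : j - M ≤ (braPos α)ᶜ.card := by
        rw [Finset.card_compl, Fintype.card_fin]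
        omega
      have := Nat.factorial_le this
      gcongr
  refine (norm_sum_le _ _).trans ((Finset.sum_le_card_nsmul _ _ _ fun α _ => hb α).trans ?_)
  dsimp only
  rw [Finset.card_univ, card_labels, nsmul_eq_mul, mul_pow]
  push_cast
  exact le_of_eq (by ring)

theorem summable_matrixElement {t : CMPOTensors ι} (ht : t.Regular I) (Φ : Fock I) {Ψ : Fock I}
    (hΨ : Ψ ∈ finiteParticle I) :
    Summable fun j => ∑ α : Fin j → Ladder, ∫ x in orderedConfigs I j, t.integrand Φ Ψ α x := by
  obtain ⟨M, hM⟩ := mem_finiteParticle_iff.1 hΨ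
  obtain ⟨u, hu, h⟩ := exists_summable_bound ht M
  exact .of_norm_bounded (hu.mul_right _) (h Φ Ψ hM)

theorem exists_norm_matrixElement_le {t : CMPOTensors ι} (ht : t.Regular I) (M : ℕ) :
    ∃ K, ∀ Φ Ψ : Fock I, (∀ n, M < n → Ψ n = 0) →
      ‖t.matrixElement I Φ Ψ‖ ≤ K * (‖Φ‖ * ‖Ψ‖) := by
  obtain ⟨u, hu, h⟩ := exists_summable_bound ht M
  refine ⟨∑' j, u j, fun Φ Ψ hM => ?_⟩
  rw [← tsum_mul_right]
  exact tsum_of_norm_bounded (hu.mul_right _).hasSum (h Φ Ψ hM)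

theorem matrixElement_add_left {t : CMPOTensors ι} (ht : t.Regular I) (Φ Φ' : Fock I) {Ψ : Fock I}
    (hΨ : Ψ ∈ finiteParticle I) :
    t.matrixElement I (Φ + Φ') Ψ = t.matrixElement I Φ Ψ + t.matrixElement I Φ' Ψ := by
  simp only [matrixElement_eq]
  rw [← (summable_matrixElement ht Φ hΨ).tsum_add (summable_matrixElement ht Φ' hΨ)]
  refine tsum_congr fun j => ?_
  rw [← Finset.sum_add_distrib]
  refine Finset.sum_congr rfl fun α _ => ?_
  rw [← integral_add (integrable_integrand ht Φ Ψ α) (integrable_integrand ht Φ' Ψ α)]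
  refine integral_congr_ae ?_
  filter_upwards [subAmplitude_add Φ Φ' (ketPos α)] with x hx
  simp only [integrand, hx, map_add]
  ring

theorem matrixElement_smul_left (t : CMPOTensors ι) (c : ℂ) (Φ Ψ : Fock I) :
    t.matrixElement I (c • Φ) Ψ = conj c * t.matrixElement I Φ Ψ := by
  simp only [matrixElement_eq]
  rw [← tsum_mul_left]
  refine tsum_congr fun j => ?_
  rw [Finset.mul_sum]
  refine Finset.sum_congr rfl fun α _ => ?_
  rw [← integral_const_mul]
  refine integral_congr_ae ?_
  filter_upwards [subAmplitude_smul c Φ (ketPos α)] with x hx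
  simp only [integrand, hx, map_mul]
  ring

theorem matrixElement_add_right {t : CMPOTensors ι} (ht : t.Regular I) (Φ : Fock I) {Ψ Ψ' : Fock I}
    (hΨ : Ψ ∈ finiteParticle I) (hΨ' : Ψ' ∈ finiteParticle I) :
    t.matrixElement I Φ (Ψ + Ψ') = t.matrixElement I Φ Ψ + t.matrixElement I Φ Ψ' := by
  simp only [matrixElement_eq]
  rw [← (summable_matrixElement ht Φ hΨ).tsum_add (summable_matrixElement ht Φ hΨ')]
  refine tsum_congr fun j => ?_
  rw [← Finset.sum_add_distrib]
  refine Finset.sum_congr rfl fun α _ => ?_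
  rw [← integral_add (integrable_integrand ht Φ Ψ α) (integrable_integrand ht Φ Ψ' α)]
  refine integral_congr_ae ?_
  filter_upwards [subAmplitude_add Ψ Ψ' (braPos α)] with x hx
  simp only [integrand, hx]
  ring

theorem matrixElement_smul_right (t : CMPOTensors ι) (c : ℂ) (Φ Ψ : Fock I) :
    t.matrixElement I Φ (c • Ψ) = c * t.matrixElement I Φ Ψ := by
  simp only [matrixElement_eq]
  rw [← tsum_mul_left]
  refine tsum_congr fun j => ?_
  rw [Finset.mul_sum]
  refine Finset.sum_congr rfl fun α _ => ?_
  rw [← integral_const_mul]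
  refine integral_congr_ae ?_
  filter_upwards [subAmplitude_smul c Ψ (braPos α)] with x hx
  simp only [integrand, hx]
  ring

/-- Riesz representation. The matrix element is antilinear in Φ, so its conjugate is the bounded
linear functional to represent. -/
theorem exists_inner_eq_matrixElement {t : CMPOTensors ι} (ht : t.Regular I) {Ψ : Fock I}
    (hΨ : Ψ ∈ finiteParticle I) : ∃ v : Fock I, ∀ Φ, inner ℂ Φ v = t.matrixElement I Φ Ψ := by
  obtain ⟨M, hM⟩ := mem_finiteParticle_iff.1 hΨ
  obtain ⟨K, hK⟩ := exists_norm_matrixElement_le ht M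
  let f : Fock I →L[ℂ] ℂ := LinearMap.mkContinuous
    { toFun := fun Φ => conj (t.matrixElement I Φ Ψ)
      map_add' := fun Φ Φ' => by rw [matrixElement_add_left ht _ _ hΨ, map_add]
      map_smul' := fun c Φ => by
        rw [matrixElement_smul_left, map_mul, Complex.conj_conj]; rfl }
    (K * ‖Ψ‖) (fun Φ => by
      change ‖conj (t.matrixElement I Φ Ψ)‖ ≤ _
      rw [RCLike.norm_conj]
      exact (hK Φ Ψ hM).trans (le_of_eq (by ring)))
  refine ⟨(InnerProductSpace.toDual ℂ (Fock I)).symm f, fun Φ => ?_⟩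
  rw [← inner_conj_symm, InnerProductSpace.toDual_symm_apply]
  exact Complex.conj_conj _

/-- The cMPO with tensors `t` as a linear map on the finite-particle vectors. -/
noncomputable def toLinearMap (t : CMPOTensors ι) (ht : t.Regular I) :
    finiteParticle I →ₗ[ℂ] Fock I where
  toFun Ψ := (exists_inner_eq_matrixElement ht Ψ.2).choose
  map_add' Ψ Ψ' := ext_inner_left ℂ fun Φ => by
    rw [inner_add_right, (exists_inner_eq_matrixElement ht (Ψ + Ψ').2).choose_spec,
      (exists_inner_eq_matrixElement ht Ψ.2).choose_spec,
      (exists_inner_eq_matrixElement ht Ψ'.2).choose_spec]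
    exact matrixElement_add_right ht Φ Ψ.2 Ψ'.2
  map_smul' c Ψ := ext_inner_left ℂ fun Φ => by
    rw [RingHom.id_apply, inner_smul_right,
      (exists_inner_eq_matrixElement ht (c • Ψ).2).choose_spec,
      (exists_inner_eq_matrixElement ht Ψ.2).choose_spec]
    exact matrixElement_smul_right t c Φ Ψ

theorem inner_toLinearMap {t : CMPOTensors ι} (ht : t.Regular I) (Φ : Fock I)
    (Ψ : finiteParticle I) :
    inner ℂ Φ (t.toLinearMap ht Ψ) = t.matrixElement I Φ Ψ :=
  (exists_inner_eq_matrixElement ht Ψ.2).choose_spec Φ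

theorem exists_norm_toLinearMap_le {t : CMPOTensors ι} (ht : t.Regular I) (M : ℕ) :
    ∃ K, ∀ Ψ : finiteParticle I, (∀ n, M < n → (Ψ : Fock I) n = 0) →
      ‖t.toLinearMap ht Ψ‖ ≤ K * ‖(Ψ : Fock I)‖ := by
  obtain ⟨K, hK⟩ := exists_norm_matrixElement_le ht M
  refine ⟨K, fun Ψ hM => ?_⟩
  -- The bound is tested on the image vector itself.
  have h := hK (t.toLinearMap ht Ψ) Ψ hM
  rw [← inner_toLinearMap ht, inner_self_eq_norm_sq_to_K, norm_pow, RCLike.norm_ofReal,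
    abs_of_nonneg (norm_nonneg _)] at h
  -- If the image vanishes no division is possible, and the sign of K has to be read off from the
  -- bound with Φ = Ψ.
  by_cases h0 : ‖t.toLinearMap ht Ψ‖ = 0
  · by_cases hΨ : ‖(Ψ : Fock I)‖ = 0
    · rw [h0, hΨ, mul_zero]
    · have h1 := hK (Ψ : Fock I) Ψ hM
      have : 0 < ‖(Ψ : Fock I)‖ := lt_of_le_of_ne (norm_nonneg _) (Ne.symm hΨ)
      have h2 : 0 ≤ K * (‖(Ψ : Fock I)‖ * ‖(Ψ : Fock I)‖) := (norm_nonneg _).trans h1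
      have h3 : 0 ≤ K := nonneg_of_mul_nonneg_left h2 (by positivity)
      rw [h0]
      positivity
  · have hpos : 0 < ‖t.toLinearMap ht Ψ‖ := lt_of_le_of_ne (norm_nonneg _) (Ne.symm h0)
    refine le_of_mul_le_mul_left ?_ hpos
    calc _ = ‖t.toLinearMap ht Ψ‖ ^ 2 := by ring
      _ ≤ _ := h
      _ = _ := by ring

end CMPOTensors

end OperatorExistence

/-! ### Kronecker products, Duhamel's expansion and overlaps -/

section ProductRule

open scoped Matrix.Norms.Operator MatrixTopology

variable {I : Set ℝ} {ι κ : Type} [Fintype ι] [DecidableEq ι] [Fintype κ] [DecidableEq κ]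

/-! ### Path-ordered exponentials of Kronecker products -/

/-- The algebra homomorphism `M ↦ M ⊗ 1`. -/
noncomputable def kroneckerLeft (ι κ : Type) [Fintype ι] [DecidableEq ι] [Fintype κ]
    [DecidableEq κ] : Matrix ι ι ℂ →L[ℝ] Matrix (ι × κ) (ι × κ) ℂ :=
  LinearMap.toContinuousLinearMap
    { toFun := fun M : Matrix ι ι ℂ => M ⊗ₖ (1 : Matrix κ κ ℂ)
      map_add' := fun M N => by ext; simp [add_mul]
      map_smul' := fun c M => by ext; simp [mul_assoc] }

/-- The algebra homomorphism `M ↦ 1 ⊗ M`. -/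
noncomputable def kroneckerRight (ι κ : Type) [Fintype ι] [DecidableEq ι] [Fintype κ]
    [DecidableEq κ] : Matrix κ κ ℂ →L[ℝ] Matrix (ι × κ) (ι × κ) ℂ :=
  LinearMap.toContinuousLinearMap
    { toFun := fun M : Matrix κ κ ℂ => (1 : Matrix ι ι ℂ) ⊗ₖ M
      map_add' := fun M N => by ext; simp [mul_add]
      map_smul' := fun c M => by ext; simp [mul_left_comm] }

theorem pathExp_kroneckerLeft {Q : ℝ → Matrix ι ι ℂ} {S : Set ℝ} (hQ : IntegrableOn Q S) :
    pathExp (fun x => Q x ⊗ₖ (1 : Matrix κ κ ℂ)) S = pathExp Q S ⊗ₖ (1 : Matrix κ κ ℂ) := by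
  have h := map_orderedExp (kroneckerLeft ι κ) Matrix.one_kronecker_one
    (fun a b => by
      change (a * b) ⊗ₖ (1 : Matrix κ κ ℂ) = (a ⊗ₖ 1) * (b ⊗ₖ 1)
      rw [← Matrix.mul_kronecker_mul, one_mul]) hQ
  rw [pathExp_eq_orderedExp hQ]
  exact (pathExp_eq_orderedExp (integrable_map (kroneckerLeft ι κ) hQ)).trans h.symm

theorem pathExp_kroneckerRight {Q : ℝ → Matrix κ κ ℂ} {S : Set ℝ} (hQ : IntegrableOn Q S) :
    pathExp (fun x => (1 : Matrix ι ι ℂ) ⊗ₖ Q x) S = (1 : Matrix ι ι ℂ) ⊗ₖ pathExp Q S := by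
  have h := map_orderedExp (kroneckerRight ι κ) Matrix.one_kronecker_one
    (fun a b => by
      change (1 : Matrix ι ι ℂ) ⊗ₖ (a * b) = (1 ⊗ₖ a) * (1 ⊗ₖ b)
      rw [← Matrix.mul_kronecker_mul, one_mul]) hQ
  rw [pathExp_eq_orderedExp hQ]
  exact (pathExp_eq_orderedExp (integrable_map (kroneckerRight ι κ) hQ)).trans h.symm

/-- The summands Q ⊗ 1 and 1 ⊗ Q' commute at all pairs of points, so the exponential factorises. -/
theorem pathExp_kronecker {Q : ℝ → Matrix ι ι ℂ} {Q' : ℝ → Matrix κ κ ℂ} {S : Set ℝ}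
    (hQ : IntegrableOn Q S) (hQ' : IntegrableOn Q' S) :
    pathExp (fun x => Q x ⊗ₖ (1 : Matrix κ κ ℂ) + (1 : Matrix ι ι ℂ) ⊗ₖ Q' x) S
      = pathExp Q S ⊗ₖ pathExp Q' S := by
  have h1 : Integrable (fun x => Q x ⊗ₖ (1 : Matrix κ κ ℂ)) (volume.restrict S) :=
    integrable_map (kroneckerLeft ι κ) hQ
  have h2 : Integrable (fun x => (1 : Matrix ι ι ℂ) ⊗ₖ Q' x) (volume.restrict S) :=
    integrable_map (kroneckerRight ι κ) hQ'
  have h12 : Integrable (fun x => Q x ⊗ₖ (1 : Matrix κ κ ℂ) + (1 : Matrix ι ι ℂ) ⊗ₖ Q' x)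
      (volume.restrict S) := h1.add h2
  rw [pathExp_eq_orderedExp h12, orderedExp_add_of_commute h1 h2 fun z w => by
      rw [Commute, SemiconjBy, ← Matrix.mul_kronecker_mul, ← Matrix.mul_kronecker_mul]
      simp,
    ← pathExp_eq_orderedExp h1, ← pathExp_eq_orderedExp h2, pathExp_kroneckerLeft hQ,
    pathExp_kroneckerRight hQ', ← Matrix.mul_kronecker_mul, mul_one, one_mul]

theorem dysonTerm_submatrix (Q : ℝ → Matrix ι ι ℂ) (e : κ ≃ ι) (k : ℕ) (S : Set ℝ) :
    dysonTerm (fun x => (Q x).submatrix e e) k S = (dysonTerm Q k S).submatrix e e := by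
  induction k generalizing S with
  | zero => exact (Matrix.submatrix_one_equiv e).symm
  | succ k ih =>
    ext a b
    simp only [dysonTerm, Matrix.of_apply, Matrix.submatrix_apply, ih, Matrix.submatrix_mul_equiv]

theorem pathExp_submatrix (Q : ℝ → Matrix ι ι ℂ) (e : κ ≃ ι) (S : Set ℝ) :
    pathExp (fun x => (Q x).submatrix e e) S = (pathExp Q S).submatrix e e := by
  ext a b
  simp only [pathExp, Matrix.of_apply, Matrix.submatrix_apply, dysonTerm_submatrix]

namespace CMPOTensors

/-- The vacuum matrix element `Tr (B 𝒫 exp ∫ Q)`. -/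
noncomputable def vacuumElement (t : CMPOTensors ι) (I : Set ℝ) : ℂ :=
  Matrix.trace (t.B * pathExp t.Q I)

theorem vacuumElement_eq_of_reindex {t : CMPOTensors ι} {s : CMPOTensors κ} (e : κ ≃ ι)
    (hB : s.B = t.B.submatrix e e) (hQ : ∀ x, s.Q x = (t.Q x).submatrix e e) :
    s.vacuumElement I = t.vacuumElement I := by
  have hQ' : s.Q = fun x => (t.Q x).submatrix e e := funext hQ
  rw [vacuumElement, vacuumElement, hB, hQ', pathExp_submatrix, Matrix.submatrix_mul_equiv,
    Matrix.trace, Matrix.trace]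
  exact e.sum_comp fun a => (t.B * pathExp t.Q I) a a

/-- Duhamel's expansion of the path-ordered exponential of a sum. -/
theorem hasSum_integral_coeff {t : CMPOTensors ι} (hQ : Integrable t.Q (volume.restrict I))
    {C : ℝ → Matrix ι ι ℂ} (hC : Integrable C (volume.restrict I))
    {f : ∀ j : ℕ, (Fin j → ℝ) → ℂ}
    (hf : ∀ j, f j =ᵐ[orderedMeasure I j] fun x => Matrix.trace (t.B * ((List.ofFn fun i =>
      orderedExp t.Q ((volume.restrict I).restrict (Iio (x i))) * C (x i) *
        orderedExpInv t.Q ((volume.restrict I).restrict (Iio (x i)))).prod *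
          orderedExp t.Q (volume.restrict I)))) :
    (∀ j, Integrable (f j) (orderedMeasure I j)) ∧
    HasSum (fun j => ∫ x in orderedConfigs I j, f j x)
      (Matrix.trace (t.B * pathExp (fun x => t.Q x + C x) I)) := by
  have hi : Integrable (fun z => orderedExp t.Q ((volume.restrict I).restrict (Iio z)) * C z *
      orderedExpInv t.Q ((volume.restrict I).restrict (Iio z))) (volume.restrict I) :=
    integrable_mul_orderedExpInv hQ (integrable_orderedExp_mul hQ hC)
  have hp : ∀ j, Integrable (fun x : Fin j → ℝ => (List.ofFn fun i =>
      orderedExp t.Q ((volume.restrict I).restrict (Iio (x i))) * C (x i) *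
        orderedExpInv t.Q ((volume.restrict I).restrict (Iio (x i)))).prod)
      (orderedMeasure I j) := fun j =>
    (integrable_list_prod (n := j) fun _ => hi).mono_measure (orderedMeasure_le I j)
  have hqc : Integrable (fun z => t.Q z + C z) (volume.restrict I) := hQ.add hC
  -- The traced Dyson series of the dressed perturbation; `orderedExp_add` resums it into the
  -- exponential of Q + C.
  have hs := (summable_dyson hi).hasSum
  have hs' := (traceCLM t.B (orderedExp t.Q (volume.restrict I))).hasSum hs
  rw [← orderedExp, traceCLM_apply, ← orderedExp_add hQ hC,
    ← pathExp_eq_orderedExp hqc] at hs'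
  refine ⟨fun j => ?_, hs'.congr_fun ?_⟩
  · exact ((traceCLM t.B (orderedExp t.Q (volume.restrict I))).integrable_comp (hp j)).congr
      (hf j).symm
  · intro j
    rw [integral_congr_ae (hf j)]
    have := (traceCLM t.B (orderedExp t.Q (volume.restrict I))).integral_comp_comm (hp j)
    rw [setIntegral_orderedConfigs_list_prod hi] at this
    exact this

/-! ### Overlaps of matrix product vectors -/

theorem word_overlap {s : CMPOTensors ι} {t : CMPOTensors κ} {w : CMPOTensors (ι × κ)}
    (hwQ : w.Q = fun x => s.Q x ⊗ₖ (1 : Matrix κ κ ℂ) + (1 : Matrix ι ι ℂ) ⊗ₖ t.Q x)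
    (hwL : w.L = fun x => s.L x ⊗ₖ t.L x) {S : Set ℝ} (hs : IntegrableOn s.Q S)
    (ht : IntegrableOn t.Q S) (l : List ℝ) :
    w.word S (l.map fun x => (Ladder.l, x))
      = s.word S (l.map fun x => (Ladder.l, x)) ⊗ₖ t.word S (l.map fun x => (Ladder.l, x)) := by
  have hp : ∀ S' ⊆ S, pathExp w.Q S' = pathExp s.Q S' ⊗ₖ pathExp t.Q S' := fun S' h => by
    rw [hwQ, pathExp_kronecker (hs.mono_set h) (ht.mono_set h)]
  induction l generalizing S with
  | nil => exact hp S subset_rfl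
  | cons x l ih =>
    simp only [List.map_cons, word]
    rw [ih (hs.mono_set inter_subset_left) (ht.mono_set inter_subset_left)
      fun S' h => hp S' (h.trans inter_subset_left), hp _ inter_subset_left,
      Matrix.mul_kronecker_mul, Matrix.mul_kronecker_mul]
    simp only [K, hwL]

/-- Conjugating a vector must not exchange L and R, so these tensors differ from `adj`. -/
theorem adj_coeff_l {s : CMPOTensors ι} {j : ℕ} (x : Fin j → ℝ) :
    (⟨s.B.map conj, fun x => (s.Q x).map conj, fun x => (s.L x).map conj, fun _ => 0, fun _ => 0⟩ :
      CMPOTensors ι).coeff I (fun _ : Fin j => Ladder.l) x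
      = conj (s.coeff I (fun _ => Ladder.l) x) := by
  have hw : ∀ (S : Set ℝ) (l : List ℝ),
      (⟨s.B.map conj, fun x => (s.Q x).map conj, fun x => (s.L x).map conj, fun _ => 0,
        fun _ => 0⟩ : CMPOTensors ι).word S (l.map fun x => (Ladder.l, x))
      = (s.word S (l.map fun x => (Ladder.l, x))).map conj := by
    intro S l
    induction l generalizing S with
    | nil => exact pathExp_conj _ _
    | cons x l ih =>
      simp only [List.map_cons, word]
      rw [ih, Matrix.map_mul, Matrix.map_mul]
      exact congrArg (fun M => M * _ * _) (pathExp_conj _ _)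
  have e : (List.ofFn fun i => (Ladder.l, x i)) = (List.ofFn x).map fun x => (Ladder.l, x) := by
    rw [List.map_ofFn]; rfl
  rw [coeff, coeff, e, hw]
  dsimp only
  rw [← Matrix.map_mul, Matrix.trace, Matrix.trace, map_sum]
  rfl

/-- The overlap density is the coefficient of tensors w whose L is conj L ⊗ L. In Duhamel's
expansion this L perturbs Q; since the R of the adjoint is conj L, the sum is the Q of the product
tensors. -/
theorem hasSum_overlap {s : CMPOTensors ι} {t : CMPOTensors κ} (hs : s.Regular I)
    (ht : t.Regular I) :
    (∀ j, Integrable (fun x => conj (s.coeff I (fun _ : Fin j => Ladder.l) x) *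
      t.coeff I (fun _ => Ladder.l) x) (orderedMeasure I j)) ∧
    HasSum (fun j => ∫ x in orderedConfigs I j, conj (s.coeff I (fun _ : Fin j => Ladder.l) x) *
      t.coeff I (fun _ => Ladder.l) x) ((s.adj.mul t).vacuumElement I) := by
  let s' : CMPOTensors ι :=
    ⟨s.B.map conj, fun x => (s.Q x).map conj, fun x => (s.L x).map conj, fun _ => 0, fun _ => 0⟩
  let w : CMPOTensors (ι × κ) :=
    ⟨s'.B ⊗ₖ t.B, fun x => s'.Q x ⊗ₖ (1 : Matrix κ κ ℂ) + (1 : Matrix ι ι ℂ) ⊗ₖ t.Q x,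
      fun x => s'.L x ⊗ₖ t.L x, fun _ => 0, fun _ => 0⟩
  have hs'Q : Integrable s'.Q (volume.restrict I) := hs.adj.integrable_Q
  have hwQ : Integrable w.Q (volume.restrict I) :=
    (integrable_map (kroneckerLeft ι κ) hs'Q).add
      (integrable_map (kroneckerRight ι κ) ht.integrable_Q)
  have hwL : Integrable w.L (volume.restrict I) := integrable_matrix_iff.2 fun a b =>
    (hs.adj.R_mem a.1 b.1).integrable_mul (ht.L_mem a.2 b.2)
  refine hasSum_integral_coeff (t := w) hwQ hwL fun j => ?_
  filter_upwards [ae_strictMono I j] with x hx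
  have h1 := coeff_eq (t := w) hwQ (fun _ => Ladder.l) hx.monotone
  refine Eq.trans ?_ h1
  have e : (List.ofFn fun i => (Ladder.l, x i)) = (List.ofFn x).map fun x => (Ladder.l, x) := by
    rw [List.map_ofFn]; rfl
  rw [← adj_coeff_l, coeff, coeff, coeff, e, word_overlap (s := s') (t := t) (w := w) rfl rfl hs'Q
    ht.integrable_Q, ← Matrix.mul_kronecker_mul, Matrix.trace_kronecker]

end CMPOTensors

end ProductRule

/-! ### Ordered products over finitely many positions -/

theorem List.prod_ofFn_ite_mem {M : Type*} [Monoid M] {j : ℕ} (s : Finset (Fin j)) (f : Fin j → M) :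
    (List.ofFn fun i => if i ∈ s then f i else 1).prod
      = (List.ofFn fun i => f (s.orderEmbOfFin rfl i)).prod := by
  have h1 : s.sort = (List.finRange j).filter (· ∈ s) := by
    refine (s.sortedLT_sort).eq_of_mem_iff ?_ fun i => by simp
    exact ((List.sortedLT_finRange j).pairwise.filter _).sortedLT
  have h2 : (List.ofFn fun i => f (s.orderEmbOfFin rfl i)) = (s.sort).map f := by
    rw [← Finset.listMap_orderEmbOfFin_finRange s rfl, List.map_map, List.ofFn_eq_map]
    rfl
  rw [h2, h1, List.ofFn_eq_map]
  induction List.finRange j with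
  | nil => simp
  | cons a l ih =>
    rw [List.map_cons, List.prod_cons, ih]
    by_cases h : a ∈ s <;> simp [h]

/-- Distributivity with the order of factors kept. It merges the sum over all words of length j into
one Dyson term for the sum of the three ladder matrices. -/
theorem sum_prod_ofFn {𝔸 β : Type*} [Semiring 𝔸] [Fintype β] {j : ℕ} (c : Fin j → β → 𝔸) :
    ∑ α : Fin j → β, (List.ofFn fun i => c i (α i)).prod = (List.ofFn fun i => ∑ b, c i b).prod := by
  induction j with
  | zero => simp
  | succ j ih =>
    rw [← (Fin.consEquiv fun _ : Fin (j + 1) => β).sum_comp, Fintype.sum_prod_type]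
    simp only [Fin.consEquiv_apply, List.ofFn_succ, List.prod_cons, Fin.cons_zero, Fin.cons_succ]
    simp only [← Finset.mul_sum, ← Finset.sum_mul, ← ih]

/-! ### Matrix product vectors and matrix elements between them -/

section MatrixProductVectors

open scoped Matrix.Norms.Operator MatrixTopology

variable {I : Set ℝ} {ι κ κ' : Type} [Fintype ι] [DecidableEq ι] [Fintype κ] [DecidableEq κ]
  [Fintype κ'] [DecidableEq κ']

theorem pathExp_zero (S : Set ℝ) : pathExp (fun _ => (0 : Matrix ι ι ℂ)) S = 1 := by
  ext a b
  rw [pathExp, Matrix.of_apply, tsum_eq_single 0]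
  · rfl
  · rintro (_ | k) hk
    · exact absurd rfl hk
    · simp [dysonTerm]

/-- The tensors of a matrix product vector without propagators. -/
def vectorTensors (E : Matrix κ κ ℂ) (F : ℝ → Matrix κ κ ℂ) : CMPOTensors κ :=
  ⟨E, fun _ => 0, F, fun _ => 0, fun _ => 0⟩

theorem vectorTensors_regular (E : Matrix κ κ ℂ) {F : ℝ → Matrix κ κ ℂ}
    (hF : ∀ a b, MemLp (fun x => F x a b) 2 (volume.restrict I)) :
    (vectorTensors E F).Regular I :=
  ⟨fun _ _ => integrable_zero _ _ _, hF, fun _ _ => MemLp.zero', fun _ _ => MemLp.zero'⟩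

theorem coeff_vectorTensors (E : Matrix κ κ ℂ) (F : ℝ → Matrix κ κ ℂ) {n : ℕ} (x : Fin n → ℝ) :
    (vectorTensors E F).coeff I (fun _ => Ladder.l) x
      = Matrix.trace (E * (List.ofFn fun i => F (x i)).prod) := by
  have h : ∀ (S : Set ℝ) (l : List ℝ), (vectorTensors E F).word S (l.map fun x => (Ladder.l, x))
      = (l.map F).prod := by
    intro S l
    induction l generalizing S with
    | nil => exact pathExp_zero S
    | cons x l ih =>
      rw [List.map_cons, CMPOTensors.word, ih, List.map_cons, List.prod_cons]
      simp only [vectorTensors, pathExp_zero, one_mul, CMPOTensors.K]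
  have e : (List.ofFn fun i => (Ladder.l, x i)) = (List.ofFn x).map fun x => (Ladder.l, x) := by
    rw [List.map_ofFn]; rfl
  rw [CMPOTensors.coeff, e, h, List.map_ofFn]
  rfl

/-- `Φ` is the matrix product vector with tensors `B`, `Q`, `L`. -/
def IsMatrixProduct (Φ : Fock I) (t : CMPOTensors ι) : Prop :=
  ∀ n, amplitude Φ n =ᵐ[orderedMeasure I n] t.coeff I fun _ => Ladder.l

theorem IsMatrixProduct.inner_eq {Φ Ψ : Fock I} {s : CMPOTensors ι} {t : CMPOTensors κ}
    (hs : s.Regular I) (ht : t.Regular I) (hΦ : IsMatrixProduct Φ s) (hΨ : IsMatrixProduct Ψ t) :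
    inner ℂ Φ Ψ = (s.adj.mul t).vacuumElement I := by
  refine (hasSum_inner_amplitude Φ Ψ).unique ((CMPOTensors.hasSum_overlap hs ht).2.congr_fun ?_)
  intro n
  refine integral_congr_ae ?_
  filter_upwards [hΦ n, hΨ n] with x h1 h2
  rw [h1, h2]

/-- Unit matrices are inserted at the positions outside s, so that ket, operator and bra become
products over the same positions and combine in a Kronecker product. -/
theorem IsMatrixProduct.subAmplitude {Φ : Fock I} {E : Matrix κ κ ℂ} {F : ℝ → Matrix κ κ ℂ}
    (h : IsMatrixProduct Φ (vectorTensors E F)) {j : ℕ} (s : Finset (Fin j)) :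
    ∀ᵐ x ∂orderedMeasure I j, subAmplitude Φ s x
      = Matrix.trace (E * (List.ofFn fun i => if i ∈ s then F (x i) else 1).prod) := by
  filter_upwards [(quasiMeasurePreserving_subConfig_ordered s).ae (h s.card)] with x hx
  rw [_root_.subAmplitude, hx, coeff_vectorTensors, List.prod_ofFn_ite_mem s fun i => F (x i)]
  rfl

/-- The tensors of the matrix element of the cMPO with tensors `t` between two matrix product
vectors. -/
def sandwich (t : CMPOTensors ι) (E : Matrix κ κ ℂ) (F : ℝ → Matrix κ κ ℂ) (E' : Matrix κ' κ' ℂ)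
    (F' : ℝ → Matrix κ' κ' ℂ) : CMPOTensors (κ × ι × κ') where
  B := E.map conj ⊗ₖ (t.B ⊗ₖ E')
  Q x := 1 ⊗ₖ (t.Q x ⊗ₖ 1)
  L x := (F x).map conj ⊗ₖ (t.L x ⊗ₖ 1)
  R x := 1 ⊗ₖ (t.R x ⊗ₖ F' x)
  T x := (F x).map conj ⊗ₖ (t.T x ⊗ₖ F' x)

theorem sandwich_word (t : CMPOTensors ι) (E : Matrix κ κ ℂ) (F : ℝ → Matrix κ κ ℂ)
    (E' : Matrix κ' κ' ℂ) (F' : ℝ → Matrix κ' κ' ℂ) {S : Set ℝ} (hQ : IntegrableOn t.Q S)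
    (l : List (Ladder × ℝ)) :
    (sandwich t E F E' F').word S l
      = ((l.map fun p => if p.1 = Ladder.l ∨ p.1 = Ladder.a then F p.2 else 1).prod.map conj) ⊗ₖ
        (t.word S l ⊗ₖ
          (l.map fun p => if p.1 = Ladder.r ∨ p.1 = Ladder.a then F' p.2 else 1).prod) := by
  have hp : ∀ S' ⊆ S, pathExp (sandwich t E F E' F').Q S' = 1 ⊗ₖ (pathExp t.Q S' ⊗ₖ 1) :=
    fun S' h => by
      have h' : IntegrableOn t.Q S' := hQ.mono_set h
      rw [← pathExp_kroneckerLeft h']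
      exact pathExp_kroneckerRight (integrable_map (kroneckerLeft ι κ') h')
  induction l generalizing S with
  | nil => simpa [CMPOTensors.word, Matrix.map_one] using hp S subset_rfl
  | cons p l ih =>
    obtain ⟨α, x⟩ := p
    have hK : (sandwich t E F E' F').K α x
        = ((if α = Ladder.l ∨ α = Ladder.a then F x else 1).map conj) ⊗ₖ (t.K α x ⊗ₖ
          (if α = Ladder.r ∨ α = Ladder.a then F' x else 1)) := by
      cases α <;> simp [CMPOTensors.K, sandwich, Matrix.map_one]
    simp only [CMPOTensors.word, List.map_cons, List.prod_cons]
    rw [ih (hQ.mono_set inter_subset_left) fun S' h => hp S' (h.trans inter_subset_left),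
      hp _ inter_subset_left, hK]
    simp only [← Matrix.mul_kronecker_mul, one_mul, Matrix.map_mul]

theorem sandwich_coeff (t : CMPOTensors ι) (E : Matrix κ κ ℂ) (F : ℝ → Matrix κ κ ℂ)
    (E' : Matrix κ' κ' ℂ) (F' : ℝ → Matrix κ' κ' ℂ) (hQ : IntegrableOn t.Q I) {j : ℕ}
    (α : Fin j → Ladder) (x : Fin j → ℝ) :
    (sandwich t E F E' F').coeff I α x
      = t.coeff I α x *
        conj (Matrix.trace (E * (List.ofFn fun i => if i ∈ ketPos α then F (x i) else 1).prod)) *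
        Matrix.trace (E' * (List.ofFn fun i => if i ∈ braPos α then F' (x i) else 1).prod) := by
  rw [CMPOTensors.coeff, sandwich_word t E F E' F' hQ, sandwich, ← Matrix.mul_kronecker_mul,
    ← Matrix.mul_kronecker_mul, Matrix.trace_kronecker, Matrix.trace_kronecker, ← Matrix.map_mul,
    List.map_ofFn, List.map_ofFn]
  have h : ∀ M : Matrix κ κ ℂ, Matrix.trace (M.map conj) = conj (Matrix.trace M) := fun M => by
    simp [Matrix.trace]
  rw [h]
  simp only [ketPos, braPos, Finset.mem_filter, Finset.mem_univ, true_and, Function.comp_def,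
    CMPOTensors.coeff]
  ring

/-- The matrix element of a cMPO between matrix product vectors. -/
theorem CMPOTensors.matrixElement_eq_vacuumElement {t : CMPOTensors ι} (ht : t.Regular I)
    {Φ Ψ : Fock I} {E : Matrix κ κ ℂ} {F : ℝ → Matrix κ κ ℂ} {E' : Matrix κ' κ' ℂ}
    {F' : ℝ → Matrix κ' κ' ℂ} (hF : (vectorTensors E F).Regular I)
    (hF' : (vectorTensors E' F').Regular I) (hΦ : IsMatrixProduct Φ (vectorTensors E F))
    (hΨ : IsMatrixProduct Ψ (vectorTensors E' F')) :
    t.matrixElement I Φ Ψ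
      = ((vectorTensors E F).adj.mul (t.mul (vectorTensors E' F'))).vacuumElement I := by
  set w := sandwich t E F E' F'
  set m := (vectorTensors E F).adj.mul (t.mul (vectorTensors E' F'))
  have hwQ : Integrable w.Q (volume.restrict I) :=
    integrable_map (kroneckerRight κ (ι × κ')) (integrable_map (kroneckerLeft ι κ') ht.integrable_Q)
  have hmQ : Integrable m.Q (volume.restrict I) := (hF.adj.mul (ht.mul hF')).integrable_Q
  -- Expanded by the product rule, the Q of the triple product contains beyond the Q of the operator
  -- exactly three terms: L met by the ket, R met by the bra, and T met by both.
  have hm : ∀ x, m.Q x = w.Q x + ∑ b, w.K b x := fun x => by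
    have : (∑ b, w.K b x) = w.L x + (w.R x + w.T x) := by
      change Finset.sum {Ladder.l, Ladder.r, Ladder.a} _ = _
      rw [Finset.sum_insert (by simp), Finset.sum_insert (by simp), Finset.sum_singleton]
      rfl
    rw [this]
    simp only [m, w, mul, adj, vectorTensors, sandwich, Matrix.kronecker_add]
    ext a b
    simp
    ring
  have hC : Integrable (fun x => ∑ b, w.K b x) (volume.restrict I) := by
    refine (hmQ.sub hwQ).congr (.of_forall fun x => ?_)
    simp [hm]
  have hs := (hasSum_integral_coeff (t := w) hwQ hC
    (f := fun j x => ∑ α : Fin j → Ladder, t.integrand Φ Ψ α x) fun j => ?_).2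
  · simp only [← hm] at hs
    rw [matrixElement_eq]
    refine Eq.trans (tsum_congr fun j => ?_) hs.tsum_eq
    exact (integral_finsetSum _ fun α _ => integrable_integrand ht Φ Ψ α).symm
  · have h1 : ∀ᵐ x ∂orderedMeasure I j, ∀ α : Fin j → Ladder,
        t.integrand Φ Ψ α x = w.coeff I α x := by
      refine ae_all_iff.2 fun α => ?_
      filter_upwards [hΦ.subAmplitude (ketPos α), hΨ.subAmplitude (braPos α)] with x h1 h2
      rw [sandwich_coeff t E F E' F' ht.integrable_Q, integrand, h1, h2]
    filter_upwards [h1, ae_strictMono I j] with x hx hmono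
    simp only [hx, coeff_eq hwQ _ hmono.monotone]
    rw [← Matrix.trace_sum, ← Finset.mul_sum, ← Finset.sum_mul,
      sum_prod_ofFn fun i α => w.dressed I α (x i)]
    simp only [dressed, ← Finset.sum_mul, ← Finset.mul_sum]

end MatrixProductVectors

/-! ### Test vectors supported on cubes -/

section TestVectors

open scoped Matrix.Norms.Operator MatrixTopology

variable {I : Set ℝ} {ι κ κ' : Type} [Fintype ι] [DecidableEq ι] [Fintype κ] [DecidableEq κ]
  [Fintype κ'] [DecidableEq κ']

/-! ### Indicator functions of cubes as matrix product vectors -/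

theorem memLp_indicator_closedBall {n : ℕ} (c : Fin n → ℝ) (r : ℝ) :
    MemLp ((Metric.closedBall c r).indicator fun _ => (1 : ℂ)) 2 (orderedMeasure I n) :=
  memLp_indicator_const 2 Metric.isClosed_closedBall.measurableSet 1
    (.inr ((Measure.restrict_apply_le _ _).trans_lt measure_closedBall_lt_top).ne)

/-- The vector whose amplitude on the ordered configurations is the indicator function of a
cube. -/
noncomputable def testVector (I : Set ℝ) {n : ℕ} (c : Fin n → ℝ) (r : ℝ) : finiteParticle I :=
  ⟨lp.single 2 n (ofOrdered I _ (memLp_indicator_closedBall c r)), single_mem_finiteParticle n _⟩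

theorem testVector_apply {n : ℕ} (c : Fin n → ℝ) (r : ℝ) :
    (testVector I c r : Fock I) n = ofOrdered I _ (memLp_indicator_closedBall c r) :=
  lp.single_apply_self (E := fun n => NParticle I n) 2 n _

theorem testVector_apply_ne {n m : ℕ} (c : Fin n → ℝ) (r : ℝ) (h : m ≠ n) :
    (testVector I c r : Fock I) m = 0 :=
  lp.single_apply_ne (E := fun n => NParticle I n) 2 n _ h

theorem amplitude_testVector {n : ℕ} (c : Fin n → ℝ) (r : ℝ) :
    amplitude (testVector I c r : Fock I) n =ᵐ[orderedMeasure I n]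
      (Metric.closedBall c r).indicator fun _ => 1 :=
  amplitude_of_apply_eq_ofOrdered (testVector_apply c r)

theorem integrableOn_amplitude {n : ℕ} (Θ : Fock I) {c : Fin n → ℝ} {r : ℝ}
    (hc : Metric.closedBall c r ⊆ orderedConfigs I n) :
    IntegrableOn (amplitude Θ n) (Metric.closedBall c r) := by
  have h : MemLp (amplitude Θ n) 2 (volume.restrict (Metric.closedBall c r)) :=
    (memLp_amplitude Θ n).mono_measure (Measure.restrict_mono_set _ hc)
  have : IsFiniteMeasure (volume.restrict (Metric.closedBall c r)) :=
    ⟨by rw [Measure.restrict_apply_univ]; exact measure_closedBall_lt_top⟩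
  exact h.integrable (by norm_num)

theorem inner_testVector {n : ℕ} (Θ : Fock I) {c : Fin n → ℝ} {r : ℝ}
    (hc : Metric.closedBall c r ⊆ orderedConfigs I n) :
    inner ℂ (testVector I c r : Fock I) Θ = ∫ x in Metric.closedBall c r, amplitude Θ n x := by
  have h1 : inner ℂ (testVector I c r : Fock I) Θ
      = inner ℂ ((testVector I c r : Fock I) n) (Θ n) := by
    rw [testVector_apply]
    exact lp.inner_single_left n _ Θ
  rw [h1, inner_apply_eq_integral, ← inter_eq_right.2 hc,
    ← setIntegral_indicator Metric.isClosed_closedBall.measurableSet]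
  refine integral_congr_ae ?_
  filter_upwards [amplitude_testVector (I := I) c r] with x hx
  rw [hx]
  by_cases h : x ∈ Metric.closedBall c r <;> simp [h]

theorem apply_eq_zero_of_inner_testVector (hI : I.OrdConnected) {n : ℕ} {Θ : Fock I}
    (H : ∀ (c : Fin n → ℝ) (r : ℝ), 0 < r → Metric.closedBall c r ⊆ orderedConfigs I n →
      inner ℂ (testVector I c r : Fock I) Θ = 0) : Θ n = 0 :=
  eq_zero_of_amplitude (ae_eq_zero_of_setIntegral_closedBall_eq_zero hI fun c r hr hc =>
    ⟨integrableOn_amplitude Θ hc, (inner_testVector Θ hc).symm.trans (H c r hr hc)⟩)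

/-- A linear functional on the finite-particle vectors that is bounded on the vectors with a bounded
number of particles vanishes if it vanishes on the indicator functions of cubes. -/
theorem eq_zero_of_testVector (hI : I.OrdConnected) {f : finiteParticle I →ₗ[ℂ] ℂ}
    (hf : ∀ M : ℕ, ∃ K, ∀ Ψ : finiteParticle I, (∀ n, M < n → (Ψ : Fock I) n = 0) →
      ‖f Ψ‖ ≤ K * ‖(Ψ : Fock I)‖)
    (H : ∀ (n : ℕ) (c : Fin n → ℝ) (r : ℝ), 0 < r → Metric.closedBall c r ⊆ orderedConfigs I n →
      f (testVector I c r) = 0) : f = 0 := by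
  have key : ∀ (n : ℕ) (v : NParticle I n),
      f ⟨lp.single 2 n v, single_mem_finiteParticle n v⟩ = 0 := by
    intro n v
    obtain ⟨K, hK⟩ := hf n
    let g : NParticle I n →L[ℂ] ℂ := LinearMap.mkContinuous
      { toFun := fun v => f ⟨lp.single 2 n v, single_mem_finiteParticle n v⟩
        map_add' := fun v w => by
          rw [← map_add]
          exact congrArg f (Subtype.ext (lp.single_add (E := fun n => NParticle I n) 2 n v w))
        map_smul' := fun a v => by
          rw [← map_smul]
          exact congrArg f (Subtype.ext (lp.single_smul (E := fun n => NParticle I n) 2 n a v)) }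
      K fun v => by
        have h := hK ⟨lp.single 2 n v, single_mem_finiteParticle n v⟩ fun m hm =>
          lp.single_apply_ne (E := fun n => NParticle I n) 2 n v hm.ne'
        rwa [lp.norm_single (E := fun n => NParticle I n) (by norm_num) n v] at h
    -- The Riesz vector of the functional on n particles is orthogonal to all cube indicators, so
    -- its amplitude integrates to zero over every cube.
    let u : NParticle I n := (InnerProductSpace.toDual ℂ (NParticle I n)).symm g
    have hu : ∀ w, inner ℂ u w = g w := fun w => InnerProductSpace.toDual_symm_apply
    have h0 : (lp.single 2 n u : Fock I) n = 0 := by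
      refine apply_eq_zero_of_inner_testVector hI fun c r hr hc => ?_
      rw [← inner_conj_symm, lp.inner_single_left, hu, testVector_apply]
      exact (congrArg conj (H n c r hr hc)).trans (map_zero _)
    rw [lp.single_apply_self (E := fun n => NParticle I n) 2 n u] at h0
    have := hu v
    rw [h0, inner_zero_left] at this
    exact this.symm
  ext Ψ
  obtain ⟨M, hM⟩ := mem_finiteParticle_iff.1 Ψ.2
  have h : Ψ = ∑ n ∈ Finset.range (M + 1), (⟨lp.single 2 n ((Ψ : Fock I) n),
      single_mem_finiteParticle n _⟩ : finiteParticle I) := by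
    apply Subtype.ext
    rw [AddSubmonoidClass.coe_finsetSum]
    exact sum_single_eq hM
  rw [h, map_sum, LinearMap.zero_apply]
  exact Finset.sum_eq_zero fun n _ => key n _

/-- The indicator function of the `k`-th edge of a cube. -/
noncomputable def edgeFunction {n : ℕ} (c : Fin n → ℝ) (r : ℝ) (k : ℕ) : ℝ → ℂ :=
  if h : k < n then (Metric.closedBall (c ⟨k, h⟩) r).indicator fun _ => 1 else 0

/-- The matrix that raises the particle number. -/
noncomputable def shiftMatrix (n : ℕ) (w : ℕ → ℂ) : Matrix (Fin (n + 1)) (Fin (n + 1)) ℂ :=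
  Matrix.of fun p q => if (p : ℕ) + 1 = q then w p else 0

/-- Each factor raises the index by one, so a single path leads from p to p + m. -/
theorem prod_shiftMatrix (n : ℕ) {m : ℕ} (w : Fin m → ℕ → ℂ) (p q : Fin (n + 1)) :
    (List.ofFn fun i => shiftMatrix n (w i)).prod p q
      = if (p : ℕ) + m = q then ∏ i, w i (p + i) else 0 := by
  induction m generalizing p with
  | zero => simp [Matrix.one_apply, Fin.ext_iff]
  | succ m ih =>
    rw [List.ofFn_succ, List.prod_cons, Matrix.mul_apply]
    simp only [ih]
    simp only [shiftMatrix, Matrix.of_apply]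
    by_cases hp : (p : ℕ) + 1 < n + 1
    · rw [Finset.sum_eq_single ⟨p + 1, hp⟩]
      · simp only [if_true, Fin.prod_univ_succ, Fin.val_zero, add_zero, Fin.val_succ]
        have e : (p : ℕ) + 1 + m = p + (m + 1) := by ring
        have e' : ∀ i : Fin m, (p : ℕ) + 1 + i = p + (i + 1) := fun i => by ring
        simp only [e, e']
        split_ifs <;> simp
      · intro s _ hs
        rw [if_neg fun h => hs (Fin.ext h.symm), zero_mul]
      · simp
    · rw [if_neg (by have := q.2; omega)]
      refine Finset.sum_eq_zero fun s _ => ?_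
      rw [if_neg (by have := s.2; omega), zero_mul]

/-- The matrix product tensors of the indicator function of a cube. -/
noncomputable def testTensors {n : ℕ} (c : Fin n → ℝ) (r : ℝ) : CMPOTensors (Fin (n + 1)) :=
  vectorTensors (Matrix.single (Fin.last n) 0 1) fun z => shiftMatrix n fun k => edgeFunction c r k z

theorem testTensors_regular {n : ℕ} (c : Fin n → ℝ) (r : ℝ) : (testTensors c r).Regular I := by
  refine vectorTensors_regular _ fun p q => ?_
  simp only [shiftMatrix, Matrix.of_apply]
  split_ifs with h
  · rw [edgeFunction]
    split_ifs
    · exact memLp_indicator_const 2 Metric.isClosed_closedBall.measurableSet 1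
        (.inr ((Measure.restrict_apply_le _ _).trans_lt measure_closedBall_lt_top).ne)
    · exact MemLp.zero'
  · exact MemLp.zero'

/-- The boundary matrix reads off the entry (0, n), reached by exactly n shifts. The i-th shift
carries the indicator of the i-th edge, and their product is the indicator of the cube. -/
theorem coeff_testTensors {n : ℕ} {c : Fin n → ℝ} {r : ℝ} (hr : 0 ≤ r) (x : Fin n → ℝ) :
    (testTensors c r).coeff I (fun _ => Ladder.l) x
      = (Metric.closedBall c r).indicator (fun _ => 1) x := by
  rw [testTensors, coeff_vectorTensors, Matrix.trace_single_mul,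
    prod_shiftMatrix n fun i k => edgeFunction c r k (x i)]
  simp only [Fin.val_zero, zero_add, Fin.val_last, if_true, one_smul, edgeFunction, Fin.is_lt,
    dif_pos, Fin.eta]
  rw [closedBall_pi c hr]
  by_cases h : x ∈ univ.pi fun b => Metric.closedBall (c b) r
  · rw [indicator_of_mem h]
    refine Finset.prod_eq_one fun i _ => ?_
    exact indicator_of_mem (h i (mem_univ i)) _
  · rw [indicator_of_notMem h]
    simp only [mem_univ_pi, not_forall] at h
    obtain ⟨i, hi⟩ := h
    refine Finset.prod_eq_zero (Finset.mem_univ i) ?_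
    exact indicator_of_notMem hi _

theorem coeff_testTensors_ne {n m : ℕ} (c : Fin n → ℝ) (r : ℝ) (h : m ≠ n) (x : Fin m → ℝ) :
    (testTensors c r).coeff I (fun _ => Ladder.l) x = 0 := by
  rw [testTensors, coeff_vectorTensors, Matrix.trace_single_mul,
    prod_shiftMatrix n fun i k => edgeFunction c r k (x i)]
  simp [h]

theorem isMatrixProduct_testVector {n : ℕ} {c : Fin n → ℝ} {r : ℝ} (hr : 0 ≤ r) :
    IsMatrixProduct (testVector I c r : Fock I) (testTensors c r) := by
  intro m
  by_cases h : m = n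
  · subst h
    filter_upwards [amplitude_testVector (I := I) c r] with x hx
    rw [hx, coeff_testTensors hr]
  · filter_upwards [amplitude_zero (testVector_apply_ne (I := I) c r h)] with x hx
    rw [hx, coeff_testTensors_ne c r h]
    rfl

theorem vacuumElement_testTensors {t : CMPOTensors ι} (ht : t.Regular I) {n : ℕ} {c : Fin n → ℝ}
    {r : ℝ} (hr : 0 ≤ r) (hc : Metric.closedBall c r ⊆ orderedConfigs I n) :
    IntegrableOn (t.coeff I fun _ => Ladder.l) (Metric.closedBall c r) ∧
    ((testTensors c r).adj.mul t).vacuumElement I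
      = ∫ x in Metric.closedBall c r, t.coeff I (fun _ => Ladder.l) x := by
  obtain ⟨h1, h2⟩ := CMPOTensors.hasSum_overlap (testTensors_regular (I := I) c r) ht
  have e : (fun x => conj ((testTensors c r).coeff I (fun _ : Fin n => Ladder.l) x) *
      t.coeff I (fun _ => Ladder.l) x)
      = (Metric.closedBall c r).indicator (t.coeff I fun _ => Ladder.l) := by
    funext x
    rw [coeff_testTensors hr]
    by_cases h : x ∈ Metric.closedBall c r <;> simp [h]
  have hm : MeasurableSet (Metric.closedBall c r) := Metric.isClosed_closedBall.measurableSet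
  refine ⟨?_, ?_⟩
  · have := h1 n
    rw [e, integrable_indicator_iff hm, IntegrableOn, Measure.restrict_restrict hm,
      inter_eq_left.2 hc] at this
    exact this
  · rw [← h2.tsum_eq, tsum_eq_single n]
    · rw [e, setIntegral_indicator hm, inter_eq_right.2 hc]
    · intro m hm
      simp [coeff_testTensors_ne c r hm]

end TestVectors

/-! ### The product of a cMPO with its adjoint -/

section ProductOperators

open scoped Matrix.Norms.Operator MatrixTopology

variable {I : Set ℝ} {ι κ κ' : Type} [Fintype ι] [DecidableEq ι] [Fintype κ] [DecidableEq κ]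
  [Fintype κ'] [DecidableEq κ']

/-- A cMPO maps the indicator function of a cube to a matrix product vector. -/
theorem CMPOTensors.isMatrixProduct_toLinearMap (hI : I.OrdConnected) {t : CMPOTensors ι}
    (ht : t.Regular I) {n : ℕ} {c : Fin n → ℝ} {r : ℝ} (hr : 0 ≤ r) :
    IsMatrixProduct (t.toLinearMap ht (testVector I c r)) (t.mul (testTensors c r)) := by
  intro k
  have hu := ht.mul (testTensors_regular (I := I) c r)
  -- The integral of the amplitude over a cube is a matrix element between two test vectors, hence a
  -- vacuum element of the product tensors, and so is the integral of the claimed coefficient.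
  have h := ae_eq_zero_of_setIntegral_closedBall_eq_zero hI (n := k)
    (h := fun x => amplitude (t.toLinearMap ht (testVector I c r)) k x -
      (t.mul (testTensors c r)).coeff I (fun _ => Ladder.l) x) fun c' r' hr' hc' => by
    obtain ⟨h1, h2⟩ := vacuumElement_testTensors hu hr'.le hc'
    have h3 := integrableOn_amplitude (t.toLinearMap ht (testVector I c r)) hc'
    refine ⟨h3.sub h1, ?_⟩
    rw [integral_sub h3 h1, ← h2, ← inner_testVector _ hc', inner_toLinearMap ht, sub_eq_zero]
    exact matrixElement_eq_vacuumElement ht (testTensors_regular c' r') (testTensors_regular c r)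
      (isMatrixProduct_testVector hr'.le) (isMatrixProduct_testVector hr)
  filter_upwards [h] with x hx
  exact sub_eq_zero.1 hx

theorem Matrix.one_prod_apply {α β : Type} [DecidableEq α] [DecidableEq β] (a b : α × β) :
    (1 : Matrix (α × β) (α × β) ℂ) a b
      = (1 : Matrix α α ℂ) a.1 b.1 * (1 : Matrix β β ℂ) a.2 b.2 := by
  rw [← Matrix.one_kronecker_one]
  rfl

/-- Both sides expand to the same sum of Kronecker products, with the tensor factors in a different
order. -/
theorem vacuumElement_assoc {t : CMPOTensors ι} (E : Matrix κ κ ℂ) (F : ℝ → Matrix κ κ ℂ)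
    (E' : Matrix κ' κ' ℂ) (F' : ℝ → Matrix κ' κ' ℂ) :
    ((t.mul (vectorTensors E F)).adj.mul (t.mul (vectorTensors E' F'))).vacuumElement I
      = ((vectorTensors E F).adj.mul ((t.adj.mul t).mul (vectorTensors E' F'))).vacuumElement I := by
  let e : (ι × κ) × (ι × κ') ≃ κ × (ι × ι) × κ' :=
    { toFun := fun p => (p.1.2, (p.1.1, p.2.1), p.2.2)
      invFun := fun p => ((p.2.1.1, p.1), (p.2.1.2, p.2.2))
      left_inv := fun _ => rfl
      right_inv := fun _ => rfl }
  have hone : ∀ {α : Type} [DecidableEq α] (a b : α),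
      conj ((1 : Matrix α α ℂ) a b) = (1 : Matrix α α ℂ) a b := fun a b => by
    rw [Matrix.one_apply]; split_ifs <;> simp
  refine CMPOTensors.vacuumElement_eq_of_reindex e ?_ fun x => ?_
  · ext a b
    simp [CMPOTensors.mul, CMPOTensors.adj, vectorTensors, e]
    ring
  · ext a b
    simp [CMPOTensors.mul, CMPOTensors.adj, vectorTensors, e, Matrix.one_prod_apply, hone]
    ring

theorem inner_toLinearMap_toLinearMap (hI : I.OrdConnected) {t : CMPOTensors ι} (ht : t.Regular I)
    (Φ Ψ : finiteParticle I) :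
    inner ℂ (t.toLinearMap ht Φ) (t.toLinearMap ht Ψ)
      = (t.adj.mul t).matrixElement I (Φ : Fock I) (Ψ : Fock I) := by
  have hs : (t.adj.mul t).Regular I := ht.adj.mul ht
  -- The defect ⟨θ, OΨ⟩ − ⟨θ', Ψ⟩ as a functional of Ψ. The operator may be unbounded, so the
  -- identity is extended from test vectors one argument at a time, with the other held fixed.
  let A : Fock I → Fock I → finiteParticle I →ₗ[ℂ] ℂ := fun θ θ' =>
    (innerSL ℂ θ).toLinearMap ∘ₗ t.toLinearMap ht -
      (innerSL ℂ θ').toLinearMap ∘ₗ (finiteParticle I).subtype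
  have hA : ∀ θ θ' Ψ, A θ θ' Ψ = inner ℂ θ (t.toLinearMap ht Ψ) - inner ℂ θ' (Ψ : Fock I) :=
    fun _ _ _ => rfl
  have bound : ∀ (θ θ' : Fock I) (M : ℕ), ∃ K, ∀ Ψ : finiteParticle I,
      (∀ n, M < n → (Ψ : Fock I) n = 0) → ‖A θ θ' Ψ‖ ≤ K * ‖(Ψ : Fock I)‖ := by
    intro θ θ' M
    obtain ⟨K, hK⟩ := CMPOTensors.exists_norm_toLinearMap_le ht M
    refine ⟨‖θ‖ * K + ‖θ'‖, fun Ψ hΨ => ?_⟩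
    rw [hA]
    calc _ ≤ ‖θ‖ * ‖t.toLinearMap ht Ψ‖ + ‖θ'‖ * ‖(Ψ : Fock I)‖ :=
          (norm_sub_le _ _).trans (add_le_add (norm_inner_le_norm _ _) (norm_inner_le_norm _ _))
      _ ≤ ‖θ‖ * (K * ‖(Ψ : Fock I)‖) + ‖θ'‖ * ‖(Ψ : Fock I)‖ := by
          gcongr
          exact hK Ψ hΨ
      _ = _ := by ring
  have step : ∀ {n : ℕ} {c : Fin n → ℝ} {r : ℝ}, 0 < r → ∀ Φ : finiteParticle I,
      inner ℂ (t.toLinearMap ht Φ) (t.toLinearMap ht (testVector I c r))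
        = inner ℂ (Φ : Fock I) ((t.adj.mul t).toLinearMap hs (testVector I c r)) := by
    intro n c r hr Φ
    have h0 : A (t.toLinearMap ht (testVector I c r))
        ((t.adj.mul t).toLinearMap hs (testVector I c r)) = 0 := by
      refine eq_zero_of_testVector hI (bound _ _) fun m c' r' hr' _ => ?_
      rw [hA, sub_eq_zero, ← inner_conj_symm,
        ← inner_conj_symm (_ : Fock I) (testVector I c' r' : Fock I)]
      congr 1
      rw [(CMPOTensors.isMatrixProduct_toLinearMap hI ht hr'.le).inner_eq
          (ht.mul (testTensors_regular _ _)) (ht.mul (testTensors_regular _ _))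
          (CMPOTensors.isMatrixProduct_toLinearMap hI ht hr.le),
        CMPOTensors.inner_toLinearMap hs,
        CMPOTensors.matrixElement_eq_vacuumElement hs (testTensors_regular c' r')
          (testTensors_regular c r) (isMatrixProduct_testVector hr'.le)
          (isMatrixProduct_testVector hr.le)]
      exact vacuumElement_assoc _ _ _ _
    have h1 := LinearMap.congr_fun h0 Φ
    rw [hA, LinearMap.zero_apply, sub_eq_zero] at h1
    rw [← inner_conj_symm, h1, inner_conj_symm]
  -- The product cMPO is moved to the left vector through its adjoint tensors, so that the
  -- functional again has the form A.
  have h0 : A (t.toLinearMap ht Φ) ((t.adj.mul t).adj.toLinearMap hs.adj Φ) = 0 := by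
    refine eq_zero_of_testVector hI (bound _ _) fun m c r hr _ => ?_
    rw [hA, step hr, CMPOTensors.inner_toLinearMap hs,
      ← inner_conj_symm (_ : Fock I) (testVector I c r : Fock I),
      CMPOTensors.inner_toLinearMap hs.adj, CMPOTensors.matrixElement_adj, Complex.conj_conj,
      sub_self]
  have h1 := LinearMap.congr_fun h0 Ψ
  rw [hA, LinearMap.zero_apply, sub_eq_zero] at h1
  rw [h1, ← inner_conj_symm, CMPOTensors.inner_toLinearMap hs.adj, CMPOTensors.matrixElement_adj,
    Complex.conj_conj]

end ProductOperators

/-! ### Matrix elements determine the coefficients -/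

section UniquenessOfCoefficients

variable {I : Set ℝ} {ι κ : Type} [Fintype ι] [DecidableEq ι] [Fintype κ] [DecidableEq κ]

theorem mem_ketPos {j : ℕ} {α : Fin j → Ladder} {i : Fin j} :
    i ∈ ketPos α ↔ α i = Ladder.l ∨ α i = Ladder.a := by
  simp [ketPos]

theorem mem_braPos {j : ℕ} {α : Fin j → Ladder} {i : Fin j} :
    i ∈ braPos α ↔ α i = Ladder.r ∨ α i = Ladder.a := by
  simp [braPos]

theorem mem_ketPos_or_mem_braPos {j : ℕ} (α : Fin j → Ladder) (i : Fin j) :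
    i ∈ ketPos α ∨ i ∈ braPos α := by
  rw [mem_ketPos, mem_braPos]
  cases α i <;> simp

theorem eq_of_ketPos_eq_of_braPos_eq {j : ℕ} {α β : Fin j → Ladder} (hk : ketPos α = ketPos β)
    (hb : braPos α = braPos β) : α = β := by
  funext i
  have h1 : i ∈ ketPos α ↔ i ∈ ketPos β := by rw [hk]
  have h2 : i ∈ braPos α ↔ i ∈ braPos β := by rw [hb]
  rw [mem_ketPos, mem_ketPos] at h1
  rw [mem_braPos, mem_braPos] at h2
  cases h : α i <;> cases h' : β i <;> simp_all

theorem le_card_ketPos_add_card_braPos {j : ℕ} (α : Fin j → Ladder) :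
    j ≤ (ketPos α).card + (braPos α).card := by
  have h : ketPos α ∪ braPos α = Finset.univ := by
    ext i
    simpa using mem_ketPos_or_mem_braPos α i
  have := Finset.card_union_le (ketPos α) (braPos α)
  rwa [h, Finset.card_univ, Fintype.card_fin] at this

/-- The edges of a cube of ordered configurations are disjoint. -/
theorem add_lt_sub_of_closedBall_subset {j : ℕ} {c : Fin j → ℝ} {r : ℝ} (hr : 0 < r)
    (hc : Metric.closedBall c r ⊆ orderedConfigs I j) {a b : Fin j} (hab : a < b) :
    c a + r < c b - r := by
  let y : Fin j → ℝ := Function.update (Function.update c a (c a + r)) b (c b - r)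
  have hy : y ∈ Metric.closedBall c r := by
    rw [Metric.mem_closedBall, dist_pi_le_iff hr.le]
    intro i
    simp only [y, Function.update_apply]
    split_ifs with h1 h2
    · simp [h1, abs_of_pos hr]
    · simp [h2, abs_of_pos hr]
    · simpa using hr.le
  have h := (hc hy).1 hab
  simpa [y, Function.update_apply, hab.ne, hab.ne'] using h

section Rigidity

variable {j j' : ℕ} {α : Fin j → Ladder} {β : Fin j' → Ladder} {c : Fin j → ℝ} {x : Fin j' → ℝ}
  {r : ℝ}

/-- Every label puts its position on the ket or the bra side, so each edge of the cube catches a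
coordinate of x. -/
theorem exists_near (hk : (ketPos β).card = (ketPos α).card)
    (hb : (braPos β).card = (braPos α).card)
    (h1 : ∀ p, |x ((ketPos β).orderEmbOfFin hk p) - c ((ketPos α).orderEmbOfFin rfl p)| ≤ r)
    (h2 : ∀ p, |x ((braPos β).orderEmbOfFin hb p) - c ((braPos α).orderEmbOfFin rfl p)| ≤ r)
    (b : Fin j) : ∃ i, |x i - c b| ≤ r := by
  rcases mem_ketPos_or_mem_braPos α b with h | h
  · rw [← Finset.mem_coe, ← Finset.range_orderEmbOfFin _ rfl] at h
    obtain ⟨p, rfl⟩ := h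
    exact ⟨_, h1 p⟩
  · rw [← Finset.mem_coe, ← Finset.range_orderEmbOfFin _ rfl] at h
    obtain ⟨p, rfl⟩ := h
    exact ⟨_, h2 p⟩

theorem eq_of_near (hc : ∀ a b, a < b → c a + r < c b - r) {z : ℝ} {a b : Fin j}
    (ha : |z - c a| ≤ r) (hb : |z - c b| ≤ r) : a = b := by
  rw [abs_le] at ha hb
  rcases lt_trichotomy a b with h | h | h
  · linarith [hc a b h]
  · exact h
  · linarith [hc b a h]

/-- Disjoint edges catch distinct coordinates, so a word shorter than α cannot contribute. -/
theorem le_of_near (hc : ∀ a b, a < b → c a + r < c b - r)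
    (hk : (ketPos β).card = (ketPos α).card) (hb : (braPos β).card = (braPos α).card)
    (h1 : ∀ p, |x ((ketPos β).orderEmbOfFin hk p) - c ((ketPos α).orderEmbOfFin rfl p)| ≤ r)
    (h2 : ∀ p, |x ((braPos β).orderEmbOfFin hb p) - c ((braPos α).orderEmbOfFin rfl p)| ≤ r) :
    j ≤ j' := by
  choose i hi using exists_near hk hb h1 h2
  have hinj : Function.Injective i := fun a b h => eq_of_near hc (hi a) (by rw [h]; exact hi b)
  simpa using Fintype.card_le_of_injective i hinj

theorem eq_of_orderEmbOfFin_near {s s' : Finset (Fin j)} {x : Fin j → ℝ} (hs : s.card = s'.card)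
    (hc : ∀ a b, a < b → c a + r < c b - r) (hx : ∀ i, |x i - c i| ≤ r)
    (h : ∀ p, |x (s.orderEmbOfFin hs p) - c (s'.orderEmbOfFin rfl p)| ≤ r) : s = s' := by
  have : (s.orderEmbOfFin hs : Fin s'.card → Fin j) = s'.orderEmbOfFin rfl :=
    funext fun p => eq_of_near hc (hx _) (h p)
  rw [← Finset.coe_inj, ← Finset.range_orderEmbOfFin s hs, this, Finset.range_orderEmbOfFin]

theorem eq_and_near {β : Fin j → Ladder} {x : Fin j → ℝ} (hx : StrictMono x)
    (hc : ∀ a b, a < b → c a + r < c b - r)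
    (hk : (ketPos β).card = (ketPos α).card) (hb : (braPos β).card = (braPos α).card)
    (h1 : ∀ p, |x ((ketPos β).orderEmbOfFin hk p) - c ((ketPos α).orderEmbOfFin rfl p)| ≤ r)
    (h2 : ∀ p, |x ((braPos β).orderEmbOfFin hb p) - c ((braPos α).orderEmbOfFin rfl p)| ≤ r) :
    β = α ∧ ∀ i, |x i - c i| ≤ r := by
  choose i hi using exists_near hk hb h1 h2
  have hmono : StrictMono i := fun a b h => by
    have ha := abs_le.1 (hi a)
    have hb := abs_le.1 (hi b)
    exact hx.lt_iff_lt.1 (by linarith [hc a b h])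
  -- A strictly increasing map from `Fin j` to itself is the identity.
  have hid : i = id := by
    have := Finset.orderEmbOfFin_unique (s := Finset.univ) (by simp) (fun a => Finset.mem_univ _)
      hmono
    have h' := Finset.orderEmbOfFin_unique (s := Finset.univ) (by simp)
      (fun a : Fin j => Finset.mem_univ (id a)) strictMono_id
    rw [this, h']
  have hxc : ∀ a, |x a - c a| ≤ r := fun a => by simpa [hid] using hi a
  exact ⟨eq_of_ketPos_eq_of_braPos_eq (eq_of_orderEmbOfFin_near hk hc hxc h1)
    (eq_of_orderEmbOfFin_near hb hc hxc h2), hxc⟩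

end Rigidity

theorem subAmplitude_testVector {n j : ℕ} (c : Fin n → ℝ) (r : ℝ) (s : Finset (Fin j)) :
    ∀ᵐ x ∂orderedMeasure I j, subAmplitude (testVector I c r : Fock I) s x
      = if h : s.card = n then (Metric.closedBall c r).indicator (fun _ => 1)
          (fun i => x (s.orderEmbOfFin h i)) else 0 := by
  by_cases h : s.card = n
  · subst h
    filter_upwards [(quasiMeasurePreserving_subConfig_ordered s).ae (amplitude_testVector c r)]
      with x hx
    rw [dif_pos rfl, subAmplitude, hx]
    rfl
  · filter_upwards [subAmplitude_zero (testVector_apply_ne (I := I) c r h)] with x hx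
    rw [dif_neg h, hx, Pi.zero_apply]

namespace CMPOTensors

/-- A word β other than α either meets a vanishing amplitude or is longer than α, as when a label
`a` is resolved into an `l` and an `r` at nearby points. The longer words are left to the induction
hypothesis. -/
theorem integrand_testVector_congr {t : CMPOTensors ι} {t' : CMPOTensors κ} {j j' : ℕ}
    {α : Fin j → Ladder} {β : Fin j' → Ladder} {c : Fin j → ℝ} {r : ℝ} (hr : 0 < r)
    (hc : Metric.closedBall c r ⊆ orderedConfigs I j)
    (hne : ∀ h : j' = j, (fun i => β (Fin.cast h.symm i)) ≠ α)
    (ih : j < j' → (ketPos β).card = (ketPos α).card → (braPos β).card = (braPos α).card →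
      t.coeff I β =ᵐ[orderedMeasure I j'] t'.coeff I β) :
    t.integrand (testVector I (subConfig (ketPos α) c) r : Fock I)
        (testVector I (subConfig (braPos α) c) r : Fock I) β
      =ᵐ[orderedMeasure I j']
    t'.integrand (testVector I (subConfig (ketPos α) c) r : Fock I)
        (testVector I (subConfig (braPos α) c) r : Fock I) β := by
  by_cases hk : (ketPos β).card = (ketPos α).card
  swap
  · filter_upwards [subAmplitude_testVector (I := I) (subConfig (ketPos α) c) r (ketPos β)]
      with x hx
    rw [integrand, integrand, hx, dif_neg hk]
    simp
  by_cases hb : (braPos β).card = (braPos α).card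
  swap
  · filter_upwards [subAmplitude_testVector (I := I) (subConfig (braPos α) c) r (braPos β)]
      with x hx
    rw [integrand, integrand, hx, dif_neg hb]
    simp
  rcases lt_or_ge j j' with hj | hj
  · filter_upwards [ih hj hk hb] with x hx
    rw [integrand, integrand, hx]
  · filter_upwards [subAmplitude_testVector (I := I) (subConfig (ketPos α) c) r (ketPos β),
      subAmplitude_testVector (I := I) (subConfig (braPos α) c) r (braPos β), ae_strictMono I j']
      with x h1 h2 hx
    rw [integrand, integrand, h1, h2, dif_pos hk, dif_pos hb]
    by_cases m1 : (fun i => x ((ketPos β).orderEmbOfFin hk i)) ∈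
        Metric.closedBall (subConfig (ketPos α) c) r
    swap
    · rw [indicator_of_notMem m1]; simp
    by_cases m2 : (fun i => x ((braPos β).orderEmbOfFin hb i)) ∈
        Metric.closedBall (subConfig (braPos α) c) r
    swap
    · rw [indicator_of_notMem m2]; simp
    rw [Metric.mem_closedBall, dist_pi_le_iff hr.le] at m1 m2
    have hc' : ∀ a b, a < b → c a + r < c b - r := fun a b h =>
      add_lt_sub_of_closedBall_subset hr hc h
    obtain rfl := le_antisymm hj (le_of_near hc' hk hb m1 m2)
    exact absurd (eq_and_near hx hc' hk hb m1 m2).1 (hne rfl)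

theorem integrand_testVector (t : CMPOTensors ι) {j : ℕ} (α : Fin j → Ladder) {c : Fin j → ℝ}
    {r : ℝ} (hr : 0 < r) :
    t.integrand (testVector I (subConfig (ketPos α) c) r : Fock I)
        (testVector I (subConfig (braPos α) c) r : Fock I) α
      =ᵐ[orderedMeasure I j] (Metric.closedBall c r).indicator (t.coeff I α) := by
  filter_upwards [subAmplitude_testVector (I := I) (subConfig (ketPos α) c) r (ketPos α),
    subAmplitude_testVector (I := I) (subConfig (braPos α) c) r (braPos α)] with x h1 h2
  rw [integrand, h1, h2, dif_pos rfl, dif_pos rfl]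
  by_cases hx : x ∈ Metric.closedBall c r
  · rw [indicator_of_mem hx, indicator_of_mem, indicator_of_mem]
    · simp
    all_goals
      rw [Metric.mem_closedBall, dist_pi_le_iff hr.le] at hx ⊢
      exact fun i => hx _
  · rw [indicator_of_notMem hx]
    by_contra hne
    have m1 : (fun i => x ((ketPos α).orderEmbOfFin rfl i)) ∈
        Metric.closedBall (subConfig (ketPos α) c) r := by
      by_contra m1
      rw [indicator_of_notMem m1] at hne
      simp at hne
    have m2 : (fun i => x ((braPos α).orderEmbOfFin rfl i)) ∈
        Metric.closedBall (subConfig (braPos α) c) r := by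
      by_contra m2
      rw [indicator_of_notMem m2] at hne
      simp at hne
    refine hx ?_
    rw [Metric.mem_closedBall, dist_pi_le_iff hr.le] at m1 m2 ⊢
    intro b
    rcases mem_ketPos_or_mem_braPos α b with h | h
    · rw [← Finset.mem_coe, ← Finset.range_orderEmbOfFin _ rfl] at h
      obtain ⟨p, rfl⟩ := h
      exact m1 p
    · rw [← Finset.mem_coe, ← Finset.range_orderEmbOfFin _ rfl] at h
      obtain ⟨p, rfl⟩ := h
      exact m2 p

/-- In the difference of the two series all terms but that of α cancel. What remains is the integral
of the difference of the coefficients over a cube. -/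
theorem coeff_ae_eq_of_gt (hI : I.OrdConnected) {t : CMPOTensors ι} {t' : CMPOTensors κ}
    (ht : t.Regular I) (ht' : t'.Regular I)
    (h : ∀ Φ ∈ finiteParticle I, ∀ Ψ ∈ finiteParticle I,
      t.matrixElement I Φ Ψ = t'.matrixElement I Φ Ψ) {j : ℕ} (α : Fin j → Ladder)
    (ih : ∀ (j' : ℕ) (β : Fin j' → Ladder), j < j' → (ketPos β).card = (ketPos α).card →
      (braPos β).card = (braPos α).card → t.coeff I β =ᵐ[orderedMeasure I j'] t'.coeff I β) :
    t.coeff I α =ᵐ[orderedMeasure I j] t'.coeff I α := by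
  have key := ae_eq_zero_of_setIntegral_closedBall_eq_zero hI (n := j)
    (h := fun x => t.coeff I α x - t'.coeff I α x) fun c r hr hc => by
    have hm : MeasurableSet (Metric.closedBall c r) := Metric.isClosed_closedBall.measurableSet
    let Φ := testVector I (subConfig (ketPos α) c) r
    let Ψ := testVector I (subConfig (braPos α) c) r
    have hint : ∀ {ι : Type} [Fintype ι] [DecidableEq ι] {t : CMPOTensors ι}, t.Regular I →
        IntegrableOn (t.coeff I α) (Metric.closedBall c r) ∧
        ∫ x in orderedConfigs I j, t.integrand (Φ : Fock I) (Ψ : Fock I) α x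
          = ∫ x in Metric.closedBall c r, t.coeff I α x := by
      intro ι _ _ t ht
      have h1 := integrand_testVector (I := I) t α (c := c) hr
      constructor
      · have := (integrable_integrand ht (Φ : Fock I) (Ψ : Fock I) α).congr h1
        rwa [integrable_indicator_iff hm, IntegrableOn, Measure.restrict_restrict hm,
          inter_eq_left.2 hc] at this
      · rw [integral_congr_ae h1, setIntegral_indicator hm, inter_eq_right.2 hc]
    obtain ⟨i1, e1⟩ := hint ht
    obtain ⟨i2, e2⟩ := hint ht'
    refine ⟨i1.sub i2, ?_⟩
    rw [integral_sub i1 i2, ← e1, ← e2]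
    have h0 := sub_eq_zero.2 (h Φ Φ.2 Ψ Ψ.2)
    rw [matrixElement_eq, matrixElement_eq, ← (summable_matrixElement ht _ Ψ.2).tsum_sub
      (summable_matrixElement ht' _ Ψ.2), tsum_eq_single j, ← Finset.sum_sub_distrib,
      Finset.sum_eq_single α] at h0
    · exact h0
    · intro β _ hβ
      rw [sub_eq_zero]
      exact integral_congr_ae (integrand_testVector_congr hr hc (fun _ => hβ) fun h' =>
        absurd h' (lt_irrefl _))
    · simp
    · intro j' hj'
      rw [← Finset.sum_sub_distrib]
      refine Finset.sum_eq_zero fun β _ => ?_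
      rw [sub_eq_zero]
      exact integral_congr_ae (integrand_testVector_congr hr hc (fun h' => absurd h' hj') (ih j' β))
  filter_upwards [key] with x hx
  exact sub_eq_zero.1 hx

/-- The matrix elements determine the coefficients. -/
theorem coeff_ae_eq (hI : I.OrdConnected) {t : CMPOTensors ι} {t' : CMPOTensors κ}
    (ht : t.Regular I) (ht' : t'.Regular I)
    (h : ∀ Φ ∈ finiteParticle I, ∀ Ψ ∈ finiteParticle I,
      t.matrixElement I Φ Ψ = t'.matrixElement I Φ Ψ) {j : ℕ} (α : Fin j → Ladder) :
    t.coeff I α =ᵐ[orderedMeasure I j] t'.coeff I α := by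
  -- Downward induction on the length. The numbers of ket and bra positions stay fixed while j
  -- grows, and k bounds the room left before j reaches their sum, beyond which no word exists.
  suffices H : ∀ (k j : ℕ) (α : Fin j → Ladder), (ketPos α).card + (braPos α).card ≤ j + k →
      t.coeff I α =ᵐ[orderedMeasure I j] t'.coeff I α from H _ j α (Nat.le_add_left _ _)
  intro k
  induction k with
  | zero =>
    intro j α hα
    refine coeff_ae_eq_of_gt hI ht ht' h α fun j' β hj hk hb => ?_
    have := le_card_ketPos_add_card_braPos β
    omega
  | succ k ih =>
    intro j α hα
    exact coeff_ae_eq_of_gt hI ht ht' h α fun j' β hj hk hb => ih j' β (by omega)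

end CMPOTensors

end UniquenessOfCoefficients

/-! ### Identity coefficients and identity matrix elements -/

section Identity

variable {I : Set ℝ} {ι : Type} [Fintype ι] [DecidableEq ι]

/-! ### The identity as a cMPO -/

/-- The tensors of the identity. -/
def identityTensors : CMPOTensors Unit :=
  ⟨1, fun _ => 0, fun _ => 0, fun _ => 0, fun _ => 1⟩

theorem identityTensors_regular (I : Set ℝ) : identityTensors.Regular I :=
  ⟨fun _ _ => integrable_zero _ _ _, fun _ _ => MemLp.zero', fun _ _ => MemLp.zero',
    fun _ _ => memLp_top_const _⟩

theorem coeff_identityTensors {j : ℕ} (α : Fin j → Ladder) (x : Fin j → ℝ) :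
    identityTensors.coeff I α x = identityCoeff α := by
  have h : ∀ (S : Set ℝ) (l : List (Ladder × ℝ)), identityTensors.word S l
      = if ∀ p ∈ l, p.1 = Ladder.a then 1 else 0 := by
    intro S l
    have hp : ∀ S, pathExp identityTensors.Q S = 1 := fun S => pathExp_zero S
    induction l generalizing S with
    | nil => simpa [CMPOTensors.word] using hp S
    | cons p l ih =>
      obtain ⟨α, x⟩ := p
      rw [CMPOTensors.word, ih, hp]
      have e : (∀ p ∈ (α, x) :: l, p.1 = Ladder.a) ↔ α = Ladder.a ∧ ∀ p ∈ l, p.1 = Ladder.a :=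
        List.forall_mem_cons
      by_cases hα : α = Ladder.a
      · subst hα
        by_cases hl : ∀ p ∈ l, p.1 = Ladder.a
        · rw [if_pos (e.2 ⟨rfl, hl⟩), if_pos hl]
          simp [CMPOTensors.K, identityTensors]
        · rw [if_neg fun h => hl (e.1 h).2, if_neg hl, mul_zero]
      · rw [if_neg fun h => hα (e.1 h).1]
        cases α <;> simp_all [CMPOTensors.K, identityTensors]
  rw [CMPOTensors.coeff, h, identityCoeff]
  simp only [List.forall_mem_ofFn_iff, identityTensors, one_mul]
  split_ifs <;> simp

theorem subAmplitude_univ (Φ : Fock I) {j : ℕ} {s : Finset (Fin j)} (hs : s = Finset.univ)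
    (x : Fin j → ℝ) : subAmplitude Φ s x = amplitude Φ j x := by
  have h : ∀ (k : ℕ) (hk : s.card = k),
      subAmplitude Φ s x = amplitude Φ k fun i => x (s.orderEmbOfFin hk i) := by
    rintro k rfl
    rfl
  have hj : s.card = j := by simp [hs]
  have hid := Finset.orderEmbOfFin_unique (s := s) hj (fun a : Fin j => by simp [hs])
    (strictMono_id (α := Fin j))
  rw [h j hj, ← hid]
  rfl

theorem matrixElement_identityTensors (Φ Ψ : Fock I) :
    identityTensors.matrixElement I Φ Ψ = inner ℂ Φ Ψ := by
  rw [CMPOTensors.matrixElement_eq, ← (hasSum_inner_amplitude Φ Ψ).tsum_eq]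
  refine tsum_congr fun j => ?_
  rw [Finset.sum_eq_single fun _ => Ladder.a]
  · refine integral_congr_ae (.of_forall fun x => ?_)
    dsimp only
    rw [CMPOTensors.integrand, coeff_identityTensors, identityCoeff, if_pos fun _ => rfl, one_mul,
      subAmplitude_univ Φ (by simp [ketPos]), subAmplitude_univ Ψ (by simp [braPos])]
  · intro α _ hα
    have : ¬ ∀ k, α k = Ladder.a := fun h => hα (funext h)
    simp [CMPOTensors.integrand, coeff_identityTensors, identityCoeff, this]
  · simp

theorem HasIdentityCoeffsAE.matrixElement_eq {t : CMPOTensors ι} (h : HasIdentityCoeffsAE I t)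
    (Φ Ψ : Fock I) : t.matrixElement I Φ Ψ = inner ℂ Φ Ψ := by
  rw [← matrixElement_identityTensors, CMPOTensors.matrixElement_eq, CMPOTensors.matrixElement_eq]
  refine tsum_congr fun j => Finset.sum_congr rfl fun α _ => integral_congr_ae ?_
  filter_upwards [h j α] with x hx
  rw [CMPOTensors.integrand, CMPOTensors.integrand, hx, coeff_identityTensors]

/-- The identity is a cMPO of bond dimension one, so the forward direction compares series termwise
and the converse is uniqueness of coefficients. -/
theorem hasIdentityCoeffsAE_iff (hI : I.OrdConnected) {t : CMPOTensors ι} (ht : t.Regular I) :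
    HasIdentityCoeffsAE I t ↔ ∀ Φ ∈ finiteParticle I, ∀ Ψ ∈ finiteParticle I,
      t.matrixElement I Φ Ψ = inner ℂ Φ Ψ := by
  refine ⟨fun h Φ _ Ψ _ => h.matrixElement_eq Φ Ψ, fun h j α => ?_⟩
  filter_upwards [CMPOTensors.coeff_ae_eq hI ht (identityTensors_regular I)
    (fun Φ hΦ Ψ hΨ => (h Φ hΦ Ψ hΨ).trans (matrixElement_identityTensors Φ Ψ).symm) α] with x hx
  rw [hx, coeff_identityTensors]

end Identity

/-! ### Continuity on the closed chamber -/

section Continuity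

open scoped Matrix.Norms.Operator MatrixTopology

variable {I : Set ℝ} {ι : Type} [Fintype ι] [DecidableEq ι]

theorem continuousOn_list_prod_ofFn {X 𝔸 : Type*} [TopologicalSpace X] [TopologicalSpace 𝔸]
    [Monoid 𝔸] [ContinuousMul 𝔸] {s : Set X} {j : ℕ} {f : Fin j → X → 𝔸}
    (hf : ∀ i, ContinuousOn (f i) s) : ContinuousOn (fun x => (List.ofFn fun i => f i x).prod) s := by
  induction j with
  | zero => simpa using continuousOn_const
  | succ j ih =>
    simp only [List.ofFn_succ, List.prod_cons]
    exact (hf 0).mul (ih fun i => hf i.succ)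

theorem mem_closure_interior_orderedConfigs (hI : I.OrdConnected) (hI' : I.Nontrivial) {j : ℕ}
    {x : Fin j → ℝ} (hx : Monotone x) (hxI : ∀ i, x i ∈ I) :
    x ∈ closure {y : Fin j → ℝ | StrictMono y ∧ ∀ i, y i ∈ interior I} := by
  obtain ⟨a, ha, b, hb, hab⟩ := hI'.exists_lt
  -- An equally spaced point strictly between a and b. Moving x slightly towards y makes the
  -- coordinates strictly increasing and interior, by convexity of I.
  let y : Fin j → ℝ := fun i => a + (b - a) * ((i + 1) / (j + 1))
  have hba : 0 < b - a := sub_pos.2 hab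
  have hj : (0 : ℝ) < j + 1 := by positivity
  have hy : StrictMono y := fun i k hik => by
    have : (i : ℝ) < k := by exact_mod_cast hik
    simp only [y]
    gcongr
  have hyI : ∀ i, y i ∈ interior I := fun i => by
    refine interior_mono (hI.out ha hb) ?_
    rw [interior_Icc]
    have hi : ((i : ℕ) : ℝ) < j := by exact_mod_cast i.2
    have h0 : (0 : ℝ) < (i + 1) / (j + 1) := by positivity
    have h1 : ((i : ℝ) + 1) / (j + 1) < 1 := (div_lt_one hj).2 (by linarith)
    constructor
    · simp only [y]; nlinarith [mul_pos hba h0]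
    · simp only [y]; nlinarith [mul_lt_mul_of_pos_left h1 hba]
  have hlim : Filter.Tendsto (fun ε : ℝ => (1 - ε) • x + ε • y) (nhdsWithin 0 (Ioo 0 1))
      (nhds x) := by
    have : Continuous fun ε : ℝ => (1 - ε) • x + ε • y := by fun_prop
    have h := this.tendsto 0
    simp only [sub_zero, one_smul, zero_smul, add_zero] at h
    exact h.mono_left nhdsWithin_le_nhds
  have hne : (nhdsWithin (0 : ℝ) (Ioo 0 1)).NeBot := by
    rw [nhdsWithin_Ioo_eq_nhdsGT one_pos]
    infer_instance
  refine mem_closure_of_tendsto hlim ?_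
  filter_upwards [self_mem_nhdsWithin] with ε hε
  refine ⟨fun i k hik => ?_, fun i => ?_⟩
  · simp only [Pi.add_apply, Pi.smul_apply, smul_eq_mul]
    exact add_lt_add_of_le_of_lt (mul_le_mul_of_nonneg_left (hx hik.le) (by linarith [hε.2]))
      (mul_lt_mul_of_pos_left (hy hik) hε.1)
  · exact hI.convex.combo_self_interior_mem_interior (hxI i) (hyI i) (by linarith [hε.2]) hε.1
      (by ring)

theorem hasIdentityCoeffs_iff (hI : I.OrdConnected) (hI' : I.Nontrivial) {t : CMPOTensors ι}
    (ht : t.Regular I) (hc : t.ContinuousLRT I) :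
    HasIdentityCoeffs I t ↔ HasIdentityCoeffsAE I t := by
  constructor
  · intro h j α
    filter_upwards [ae_mem_orderedConfigs hI.measurableSet j] with x hx
    exact h j α x hx.1.monotone hx.2
  · intro h j α x hx hxI
    have hQ := ht.integrable_Q
    -- F agrees with the coefficient at monotone points and is visibly continuous, so its value
    -- passes from the open chamber to the closed one.
    set F : (Fin j → ℝ) → ℂ := fun x => Matrix.trace (t.B *
      ((List.ofFn fun i => t.dressed I (α i) (x i)).prod * orderedExp t.Q (volume.restrict I)))
    have hF : ContinuousOn F {y | Monotone y ∧ ∀ i, y i ∈ I} := by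
      refine (traceCLM t.B (orderedExp t.Q (volume.restrict I))).continuous.comp_continuousOn
        (continuousOn_list_prod_ofFn fun i => ?_)
      exact (CMPOTensors.continuousOn_dressed hQ hc (α i)).comp (continuous_apply i).continuousOn
        fun y hy => hy.2 i
    have hsub : {y : Fin j → ℝ | StrictMono y ∧ ∀ i, y i ∈ interior I} ⊆
        {y | Monotone y ∧ ∀ i, y i ∈ I} := fun y hy =>
      ⟨hy.1.monotone, fun i => interior_subset (hy.2 i)⟩
    have hU : IsOpen {y : Fin j → ℝ | StrictMono y ∧ ∀ i, y i ∈ interior I} := by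
      simp only [StrictMono, ofPred_and, ofPred_forall]
      refine .inter ?_ ?_
      · exact isOpen_iInter_of_finite fun i => isOpen_iInter_of_finite fun j =>
          isOpen_iInter_of_finite fun _ => isOpen_lt (continuous_apply i) (continuous_apply j)
      · exact isOpen_iInter_of_finite fun i => isOpen_interior.preimage (continuous_apply i)
    have h1 : EqOn F (fun _ => identityCoeff α)
        {y : Fin j → ℝ | StrictMono y ∧ ∀ i, y i ∈ interior I} := by
      refine Measure.eqOn_open_of_ae_eq (μ := volume) ?_ hU (hF.mono hsub) continuousOn_const
      have hle : {y : Fin j → ℝ | StrictMono y ∧ ∀ i, y i ∈ interior I} ⊆ orderedConfigs I j :=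
        fun y hy => ⟨hy.1, fun i => interior_subset (hy.2 i)⟩
      filter_upwards [ae_restrict_of_ae_restrict_of_subset hle (h j α),
        ae_restrict_mem hU.measurableSet] with y hy hm
      rw [← hy, CMPOTensors.coeff_eq hQ α hm.1.monotone]
    have h2 := h1.of_subset_closure hF continuousOn_const hsub fun y hy =>
      mem_closure_interior_orderedConfigs hI hI' hy.1 hy.2
    rw [CMPOTensors.coeff_eq hQ α hx]
    exact h2 ⟨hx, hxI⟩

end Continuity

/-! ### Isometries, adjoints and unitarity -/

theorem LinearMap.inner_map_map_of_norm_map {E : Type*} [NormedAddCommGroup E]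
    [InnerProductSpace ℂ E] {p : Submodule ℂ E} {S : p →ₗ[ℂ] E} (h : ∀ x, ‖S x‖ = ‖(x : E)‖)
    (x y : p) : inner ℂ (S x) (S y) = inner ℂ (x : E) (y : E) :=
  (LinearMap.norm_map_iff_inner_map_map S).1 h x y

section Operators

variable {I : Set ℝ} {ι κ : Type} [Fintype ι] [DecidableEq ι] [Fintype κ] [DecidableEq κ]

/-- The cMPO as an operator with domain the finite-particle vectors. -/
noncomputable def CMPOTensors.toLinearPMap (t : CMPOTensors ι) (ht : t.Regular I) :
    Fock I →ₗ.[ℂ] Fock I :=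
  ⟨finiteParticle I, t.toLinearMap ht⟩

theorem CMPOTensors.isCMPO_toLinearPMap {t : CMPOTensors ι} (ht : t.Regular I) :
    IsCMPO I t (t.toLinearPMap ht) :=
  ⟨rfl, fun Φ _ Ψ => inner_toLinearMap ht Φ Ψ⟩

theorem IsCMPO.eq_toLinearPMap {t : CMPOTensors ι} (ht : t.Regular I) {O : Fock I →ₗ.[ℂ] Fock I}
    (hO : IsCMPO I t O) : O = t.toLinearPMap ht := by
  refine LinearPMap.ext hO.1 fun Ψ h1 h2 => ?_
  refine (dense_finiteParticle I).eq_of_inner_right ℂ fun Φ hΦ => ?_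
  exact (hO.2 Φ hΦ ⟨Ψ, h1⟩).trans (CMPOTensors.inner_toLinearMap ht Φ ⟨Ψ, h2⟩).symm

theorem CMPOTensors.inner_toLinearMap_adj {t : CMPOTensors ι} (ht : t.Regular I)
    (Φ : finiteParticle I) (Ψ : finiteParticle I) :
    inner ℂ (t.adj.toLinearMap ht.adj Φ) (Ψ : Fock I) = inner ℂ (Φ : Fock I) (t.toLinearMap ht Ψ) := by
  rw [← inner_conj_symm, inner_toLinearMap, inner_toLinearMap, matrixElement_adj, Complex.conj_conj]

/-- The adjoint of a cMPO extends the cMPO with the adjoint tensors. -/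
theorem CMPOTensors.toLinearPMap_adj_le_adjoint {t : CMPOTensors ι} (ht : t.Regular I) :
    t.adj.toLinearPMap ht.adj ≤ (t.toLinearPMap ht).adjoint :=
  LinearPMap.IsFormalAdjoint.le_adjoint (dense_finiteParticle I)
    (LinearPMap.IsFormalAdjoint.symm fun Φ Ψ => inner_toLinearMap_adj ht Φ Ψ)

theorem CMPOTensors.adjointMulSelfIsCMPO_of_le (hI : I.OrdConnected) {t : CMPOTensors ι}
    (ht : t.Regular I) {A : Fock I →ₗ.[ℂ] Fock I} (hA : t.toLinearPMap ht ≤ A) :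
    AdjointMulSelfIsCMPO I A (t.adj.mul t) := by
  refine ⟨ht.adj.mul ht, hA.1, fun Φ Ψ hΦ hΨ => ?_⟩
  have h1 : t.toLinearMap ht ⟨Φ, hΦ⟩ = A Φ := hA.2 (x := ⟨Φ, hΦ⟩) rfl
  have h2 : t.toLinearMap ht ⟨Ψ, hΨ⟩ = A Ψ := hA.2 (x := ⟨Ψ, hΨ⟩) rfl
  rw [← h1, ← h2]
  exact inner_toLinearMap_toLinearMap hI ht ⟨Φ, hΦ⟩ ⟨Ψ, hΨ⟩

/-- Identity matrix elements of A†A mean that A preserves inner products of finite-particle vectors;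
by polarisation it is enough to preserve norms. Allowing A to extend the cMPO covers the Hilbert
space adjoint. -/
theorem AdjointMulSelfIsCMPO.hasIdentityCoeffsAE_iff (hI : I.OrdConnected) {t : CMPOTensors ι}
    (ht : t.Regular I) {A : Fock I →ₗ.[ℂ] Fock I} (hA : t.toLinearPMap ht ≤ A)
    {s : CMPOTensors κ} (hs : AdjointMulSelfIsCMPO I A s) :
    HasIdentityCoeffsAE I s ↔ ∀ Φ : finiteParticle I, ‖t.toLinearMap ht Φ‖ = ‖(Φ : Fock I)‖ := by
  have h : ∀ Φ Ψ : finiteParticle I, inner ℂ (t.toLinearMap ht Φ) (t.toLinearMap ht Ψ)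
      = s.matrixElement I (Φ : Fock I) (Ψ : Fock I) := fun Φ Ψ => by
    have h1 : t.toLinearMap ht Φ = A ⟨Φ, hA.1 Φ.2⟩ := hA.2 rfl
    have h2 : t.toLinearMap ht Ψ = A ⟨Ψ, hA.1 Ψ.2⟩ := hA.2 rfl
    rw [h1, h2]
    exact hs.2.2 ⟨Φ, hA.1 Φ.2⟩ ⟨Ψ, hA.1 Ψ.2⟩ Φ.2 Ψ.2
  rw [_root_.hasIdentityCoeffsAE_iff hI hs.1]
  constructor
  · intro H Φ
    have := (h Φ Φ).trans (H Φ Φ.2 Φ Φ.2)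
    rw [inner_self_eq_norm_sq_to_K, inner_self_eq_norm_sq_to_K] at this
    have h2 : ‖t.toLinearMap ht Φ‖ ^ 2 = ‖(Φ : Fock I)‖ ^ 2 := by exact_mod_cast this
    exact (sq_eq_sq₀ (norm_nonneg _) (norm_nonneg _)).1 h2
  · intro H Φ hΦ Ψ hΨ
    rw [← h ⟨Φ, hΦ⟩ ⟨Ψ, hΨ⟩]
    exact LinearMap.inner_map_map_of_norm_map H ⟨Φ, hΦ⟩ ⟨Ψ, hΨ⟩

/-- An isometry on a dense space need not extend to a surjection; isometry of the formal adjoint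
supplies what is missing. -/
theorem isUnitaryOp_iff {t : CMPOTensors ι} (ht : t.Regular I) :
    IsUnitaryOp (t.toLinearPMap ht) ↔
      (∀ Φ : finiteParticle I, ‖t.toLinearMap ht Φ‖ = ‖(Φ : Fock I)‖) ∧
      ∀ Φ : finiteParticle I, ‖t.adj.toLinearMap ht.adj Φ‖ = ‖(Φ : Fock I)‖ := by
  have hdense := dense_finiteParticle I
  constructor
  · rintro ⟨U, hU, h⟩
    have h1 : ∀ Φ : finiteParticle I, U Φ = t.toLinearMap ht Φ := h
    have h2 : ∀ Φ : finiteParticle I, star U (Φ : Fock I) = t.adj.toLinearMap ht.adj Φ := fun Φ => by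
      refine hdense.eq_of_inner_left ℂ fun Ψ hΨ => ?_
      rw [ContinuousLinearMap.star_eq_adjoint, ContinuousLinearMap.adjoint_inner_left,
        CMPOTensors.inner_toLinearMap_adj ht Φ ⟨Ψ, hΨ⟩, ← h1]
    refine ⟨fun Φ => ?_, fun Φ => ?_⟩
    · rw [← h1]
      exact ContinuousLinearMap.norm_map_of_mem_unitary hU _
    · rw [← h2]
      exact ContinuousLinearMap.norm_map_of_mem_unitary (Unitary.star_mem hU) _
  · rintro ⟨h1, h2⟩
    have ext : ∀ {S : finiteParticle I →ₗ[ℂ] Fock I}, (∀ Φ, ‖S Φ‖ = ‖(Φ : Fock I)‖) →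
        ∃ V : Fock I →L[ℂ] Fock I, (∀ Φ : finiteParticle I, V Φ = S Φ) ∧ ∀ x, ‖V x‖ = ‖x‖ := by
      intro S hS
      have hr : DenseRange (finiteParticle I).subtype := hdense.denseRange_val
      have hV : ∀ Φ : finiteParticle I, S.extendOfNorm (finiteParticle I).subtype Φ = S Φ :=
        fun Φ => LinearMap.extendOfNorm_eq hr ⟨1, fun Φ => by rw [one_mul]; exact (hS Φ).le⟩ Φ
      refine ⟨_, hV, fun x => ?_⟩
      refine congrFun (Continuous.ext_on hdense
        (f := fun x => ‖S.extendOfNorm (finiteParticle I).subtype x‖) (by fun_prop)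
        continuous_norm fun Φ hΦ => ?_) x
      exact (congrArg norm (hV ⟨Φ, hΦ⟩)).trans (hS ⟨Φ, hΦ⟩)
    obtain ⟨V, hV, nV⟩ := ext h1
    obtain ⟨W, hW, nW⟩ := ext h2
    -- The formal adjoint relation on the dense space passes to the extensions. Then V*V = 1 and VV*
    -- = W*W = 1.
    have hVW : star V = W := by
      rw [ContinuousLinearMap.star_eq_adjoint]
      refine ContinuousLinearMap.ext_on (hdense.mono Submodule.subset_span) fun Φ hΦ => ?_
      refine hdense.eq_of_inner_left ℂ fun Ψ hΨ => ?_
      rw [ContinuousLinearMap.adjoint_inner_left, hV ⟨Ψ, hΨ⟩, hW ⟨Φ, hΦ⟩]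
      exact (CMPOTensors.inner_toLinearMap_adj ht ⟨Φ, hΦ⟩ ⟨Ψ, hΨ⟩).symm
    refine ⟨V, Unitary.mem_iff.2 ⟨?_, ?_⟩, hV⟩
    · rw [ContinuousLinearMap.star_eq_adjoint]
      exact (ContinuousLinearMap.norm_map_iff_adjoint_comp_self V).1 nV
    · have h := (ContinuousLinearMap.norm_map_iff_adjoint_comp_self W).1 nW
      rw [← ContinuousLinearMap.star_eq_adjoint, ← hVW, star_star] at h
      exact h

end Operators

theorem mainTheorem3 {I : Set ℝ} (hI : I.OrdConnected) (hI' : I.Nontrivial)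
    {ι : Type} [Fintype ι] [DecidableEq ι] (t : CMPOTensors ι) (ht : t.Regular I) :
    (∃! O : Fock I →ₗ.[ℂ] Fock I, IsCMPO I t O) ∧
    ∀ O : Fock I →ₗ.[ℂ] Fock I, IsCMPO I t O →
      AdjointMulSelfIsCMPO I O (t.adj.mul t) ∧
      AdjointMulSelfIsCMPO I O.adjoint (t.mul t.adj) ∧
      ∀ {κ₁ κ₂ : Type} [Fintype κ₁] [DecidableEq κ₁] [Fintype κ₂] [DecidableEq κ₂]
        (tp : CMPOTensors κ₁) (tm : CMPOTensors κ₂),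
        AdjointMulSelfIsCMPO I O tp → AdjointMulSelfIsCMPO I O.adjoint tm →
          (IsUnitaryOp O ↔ HasIdentityCoeffsAE I tp ∧ HasIdentityCoeffsAE I tm) ∧
          (tp.ContinuousLRT I → tm.ContinuousLRT I →
            (IsUnitaryOp O ↔ HasIdentityCoeffs I tp ∧ HasIdentityCoeffs I tm)) := by
  refine ⟨⟨t.toLinearPMap ht, CMPOTensors.isCMPO_toLinearPMap ht, fun O hO =>
    hO.eq_toLinearPMap ht⟩, fun O hO => ?_⟩
  obtain rfl := hO.eq_toLinearPMap ht
  have hadj := CMPOTensors.toLinearPMap_adj_le_adjoint ht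
  -- OO† is A†A for A = O†, which extends the cMPO with adjoint tensors; taking the adjoint tensors
  -- twice gives back t.
  have h2 := CMPOTensors.adjointMulSelfIsCMPO_of_le hI ht.adj hadj
  rw [CMPOTensors.adj_adj] at h2
  refine ⟨CMPOTensors.adjointMulSelfIsCMPO_of_le hI ht le_rfl, h2, fun tp tm hp hm => ?_⟩
  have key : IsUnitaryOp (t.toLinearPMap ht) ↔
      HasIdentityCoeffsAE I tp ∧ HasIdentityCoeffsAE I tm := by
    rw [isUnitaryOp_iff, hp.hasIdentityCoeffsAE_iff hI ht le_rfl,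
      hm.hasIdentityCoeffsAE_iff hI ht.adj hadj]
  refine ⟨key, fun cp cm => ?_⟩
  rw [key, hasIdentityCoeffs_iff hI hI' hp.1 cp, hasIdentityCoeffs_iff hI hI' hm.1 cm]
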